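/- Let $G$ be a nonamenable locally compact second countable (lcsc) group and let $\nu$ be a probability measure on $G$ that is equivalent with the Haar measure. Assume that the convolution operator $\lambda(\nu) = \int_G \lambda(g)\, d\nu(g)$ on $L^2(G)$, where $\lambda$ is the left regular representation, satisfies $\|\lambda(\nu)\| < 1/3$. Let $\mathbb{F}_2$ be the free group with free generators $a,b$ and consider the Bernoulli action $\mathbb{F}_2 \curvearrowright (X,\mu) = (G \times G, \nu \times \nu)^{\mathbb{F}_2}$, $(s \cdot x)_t = x_{s^{-1}t}$. Consider the action $\mathbb{F}_2 \times G \curvearrowright (\Omega,\gamma) = (X \times G, \mu \times \nu)$ given by $$a \cdot (x,h) = (a \cdot x, (x_e)_1 h), \qquad b \cdot (x,h) = (b \cdot x, (x_e)_2 h), \qquad g \cdot (x,h) = (x, hg^{-1}) \quad (g \in G).$$ 1. This action is a measure equivalence embedding of $\mathbb{F}_2$ into $G$. That is, it is a nonsingular action on a standard probability space; the actions $\mathbb{F}_2 \curvearrowright \Omega$ and $G \curvearrowright \Omega$ are both dissipative and essentially free; and the action $\mathbb{F}_2 \curvearrowright \Omega/G$ admits an equivalent invariant probability measure. Here a nonsingular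 action $H \curvearrowright (\Omega,\gamma)$ of an lcsc group with left Haar measure $\lambda_H$ is called dissipative and essentially free if there are a standard probability space $(Y,\eta)$ and a nonsingular isomorphism $\theta : (H \times Y, \lambda_H \times \eta) \to (\Omega,\gamma)$ such that for every $h \in H$, $\theta(hk,y) = h \cdot \theta(k,y)$ for a.e. $(k,y)$. 2. This embedding is weakly mixing: the nonsingular action $G \curvearrowright \mathbb{F}_2 \backslash \Omega$ is essentially free and weakly mixing, meaning that for every ergodic probability measure preserving (pmp) action $G \curvearrowright (Z,\zeta)$ on a standard probability space, the diagonal action $G \curvearrowright \mathbb{F}_2 \backslash \Omega \times Z$ is ergodic. 3. This embedding is stably strongly ergodic: the action $G \curvearrowright \mathbb{F}_2 \backslash \Omega$ is strongly ergodic, and for every strongly ergodic pmp action $G \curvearrowright (Z,\zeta)$ on a standard probability space, the diagonal action $G \curvearrowright \mathbb{F}_2 \backslash \Omega \times Z$ is strongly ergodic. Here a nonsingular action $G \curvearrowright (Y,\eta)$ on a probability space is called strongly ergodic if every bounded sequence $F_n \in L^\infty(Y,\eta)$ with $\|F_n(g \,\cdot) - F_n\|_1 \to 0$ uniformly on compact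 sets of $g \in G$ satisfies $\|F_n - \eta(F_n)1\|_1 \to 0$. -/

import Mathlib

open MeasureTheory Filter Topology
open scoped ENNReal BoundedContinuousFunction

universe w u

noncomputable section

/-! ### Amenability and convolution operators -/

/-- A topological group is amenable if its space of bounded continuous real functions carries a
left invariant mean. -/
def IsAmenableGroup (G : Type*) [Group G] [TopologicalSpace G] [IsTopologicalGroup G] : Prop :=
  ∃ m : (G →ᵇ ℝ) →ₗ[ℝ] ℝ,
    (∀ f : G →ᵇ ℝ, 0 ≤ f → 0 ≤ m f) ∧
    m (BoundedContinuousFunction.const G 1) = 1 ∧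
    ∀ (g : G) (f : G →ᵇ ℝ), m (f.compContinuous (ContinuousMap.mulLeft g)) = m f

section Convolution

variable {G : Type*} [Group G] [TopologicalSpace G] [IsTopologicalGroup G]
  [LocallyCompactSpace G] [MeasurableSpace G] [BorelSpace G]

/-- The left regular representation on `L²(G)` (for a left Haar measure):
`(leftRegular g ξ) h = ξ (g⁻¹ * h)`. -/
def leftRegular (g : G) (ξ : Lp ℂ 2 (Measure.haar : Measure G)) :
    Lp ℂ 2 (Measure.haar : Measure G) :=
  DomMulAct.mk g⁻¹ • ξ

theorem leftRegular_coeFn (g : G) (ξ : Lp ℂ 2 (Measure.haar : Measure G)) :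
    leftRegular g ξ =ᵐ[Measure.haar] fun h => ξ (g⁻¹ * h) :=
  DomMulAct.smul_Lp_ae_eq _ _

theorem integrable_leftRegular [SecondCountableTopology G] (ν : Measure G)
    [IsProbabilityMeasure ν] (ξ : Lp ℂ 2 (Measure.haar : Measure G)) :
    Integrable (fun g => leftRegular g ξ) ν := by
  have hc : Continuous fun g : G => leftRegular g ξ := by
    unfold leftRegular
    have h : Continuous fun g : G => (DomMulAct.mk g⁻¹ : Gᵈᵐᵃ) :=
      DomMulAct.continuous_mk.comp continuous_inv
    have : Fact ((2 : ℝ≥0∞) ≠ ∞) := ⟨by simp⟩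
    exact h.smul continuous_const
  refine Integrable.of_bound hc.aestronglyMeasurable ‖ξ‖ (ae_of_all _ fun g => ?_)
  exact (DomMulAct.norm_smul_Lp _ ξ).le

/-- The convolution operator `λ(ν) = ∫ λ(g) dν(g)` on `L²(G)` of a probability measure `ν`, where
`λ` is the left regular representation. -/
def convolutionOperator [SecondCountableTopology G] (ν : Measure G) [IsProbabilityMeasure ν] :
    Lp ℂ 2 (Measure.haar : Measure G) →L[ℂ] Lp ℂ 2 (Measure.haar : Measure G) :=
  LinearMap.mkContinuous
    { toFun := fun ξ => ∫ g, leftRegular g ξ ∂ν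
      map_add' := fun ξ η => by
        rw [← integral_add (integrable_leftRegular ν ξ) (integrable_leftRegular ν η)]
        exact integral_congr_ae (ae_of_all _ fun g => smul_add _ ξ η)
      map_smul' := fun c ξ => by
        rw [RingHom.id_apply, ← integral_smul]
        exact integral_congr_ae (ae_of_all _ fun g => smul_comm _ c ξ) }
    1 (fun ξ => by
      have h := norm_integral_le_of_norm_le_const (μ := ν) (f := fun g => leftRegular g ξ)
        (ae_of_all _ fun g => (DomMulAct.norm_smul_Lp (DomMulAct.mk g⁻¹) ξ).le)
      simpa using h)

end Convolution

/-! ### Orbit spaces -/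

/-- The orbit space of an action of `H` on `Ω`. -/
def OrbitSpace (H Ω : Type*) [Group H] [MulAction H Ω] : Type _ :=
  MulAction.orbitRel.Quotient H Ω

namespace OrbitSpace

variable {H G Ω : Type*} [Group H] [Group G] [MulAction H Ω] [MulAction G Ω]

/-- The orbit map. -/
def mk (H : Type*) {Ω : Type*} [Group H] [MulAction H Ω] (ω : Ω) : OrbitSpace H Ω :=
  (Quotient.mk'' ω : MulAction.orbitRel.Quotient H Ω)

/-- The quotient `σ`-algebra: a set of orbits is measurable iff the union of these orbits is. -/
instance [MeasurableSpace Ω] : MeasurableSpace (OrbitSpace H Ω) :=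
  MeasurableSpace.map (mk H) inferInstance

/-- The action on the `H`-orbits induced by an action of `G` that commutes with `H`. -/
instance [SMulCommClass H G Ω] : MulAction G (OrbitSpace H Ω) where
  smul g := Quotient.map' (fun ω => g • ω) (by
    rintro ω ω' ⟨h, rfl⟩
    exact ⟨h, smul_comm h g ω'⟩)
  one_smul := by
    rintro ⟨ω⟩
    exact congrArg (mk H) (one_smul G ω)
  mul_smul := by
    rintro g g' ⟨ω⟩
    exact congrArg (mk H) (mul_smul g g' ω)

theorem smul_mk [SMulCommClass H G Ω] (g : G) (ω : Ω) : g • mk H ω = mk H (g • ω) := rfl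

/-- The image on the orbit space of a measure `γ` on `Ω`; only its measure class matters. -/
def measure (H : Type*) {Ω : Type*} [Group H] [MulAction H Ω] [MeasurableSpace Ω]
    (γ : Measure Ω) : Measure (OrbitSpace H Ω) :=
  γ.map (mk H)

end OrbitSpace

/-! ### Nonsingular actions -/

section Actions

variable (G : Type*) [Group G]

/-- Every group element acts by a measurable map that preserves the measure class. (The class is
then preserved in both directions, since `g⁻¹` acts in this way as well.) -/
def IsNonsingular {Y : Type*} [MeasurableSpace Y] [MulAction G Y] (η : Measure Y) : Prop :=
  ∀ g : G, Measure.QuasiMeasurePreserving (fun y : Y => g • y) η η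

/-- A nonsingular action with a jointly measurable action map. -/
def IsNonsingularAction [MeasurableSpace G] {Y : Type*} [MeasurableSpace Y] [MulAction G Y]
    (η : Measure Y) : Prop :=
  Measurable (fun p : G × Y => p.1 • p.2) ∧ IsNonsingular G η

/-- Almost every point has a trivial stabilizer. -/
def IsEssentiallyFree {Y : Type*} [MeasurableSpace Y] [MulAction G Y] (η : Measure Y) : Prop :=
  ∀ᵐ y ∂η, ∀ g : G, g • y = y → g = 1

/-- Ergodicity: every measurable set that is invariant up to null sets is null or conull. -/
def IsErgodicAction {Y : Type*} [MeasurableSpace Y] [MulAction G Y] (η : Measure Y) : Prop :=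
  ∀ A : Set Y, MeasurableSet A → (∀ g : G, (fun y : Y => g • y) ⁻¹' A =ᵐ[η] A) →
    η A = 0 ∨ η Aᶜ = 0

/-- Strong ergodicity: every bounded sequence `Fₙ` in `L^∞(Y, η)` such that
`‖Fₙ ∘ g - Fₙ‖₁ → 0` uniformly on compact sets of `g ∈ G`, satisfies `‖Fₙ - η(Fₙ) 1‖₁ → 0`. -/
def IsStronglyErgodicAction [TopologicalSpace G] {Y : Type*} [MeasurableSpace Y] [MulAction G Y]
    (η : Measure Y) : Prop :=
  ∀ (F : ℕ → Y → ℂ) (C : ℝ), (∀ n, AEStronglyMeasurable (F n) η) →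
    (∀ n, ∀ᵐ y ∂η, ‖F n y‖ ≤ C) →
    (∀ K : Set G, IsCompact K →
      TendstoUniformlyOn (fun n g => ∫ y, ‖F n (g • y) - F n y‖ ∂η) (fun _ => 0) atTop K) →
    Tendsto (fun n => ∫ y, ‖F n y - ∫ z, F n z ∂η‖ ∂η) atTop (𝓝 0)

/-- A probability measure preserving action on a standard probability space. -/
structure IsPMPAction [MeasurableSpace G] {Z : Type*} [MeasurableSpace Z] [MulAction G Z]
    (ζ : Measure Z) : Prop where
  standardBorel : StandardBorelSpace Z
  isProbabilityMeasure : IsProbabilityMeasure ζ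
  measurable : Measurable (fun p : G × Z => p.1 • p.2)
  measurePreserving : ∀ g : G, MeasurePreserving (fun z : Z => g • z) ζ ζ

/-- Weak mixing: the diagonal product with every ergodic pmp action `G ↷ (Z, ζ)` is ergodic. -/
def IsWeaklyMixingAction.{w', u', v'} (G : Type u') [Group G] [MeasurableSpace G]
    {Y : Type v'} [MeasurableSpace Y] [MulAction G Y] (η : Measure Y) : Prop :=
  ∀ (Z : Type w') [MeasurableSpace Z] [MulAction G Z] (ζ : Measure Z),
    IsPMPAction G ζ → IsErgodicAction G ζ → IsErgodicAction G (η.prod ζ)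

/-- Stable strong ergodicity: the action is strongly ergodic and the diagonal product with every
strongly ergodic pmp action `G ↷ (Z, ζ)` is strongly ergodic. -/
def IsStablyStronglyErgodicAction.{w', u', v'} (G : Type u') [Group G] [TopologicalSpace G]
    [MeasurableSpace G] {Y : Type v'} [MeasurableSpace Y] [MulAction G Y] (η : Measure Y) : Prop :=
  IsStronglyErgodicAction G η ∧
  ∀ (Z : Type w') [MeasurableSpace Z] [MulAction G Z] (ζ : Measure Z),
    IsPMPAction G ζ → IsStronglyErgodicAction G ζ → IsStronglyErgodicAction G (η.prod ζ)

end Actions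

/-! ### Correspondences and measure equivalence embeddings -/

/-- A nonsingular action `H ↷ (Ω, γ)` is dissipative and essentially free if, for some standard
probability space `(Y, η)`, there is a nonsingular isomorphism `θ : (H × Y, λ × η) → (Ω, γ)`, with
`λ` a left Haar measure of `H`, such that for all `h`, `θ (h * k, y) = h • θ (k, y)` for a.e.
`(k, y)`. Here `θ'` is an almost everywhere inverse of `θ`. -/
def IsDissipativeEssentiallyFree.{u', v'} (H : Type u') [Group H] [TopologicalSpace H] [IsTopologicalGroup H]
    [LocallyCompactSpace H] [MeasurableSpace H] [BorelSpace H] {Ω : Type v'} [MeasurableSpace Ω]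
    [MulAction H Ω] (γ : Measure Ω) : Prop :=
  ∃ (Y : Type v') (_ : MeasurableSpace Y) (_ : StandardBorelSpace Y) (η : Measure Y)
    (_ : IsProbabilityMeasure η) (θ : H × Y → Ω) (θ' : Ω → H × Y),
    Measure.QuasiMeasurePreserving θ ((Measure.haar : Measure H).prod η) γ ∧
    Measure.QuasiMeasurePreserving θ' γ ((Measure.haar : Measure H).prod η) ∧
    (∀ᵐ p ∂((Measure.haar : Measure H).prod η), θ' (θ p) = p) ∧
    (∀ᵐ ω ∂γ, θ (θ' ω) = ω) ∧
    ∀ h : H, ∀ᵐ p ∂((Measure.haar : Measure H).prod η), θ (h * p.1, p.2) = h • θ p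

section ME

variable (H G : Type*) [Group H] [TopologicalSpace H] [IsTopologicalGroup H]
  [LocallyCompactSpace H] [MeasurableSpace H] [BorelSpace H]
  [Group G] [TopologicalSpace G] [IsTopologicalGroup G]
  [LocallyCompactSpace G] [MeasurableSpace G] [BorelSpace G]
  {Ω : Type*} [MeasurableSpace Ω] [MulAction H Ω] [MulAction G Ω] [SMulCommClass H G Ω]

/-- A correspondence between `H` and `G`: a nonsingular action of `H × G` (that is, a pair of
commuting nonsingular actions of `H` and `G`) on a standard probability space `(Ω, γ)`, such that
the actions of `H` and of `G` are both dissipative and essentially free. -/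
structure IsCorrespondence (γ : Measure Ω) : Prop where
  standardBorel : StandardBorelSpace Ω
  isProbabilityMeasure : IsProbabilityMeasure γ
  nonsingular_left : IsNonsingularAction H γ
  nonsingular_right : IsNonsingularAction G γ
  dissipative_left : IsDissipativeEssentiallyFree H γ
  dissipative_right : IsDissipativeEssentiallyFree G γ

/-- A measure equivalence embedding of `H` into `G`: a correspondence for which `H ↷ Ω / G` admits
an invariant probability measure in the canonical measure class of `Ω / G`. -/
structure IsMEEmbedding (γ : Measure Ω) : Prop where
  isCorrespondence : IsCorrespondence H G γ
  exists_invariant : ∃ η : Measure (OrbitSpace G Ω), IsProbabilityMeasure η ∧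
    η ≪ OrbitSpace.measure G γ ∧ OrbitSpace.measure G γ ≪ η ∧
    letI : SMulCommClass G H Ω := SMulCommClass.symm H G Ω
    ∀ h : H, MeasurePreserving (fun y : OrbitSpace G Ω => h • y) η η

end ME

/-! ### The free group as a discrete group -/

instance : TopologicalSpace (FreeGroup (Fin 2)) := ⊥

instance : DiscreteTopology (FreeGroup (Fin 2)) := ⟨rfl⟩

instance : MeasurableSpace (FreeGroup (Fin 2)) := ⊤

instance : BorelSpace (FreeGroup (Fin 2)) := ⟨borel_eq_top_of_discrete.symm⟩

/-! ### The Bernoulli action and the skew product -/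

/-- The space `X = (G × G)^{F₂}`. -/
def BernoulliSpace (G : Type*) : Type _ := FreeGroup (Fin 2) → G × G

instance (G : Type*) [MeasurableSpace G] : MeasurableSpace (BernoulliSpace G) :=
  inferInstanceAs (MeasurableSpace (FreeGroup (Fin 2) → G × G))

/-- The Bernoulli action `(s • x) t = x (s⁻¹ * t)` of `F₂`. -/
instance (G : Type*) : MulAction (FreeGroup (Fin 2)) (BernoulliSpace G) where
  smul s x := fun t => x (s⁻¹ * t)
  one_smul x := funext fun t => congrArg x (by simp)
  mul_smul s s' x := funext fun t => congrArg x (by simp [mul_assoc])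

/-- The product measure `μ = (ν × ν)^{F₂}`. -/
def bernoulliMeasure {G : Type*} [MeasurableSpace G] (ν : Measure G) [IsProbabilityMeasure ν] :
    Measure (BernoulliSpace G) :=
  Measure.infinitePi (fun _ : FreeGroup (Fin 2) => ν.prod ν)

/-- The space `Ω = X × G`. -/
structure SkewSpace (G : Type*) where
  /-- The component in `X`. -/
  base : BernoulliSpace G
  /-- The component in `G`. -/
  fiber : G

namespace SkewSpace

variable {G : Type*}

/-- The identification of `Ω` with the product `X × G`. -/
def equivProd (G : Type*) : SkewSpace G ≃ BernoulliSpace G × G where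
  toFun ω := (ω.base, ω.fiber)
  invFun p := ⟨p.1, p.2⟩

instance [MeasurableSpace G] : MeasurableSpace (SkewSpace G) :=
  MeasurableSpace.comap (equivProd G) inferInstance

/-- The product measure `γ = μ × ν` on `Ω = X × G`. -/
def measure [MeasurableSpace G] (ν : Measure G) [IsProbabilityMeasure ν] : Measure (SkewSpace G) :=
  ((bernoulliMeasure ν).prod ν).map (equivProd G).symm

variable [Group G]

/-- The action of the free generators: with `a` the generator of index `0` and `b` the generator of
index `1`, `a • (x, h) = (a • x, (x_e)₁ h)` and `b • (x, h) = (b • x, (x_e)₂ h)`. -/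
def generatorPerm (i : Fin 2) : Equiv.Perm (SkewSpace G) where
  toFun ω := ⟨FreeGroup.of i • ω.base, (if i = 0 then (ω.base 1).1 else (ω.base 1).2) * ω.fiber⟩
  invFun ω := ⟨(FreeGroup.of i)⁻¹ • ω.base,
    (if i = 0 then (((FreeGroup.of i)⁻¹ • ω.base : BernoulliSpace G) 1).1
      else (((FreeGroup.of i)⁻¹ • ω.base : BernoulliSpace G) 1).2)⁻¹ * ω.fiber⟩
  left_inv ω := by
    split_ifs <;> simp
  right_inv ω := by
    split_ifs <;> simp

/-- The action of `F₂ = ⟨a, b⟩` on `Ω` that is determined by the action of the generators. -/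
instance : MulAction (FreeGroup (Fin 2)) (SkewSpace G) :=
  MulAction.compHom (SkewSpace G)
    (FreeGroup.lift generatorPerm : FreeGroup (Fin 2) →* Equiv.Perm (SkewSpace G))

theorem of_zero_smul (ω : SkewSpace G) :
    FreeGroup.of (0 : Fin 2) • ω =
      ⟨FreeGroup.of (0 : Fin 2) • ω.base, (ω.base 1).1 * ω.fiber⟩ := by
  change (FreeGroup.lift generatorPerm (FreeGroup.of (0 : Fin 2))) ω = _
  rw [FreeGroup.lift_apply_of]
  rfl

theorem of_one_smul (ω : SkewSpace G) :
    FreeGroup.of (1 : Fin 2) • ω =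
      ⟨FreeGroup.of (1 : Fin 2) • ω.base, (ω.base 1).2 * ω.fiber⟩ := by
  change (FreeGroup.lift generatorPerm (FreeGroup.of (1 : Fin 2))) ω = _
  rw [FreeGroup.lift_apply_of]
  rfl

/-- The action of `G` on `Ω`: `g • (x, h) = (x, h g⁻¹)`. -/
instance : MulAction G (SkewSpace G) where
  smul g ω := ⟨ω.base, ω.fiber * g⁻¹⟩
  one_smul ω := by
    change (⟨ω.base, ω.fiber * 1⁻¹⟩ : SkewSpace G) = ω
    simp
  mul_smul g g' ω := by
    change (⟨ω.base, ω.fiber * (g * g')⁻¹⟩ : SkewSpace G) = ⟨ω.base, ω.fiber * g'⁻¹ * g⁻¹⟩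
    simp [mul_assoc]

theorem smul_def (g : G) (ω : SkewSpace G) : g • ω = ⟨ω.base, ω.fiber * g⁻¹⟩ := rfl

instance : SMulCommClass (FreeGroup (Fin 2)) G (SkewSpace G) where
  smul_comm s g ω := by
    induction s using FreeGroup.induction_on generalizing ω with
    | C1 => rw [one_smul, one_smul]
    | of i =>
      change (FreeGroup.lift generatorPerm (FreeGroup.of i)) (g • ω) =
        g • (FreeGroup.lift generatorPerm (FreeGroup.of i)) ω
      rw [FreeGroup.lift_apply_of]
      simp only [generatorPerm, Equiv.coe_fn_mk, smul_def, mul_assoc]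
    | inv_of i h =>
      have := h ((FreeGroup.of i)⁻¹ • ω)
      rw [smul_inv_smul] at this
      rw [inv_smul_eq_iff, this]
    | mul s t hs ht => rw [mul_smul, ht, hs, mul_smul]

end SkewSpace

end

/-!
# A measure equivalence embedding of the free group from a Bernoulli skew product

Write `μ` for the Bernoulli measure on `X` and `c` for the cocycle `SkewSpace.cocycle`, so that
`s • (x, h) = (s • x, c s x * h)`. The pairs `(t, i)` of an element of the free group and a generator
index the edges of the Cayley tree, and `x` is a labelling of these edges by independent elements of
`G` with law `ν`. The value `c s x` is the product of the labels, or of their inverses, along the path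
from `1` to `s⁻¹`.

*Dissipativity.* Along a reduced word the labels are independent, so the law of `(c s x)⁻¹` is a
convolution of copies of `ν` and of its image under inversion, and the mean over `x` of
`⟨φ, λ((c s x)⁻¹) φ⟩` is at most `‖λ(ν)‖ ^ |s| * ‖φ‖²` for `φ ∈ L²(G)`
(`SkewSpace.norm_convolutionOperator_cocycleLaw_le`). There are at most `4 * 3 ^ (n - 1)` words of
length `n ≥ 1`, so by `‖λ(ν)‖ < 1 / 3` these means have a finite sum over `s`. For a positive `φ` it
follows that `∑ₛ φ(c s x * h)` is finite for almost every `(x, h)`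
(`SkewSpace.exists_tsum_lt_top`). Hence `(x, h) ↦ φ h` attains its maximum on almost every orbit of
the free group at finitely many points, and after breaking ties the points of the maximum form a
fundamental domain (`isDissipativeEssentiallyFree_of_tsum_lt_top`). The remaining properties of the
measure equivalence embedding are direct: `Ω / G` is `X`, with the invariant measure `μ`.

*Spectral gap.* For every pmp action of `G` on `(Z, ζ)`, the skew product action
`s • (x, w) = (s • x, c s x • w)` on `X × Z` has spectral gap relative to `Z`
(`SkewSpace.spectral_gap`), with a constant that depends neither on `ν` nor on `Z`. The reason is the
paradoxical decomposition of the free group. A function on `X × Z` splits according to the balls of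
the Cayley tree whose edges it depends on. The generator `i` moves the part of a function that does
not lie in the direction of `i` into the direction of `i⁻¹`, by `resample_comp_edgeSkew` and
`pairing_comp_edgeSkew_eq_zero`. For a function that is almost fixed by both generators, almost all of
its mass outside of the functions on `Z` would have to lie in the directions of `i` and `i⁻¹`, which
is impossible for both generators `i` at once (`form_sub_le_of_paradoxical`).

*Weak mixing and strong ergodicity.* Let `Fₙ` be a bounded sequence of functions on `F₂ \ Ω × Z` that
is asymptotically invariant under `G`. In the coordinates `(x, w, h) ↦ (F₂ (x, h), h⁻¹ w)`, the group
`G` only moves `h`, so `Fₙ` is asymptotically a function of `(x, w)`, and it is asymptotically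
invariant under the skew product action since it is defined on the orbits of the free group. By the
spectral gap it is asymptotically a function of `w` alone, and this function on `Z` is again
asymptotically invariant under `G` (`SkewSpace.almost_invariant_eq_totalMean`). For a constant
sequence this transfers ergodicity from `Z` to `F₂ \ Ω × Z`, and in general it transfers strong
ergodicity. The strong ergodicity of `F₂ \ Ω` itself is the case where `Z` is a point.
-/

open scoped NNReal

noncomputable section

/-! ### A paradoxical decomposition inequality -/

section Paradox

variable {E ι : Type*} [AddCommGroup E] [Module ℝ E] {B : LinearMap.BilinForm ℝ E}
  {R : Set ι → E →ₗ[ℝ] E}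

theorem form_sub_self (hs : ∀ x y, B x y = B y x) (x y : E) :
    B (x - y) (x - y) = B x x - 2 * B x y + B y y := by
  simp only [map_sub, LinearMap.sub_apply, hs y x]
  ring

theorem form_sub_of_subset (hR : ∀ J f g, B (R J f) g = B f (R J g))
    (hRR : ∀ J K f, R J (R K f) = R (J ∩ K) f) {J K : Set ι} (h : K ⊆ J) (f : E) :
    B (R J f - R K f) (R J f - R K f) = B f (R J f) - B f (R K f) := by
  simp only [map_sub, LinearMap.sub_apply, hR, hRR, Set.inter_self,
    Set.inter_eq_left.2 h, Set.inter_eq_right.2 h]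
  ring

/-- Bessel's inequality for the pairwise orthogonal projections `R (J g) - R K`. -/
theorem sum_form_sub_le {L : Type*} [Fintype L] (hs : ∀ x y, B x y = B y x)
    (hp : ∀ x, 0 ≤ B x x) (hR : ∀ J f g, B (R J f) g = B f (R J g))
    (hRR : ∀ J K f, R J (R K f) = R (J ∩ K) f) {J : L → Set ι} {K M : Set ι}
    (hK : ∀ g, K ⊆ J g) (hM : ∀ g, J g ⊆ M) (hJ : ∀ g g', g ≠ g' → J g ∩ J g' ⊆ K) (hKM : K ⊆ M)
    (f : E) :
    ∑ g, (B f (R (J g) f) - B f (R K f)) ≤ B f (R M f) - B f (R K f) := by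
  classical
  set v := R M f - R K f with hv
  set a : L → E := fun g => R (J g) f - R K f with ha
  have hva : ∀ g, B v (a g) = B f (R (J g) f) - B f (R K f) := fun g => by
    simp only [hv, ha, map_sub, LinearMap.sub_apply, hR, hRR, Set.inter_self,
      Set.inter_eq_left.2 (hK g), Set.inter_eq_right.2 (hM g), Set.inter_eq_right.2 hKM]
    ring
  have haa : ∀ g g', B (a g) (a g') = if g = g' then B f (R (J g) f) - B f (R K f) else 0 := by
    intro g g'
    split_ifs with h
    · subst h
      exact form_sub_of_subset hR hRR (hK g) f
    · have hi : J g ∩ J g' = K :=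
        Set.Subset.antisymm (hJ g g' h) (Set.subset_inter (hK g) (hK g'))
      simp only [ha, map_sub, LinearMap.sub_apply, hR, hRR, Set.inter_self, hi,
        Set.inter_eq_left.2 (hK g'), Set.inter_eq_right.2 (hK g)]
      ring
  have h0 := hp (v - ∑ g, a g)
  have hsum : B (∑ g, a g) (∑ g, a g) = ∑ g, (B f (R (J g) f) - B f (R K f)) := by
    simp [haa]
  have hvs : B v (∑ g, a g) = ∑ g, (B f (R (J g) f) - B f (R K f)) := by
    simp only [map_sum, hva]
  have hvv : B v v = B f (R M f) - B f (R K f) := form_sub_of_subset hR hRR hKM f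
  rw [form_sub_self hs, hsum, hvs, hvv] at h0
  linarith

/-- The paradoxical inequality. The sets `b k` are thought of as balls around the unit of the free
group and `bg g k` as their parts in the direction of the letter `g`. The isometry `V i` maps the
vectors supported in `b k` and orthogonal to the part in the direction of the generator `i` into
the part of `b (k + 1)` in the direction of the inverse of `i`, and away from `b k`. As both
generators have this property, a vector that is almost fixed by them is close to the range of
`R (b 0)`. -/
theorem form_sub_le_of_paradoxical (hs : ∀ x y, B x y = B y x) (hp : ∀ x, 0 ≤ B x x)
    (hR : ∀ J f g, B (R J f) g = B f (R J g))
    (hRR : ∀ J K f, R J (R K f) = R (J ∩ K) f) {b : ℕ → Set ι} {bg : Fin 2 × Bool → ℕ → Set ι}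
    (h1 : ∀ g k, bg g k ⊆ b k) (h2 : ∀ g k, b k ⊆ bg g (k + 1))
    (h3 : ∀ g g' k, g ≠ g' → bg g (k + 1) ∩ bg g' (k + 1) ⊆ b k)
    {V : Fin 2 → E →ₗ[ℝ] E} (hV : ∀ i f g, B (V i f) (V i g) = B f g)
    (hV1 : ∀ i k f, R (bg (i, false) (k + 1)) (V i (R (b k) f)) = V i (R (b k) f))
    (hV2 : ∀ i k f h, B (V i (R (b k) f - R (bg (i, true) k) f)) (R (b k) h) = 0)
    {N : ℕ} {f : E} (hf : R (b N) f = f) :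
    B (f - R (b 0) f) (f - R (b 0) f) ≤ 6 * ∑ i, B (V i f - f) (V i f - f) := by
  have hb : ∀ k, b k ⊆ b (k + 1) := fun k => (h2 (0, true) k).trans (h1 _ _)
  have hbmono : Monotone b := monotone_nat_of_le_succ hb
  set n : Set ι → ℝ := fun J => B f (R J f) with hn
  have hNf : ∀ J, b N ⊆ J → R J f = f := fun J hJ => by
    conv_lhs => rw [← hf]
    rw [hRR, Set.inter_eq_right.2 hJ, hf]
  -- the mass of `f` away from the unit; `q g` below is the part of it in the direction of `g`
  set D := n (b N) - n (b 0) with hD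
  have hDf : B (f - R (b 0) f) (f - R (b 0) f) = D := by
    have := form_sub_of_subset hR hRR (hbmono (Nat.zero_le N)) f
    rw [hf] at this
    simp only [hD, hn, hf, this]
  set q : Fin 2 × Bool → ℝ := fun g => ∑ k ∈ Finset.range (N + 1), (n (bg g (k + 1)) - n (b k))
    with hq
  have hq_sum : ∑ g, q g ≤ D := by
    simp only [hq]
    rw [Finset.sum_comm]
    calc ∑ k ∈ Finset.range (N + 1), ∑ g, (n (bg g (k + 1)) - n (b k))
        ≤ ∑ k ∈ Finset.range (N + 1), (n (b (k + 1)) - n (b k)) :=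
          Finset.sum_le_sum fun k _ => sum_form_sub_le hs hp hR hRR (fun g => h2 g k)
            (fun g => h1 g _) (fun g g' h => h3 g g' k h) (hb k) f
      _ = n (b (N + 1)) - n (b 0) := Finset.sum_range_sub (fun k => n (b k)) _
      _ = D := by
          simp only [hD, hn, hNf (b (N + 1)) (hb N), hf]
  -- the pieces of `h` in the direction of `g` and at distance `k + 1` are orthogonal
  have hbessel : ∀ (g : Fin 2 × Bool) (h : E),
      ∑ k ∈ Finset.range (N + 1), B (R (bg g (k + 1)) h - R (b k) h) (R (bg g (k + 1)) h - R (b k) h)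
        ≤ B h h := by
    intro g h
    calc _ ≤ ∑ k ∈ Finset.range (N + 1), (B h (R (b (k + 1)) h) - B h (R (b k) h)) := by
          refine Finset.sum_le_sum fun k _ => ?_
          rw [form_sub_of_subset hR hRR (h2 g k)]
          have := hp (R (b (k + 1)) h - R (bg g (k + 1)) h)
          rw [form_sub_of_subset hR hRR (h1 g (k + 1))] at this
          linarith
      _ = B h (R (b (N + 1)) h) - B h (R (b 0) h) :=
          Finset.sum_range_sub (fun k => B h (R (b k) h)) _
      _ ≤ B h h := by
          have e1 := hp (R (b 0) h)
          rw [hR, hRR, Set.inter_self] at e1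
          have e2 := hp (h - R (b (N + 1)) h)
          have e3 : B (R (b (N + 1)) h) (R (b (N + 1)) h) = B h (R (b (N + 1)) h) := by
            rw [hR, hRR, Set.inter_self]
          rw [form_sub_self hs, e3] at e2
          linarith
  -- `V i` moves all of the mass outside of the direction `i` into the direction of the inverse of
  -- `i`, and `V i f` is close to `f`
  have hkey : ∀ i, D - q (i, true) ≤ 3 / 2 * q (i, false) + 3 * B (V i f - f) (V i f - f) := by
    intro i
    set J : ℕ → Set ι := fun k => bg (i, true) k
    set A : ℕ → Set ι := fun k => bg (i, false) k
    -- the projections onto the pieces in the direction of the inverse of `i`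
    set Q : ℕ → E → E := fun k h => R (A (k + 1)) h - R (b k) h with hQ
    have hu : ∀ k, n (b k) - n (J k) ≤ B (Q k (V i f)) (Q k (V i f)) := by
      intro k
      set v := R (b k) f - R (J k) f with hv
      have hvv : B v v = n (b k) - n (J k) := form_sub_of_subset hR hRR (h1 _ k) f
      have hfv : B f v = n (b k) - n (J k) := by rw [hv, map_sub]
      have hAv : R (A (k + 1)) (V i v) = V i v := by
        have : v = R (b k) (f - R (J k) f) := by
          rw [map_sub, hRR, Set.inter_eq_right.2 (h1 _ k)]
        rw [this]
        exact hV1 i k _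
      have h4 : B (Q k (V i f)) (V i v) = n (b k) - n (J k) := by
        rw [hQ, map_sub, LinearMap.sub_apply, hR, hAv, hV, hfv, hs, hV2, sub_zero]
      have h5 := hp (Q k (V i f) - V i v)
      rw [form_sub_self hs, hV, hvv, h4] at h5
      linarith
    have hDq : D - q (i, true) ≤ ∑ k ∈ Finset.range (N + 1), (n (b k) - n (J k)) := by
      have e1 : q (i, true) = ∑ k ∈ Finset.range (N + 1), (n (J (k + 1)) - n (J k))
          - ∑ k ∈ Finset.range (N + 1), (n (b k) - n (J k)) := by
        rw [← Finset.sum_sub_distrib]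
        exact Finset.sum_congr rfl fun k _ => by ring
      rw [e1, Finset.sum_range_sub (fun k => n (J k))]
      have e2 : n (J (N + 1)) = n (b N) := by
        simp only [hn, J, hNf _ (h2 (i, true) N), hf]
      have e3 : n (J 0) ≤ n (b 0) := by
        have := hp (R (b 0) f - R (J 0) f)
        rw [form_sub_of_subset hR hRR (h1 _ 0)] at this
        linarith
      rw [e2, hD]
      linarith
    refine hDq.trans ((Finset.sum_le_sum fun k _ => hu k).trans ?_)
    have hsplit : ∀ k, B (Q k (V i f)) (Q k (V i f)) ≤
        3 / 2 * (n (A (k + 1)) - n (b k)) + 3 * B (Q k (V i f - f)) (Q k (V i f - f)) := by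
      intro k
      have e1 : Q k (V i f) = Q k f + Q k (V i f - f) := by
        simp only [hQ, map_sub]; abel
      have e2 : B (Q k f) (Q k f) = n (A (k + 1)) - n (b k) :=
        form_sub_of_subset hR hRR (h2 _ k) f
      have e3 := hp (Q k f - (2 : ℝ) • Q k (V i f - f))
      simp only [form_sub_self hs, map_smul, LinearMap.smul_apply, smul_eq_mul] at e3
      rw [e1, ← e2]
      simp only [map_add, LinearMap.add_apply, hs (Q k (V i f - f)) (Q k f)]
      linarith
    refine (Finset.sum_le_sum fun k _ => hsplit k).trans ?_
    rw [Finset.sum_add_distrib, ← Finset.mul_sum, ← Finset.mul_sum]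
    have := hbessel (i, false) (V i f - f)
    simp only [hq]
    simp only [hQ, A]
    linarith
  have hq' : ∑ g, q g = q (0, true) + q (0, false) + (q (1, true) + q (1, false)) := by
    rw [Fintype.sum_prod_type]
    simp [Fin.sum_univ_two]
  rw [hDf, Fin.sum_univ_two]
  have k0 := hkey 0
  have k1 := hkey 1
  have hqn : ∀ g, 0 ≤ q g := fun g => Finset.sum_nonneg fun k _ => by
    have := hp (R (bg g (k + 1)) f - R (b k) f)
    rwa [form_sub_of_subset hR hRR (h2 g k)] at this
  linarith [hqn (0, true), hqn (1, true)]

end Paradox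

/-! ### Word length in the free group -/

section Words

/-- The generator `i` for `true` and its inverse for `false`. -/
def letter (g : Fin 2 × Bool) : FreeGroup (Fin 2) := FreeGroup.mk [g]

theorem letter_true (i : Fin 2) : letter (i, true) = FreeGroup.of i := rfl

theorem letter_not (i : Fin 2) (e : Bool) : letter (i, !e) = (letter (i, e))⁻¹ := by
  simp [letter, FreeGroup.inv_mk, FreeGroup.invRev]

theorem letter_false (i : Fin 2) : letter (i, false) = (FreeGroup.of i)⁻¹ := by
  rw [← letter_true, ← letter_not]; rfl

theorem norm_letter (g : Fin 2 × Bool) : (letter g).norm = 1 := by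
  obtain ⟨i, _ | _⟩ := g
  · rw [letter_false, FreeGroup.norm_inv_eq, FreeGroup.norm_of]
  · rw [letter_true, FreeGroup.norm_of]

theorem toWord_letter_mul (g : Fin 2 × Bool) (v : FreeGroup (Fin 2)) :
    (letter g * v).toWord = FreeGroup.reduce (g :: v.toWord) := by
  conv_lhs => rw [← FreeGroup.mk_toWord (x := v), letter, FreeGroup.mul_mk, FreeGroup.toWord_mk]
  rfl

/-- Left multiplication by the inverse of a letter `g` increases the word length, except for the
words that start with `g`. -/
theorem norm_letter_inv_mul (g : Fin 2 × Bool) (v : FreeGroup (Fin 2)) :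
    ((letter g)⁻¹ * v).norm = v.norm + 1 ∨
      v.toWord.head? = some g ∧ ((letter g)⁻¹ * v).norm + 1 = v.norm := by
  obtain ⟨i, e⟩ := g
  rw [← letter_not, FreeGroup.norm, FreeGroup.norm, toWord_letter_mul, FreeGroup.reduce.cons,
    FreeGroup.reduce_toWord]
  rcases h : v.toWord with _ | ⟨⟨j, e'⟩, l⟩
  · simp
  · by_cases hc : i = j ∧ (!e) = !e'
    · right
      obtain ⟨rfl, hc⟩ := hc
      have : e = e' := by simpa using hc
      subst this
      simp
    · left
      simp only [hc, if_false, List.length_cons]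

/-- A word has at most one first letter. -/
theorem letter_eq_of_norm_le {g g' : Fin 2 × Bool} {v : FreeGroup (Fin 2)}
    (h : ((letter g)⁻¹ * v).norm ≤ v.norm) (h' : ((letter g')⁻¹ * v).norm ≤ v.norm) : g = g' := by
  rcases norm_letter_inv_mul g v with h1 | h1
  · omega
  rcases norm_letter_inv_mul g' v with h2 | h2
  · omega
  exact Option.some_injective _ (h1.1.symm.trans h2.1)

/-- The edges of the Cayley tree with both end points at distance at most `k` from `c`. The index
`(t, i)` stands for the edge between `t` and `t * (FreeGroup.of i)⁻¹`. -/
def edgeBall (c : FreeGroup (Fin 2)) (k : ℕ) : Set (FreeGroup (Fin 2) × Fin 2) :=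
  {j | (c⁻¹ * j.1).norm ≤ k ∧ (c⁻¹ * (j.1 * (FreeGroup.of j.2)⁻¹)).norm ≤ k}

/-- The triangle inequality for the distance `‖c⁻¹ * v‖` of the Cayley tree. -/
theorem norm_inv_mul_le (c d v : FreeGroup (Fin 2)) :
    (c⁻¹ * v).norm ≤ (d⁻¹ * c).norm + (d⁻¹ * v).norm := by
  have h : c⁻¹ * v = (d⁻¹ * c)⁻¹ * (d⁻¹ * v) := by group
  rw [h]
  exact (FreeGroup.norm_mul_le _ _).trans (by rw [FreeGroup.norm_inv_eq])

theorem edgeBall_subset {c d : FreeGroup (Fin 2)} (h : (d⁻¹ * c).norm ≤ 1) (k : ℕ) :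
    edgeBall d k ⊆ edgeBall c (k + 1) := fun j hj =>
  ⟨(norm_inv_mul_le c d _).trans (by have := hj.1; omega),
    (norm_inv_mul_le c d _).trans (by have := hj.2; omega)⟩

theorem edgeBall_mono (c : FreeGroup (Fin 2)) {k l : ℕ} (h : k ≤ l) :
    edgeBall c k ⊆ edgeBall c l := fun _ hj => ⟨hj.1.trans h, hj.2.trans h⟩

/-- The edges of the ball of radius `k` around the unit whose far end point either starts with the
letter `g` or has length less than `k`. -/
def edgeBallToward (g : Fin 2 × Bool) (k : ℕ) : Set (FreeGroup (Fin 2) × Fin 2) :=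
  edgeBall 1 k ∩ edgeBall (letter g) k

theorem edgeBallToward_inter_subset {g g' : Fin 2 × Bool} (h : g ≠ g') (k : ℕ) :
    edgeBallToward g (k + 1) ∩ edgeBallToward g' (k + 1) ⊆ edgeBall 1 k := by
  have key : ∀ v : FreeGroup (Fin 2), (1⁻¹ * v).norm ≤ k + 1 → ((letter g)⁻¹ * v).norm ≤ k + 1 →
      ((letter g')⁻¹ * v).norm ≤ k + 1 → (1⁻¹ * v).norm ≤ k := by
    intro v h0 h1 h2
    by_contra hc
    rw [inv_one, one_mul] at h0 hc
    exact h (letter_eq_of_norm_le (v := v) (by omega) (by omega))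
  rintro j ⟨⟨h0, h1⟩, _, h2⟩
  exact ⟨key _ h0.1 h1.1 h2.1, key _ h0.2 h1.2 h2.2⟩

theorem edgeBall_zero : edgeBall 1 0 = ∅ := by
  ext ⟨t, i⟩
  simp only [edgeBall, Set.mem_ofPred_eq, Set.mem_empty_iff_false, iff_false, inv_one, one_mul,
    nonpos_iff_eq_zero, FreeGroup.norm_eq_zero]
  rintro ⟨rfl, h⟩
  simp at h

theorem iUnion_edgeBall : ⋃ k, edgeBall 1 k = Set.univ := by
  refine Set.eq_univ_of_forall fun j => Set.mem_iUnion.2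
    ⟨max (1⁻¹ * j.1).norm (1⁻¹ * (j.1 * (FreeGroup.of j.2)⁻¹)).norm, ?_, ?_⟩
  · exact le_max_left _ _
  · exact le_max_right _ _

end Words

/-! ### Bounded measurable functions -/

/-- The real vector space of bounded measurable functions. Actual functions are used instead of
classes in `L²`, so that the identities between conditional expectations below hold pointwise. -/
def BddMeas (P : Type*) [MeasurableSpace P] : Submodule ℝ (P → ℝ) where
  carrier := {f | Measurable f ∧ ∃ C, ∀ p, |f p| ≤ C}
  add_mem' := by
    rintro f g ⟨hf, C, hC⟩ ⟨hg, D, hD⟩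
    exact ⟨hf.add hg, C + D, fun p => (abs_add_le _ _).trans (add_le_add (hC p) (hD p))⟩
  zero_mem' := ⟨measurable_const, 0, fun p => by simp⟩
  smul_mem' := by
    rintro c f ⟨hf, C, hC⟩
    refine ⟨hf.const_smul c, |c| * C, fun p => ?_⟩
    rw [Pi.smul_apply, smul_eq_mul, abs_mul]
    exact mul_le_mul_of_nonneg_left (hC p) (abs_nonneg c)

theorem integrable_of_abs_le {P : Type*} [MeasurableSpace P] {m : Measure P} [IsFiniteMeasure m]
    {f : P → ℝ} (hf : Measurable f) {C : ℝ} (h : ∀ p, |f p| ≤ C) : Integrable f m :=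
  Integrable.of_bound hf.aestronglyMeasurable C (ae_of_all _ h)

namespace BddMeas

variable {P Q : Type*} [MeasurableSpace P] [MeasurableSpace Q]

theorem integrable (f : BddMeas P) (m : Measure P) [IsFiniteMeasure m] :
    Integrable (f : P → ℝ) m := by
  obtain ⟨C, hC⟩ := f.2.2
  exact integrable_of_abs_le f.2.1 hC

/-- The product of bounded measurable functions. -/
def mul (f g : BddMeas P) : BddMeas P :=
  ⟨fun p => f.1 p * g.1 p, by
    obtain ⟨f, hf, C, hC⟩ := f
    obtain ⟨g, hg, D, hD⟩ := g
    refine ⟨hf.mul hg, C * D, fun p => ?_⟩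
    rw [abs_mul]
    exact mul_le_mul (hC p) (hD p) (abs_nonneg _) ((abs_nonneg _).trans (hC p))⟩

theorem integrable_mul (f g : BddMeas P) (m : Measure P) [IsFiniteMeasure m] :
    Integrable (fun p => f.1 p * g.1 p) m := integrable (mul f g) m

/-- The `L²` scalar product. -/
def pairing (m : Measure P) [IsFiniteMeasure m] : LinearMap.BilinForm ℝ (BddMeas P) :=
  LinearMap.mk₂ ℝ (fun f g => ∫ p, f.1 p * g.1 p ∂m)
    (fun f f' g => by
      rw [← integral_add (integrable_mul f g m) (integrable_mul f' g m)]
      exact integral_congr_ae (ae_of_all _ fun p => add_mul (f.1 p) (f'.1 p) (g.1 p)))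
    (fun c f g => by
      rw [smul_eq_mul, ← integral_const_mul]
      exact integral_congr_ae (ae_of_all _ fun p => mul_assoc c (f.1 p) (g.1 p)))
    (fun f g g' => by
      rw [← integral_add (integrable_mul f g m) (integrable_mul f g' m)]
      exact integral_congr_ae (ae_of_all _ fun p => mul_add (f.1 p) (g.1 p) (g'.1 p)))
    (fun c f g => by
      rw [smul_eq_mul, ← integral_const_mul]
      exact integral_congr_ae (ae_of_all _ fun p => mul_left_comm (f.1 p) c (g.1 p)))

theorem pairing_apply (m : Measure P) [IsFiniteMeasure m] (f g : BddMeas P) :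
    pairing m f g = ∫ p, f.1 p * g.1 p ∂m := rfl

theorem pairing_comm (m : Measure P) [IsFiniteMeasure m] (f g : BddMeas P) :
    pairing m f g = pairing m g f := by
  simp only [pairing_apply, mul_comm]

theorem pairing_self_nonneg (m : Measure P) [IsFiniteMeasure m] (f : BddMeas P) :
    0 ≤ pairing m f f :=
  integral_nonneg fun p => mul_self_nonneg (f.1 p)

theorem pairing_add_self_le (m : Measure P) [IsFiniteMeasure m] (f g : BddMeas P) :
    pairing m (f + g) (f + g) ≤ 2 * pairing m f f + 2 * pairing m g g := by
  have h := pairing_self_nonneg m (f - g)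
  simp only [map_add, map_sub, LinearMap.add_apply, LinearMap.sub_apply,
    pairing_comm m g f] at h ⊢
  linarith

/-- Composition with a measurable map. -/
def comp (T : P → Q) (hT : Measurable T) : BddMeas Q →ₗ[ℝ] BddMeas P where
  toFun f := ⟨fun p => f.1 (T p), f.2.1.comp hT, f.2.2.imp fun _ h p => h (T p)⟩
  map_add' _ _ := rfl
  map_smul' _ _ := rfl

theorem comp_apply (T : P → Q) (hT : Measurable T) (f : BddMeas Q) (p : P) :
    (comp T hT f).1 p = f.1 (T p) := rfl

theorem integral_comp {m : Measure P} {m' : Measure Q} {T : P → Q} (hT : MeasurePreserving T m m')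
    (f : BddMeas Q) : ∫ p, f.1 (T p) ∂m = ∫ q, f.1 q ∂m' := by
  rw [← hT.map_eq, integral_map hT.measurable.aemeasurable f.2.1.aestronglyMeasurable]

theorem pairing_comp {m : Measure P} {m' : Measure Q} [IsFiniteMeasure m] [IsFiniteMeasure m']
    {T : P → Q} (hT : MeasurePreserving T m m') (f g : BddMeas Q) :
    pairing m (comp T hT.measurable f) (comp T hT.measurable g) = pairing m' f g :=
  integral_comp hT (mul f g)

end BddMeas

/-! ### Resampling coordinates of a product space -/

section Resample

variable {ι S Z : Type*}

open Classical in
/-- The point that agrees with `y` on `J` and with `y'` outside of `J`. -/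
def splice (J : Set ι) (y y' : ι → S) : ι → S := fun i => if i ∈ J then y i else y' i

theorem splice_of_mem {J : Set ι} {i : ι} (h : i ∈ J) (y y' : ι → S) : splice J y y' i = y i :=
  if_pos h

theorem splice_of_notMem {J : Set ι} {i : ι} (h : i ∉ J) (y y' : ι → S) :
    splice J y y' i = y' i :=
  if_neg h

theorem splice_splice (J K : Set ι) (y y' y'' : ι → S) :
    splice K (splice J y y') y'' = splice (J ∩ K) y (splice K y' y'') := by
  funext i
  by_cases hK : i ∈ K <;> by_cases hJ : i ∈ J <;> simp [splice, hK, hJ]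

theorem splice_splice_self (J : Set ι) (y y' y'' : ι → S) :
    splice J (splice J y y') y'' = splice J y y'' := by
  funext i
  by_cases hJ : i ∈ J <;> simp [splice, hJ]

variable [MeasurableSpace S] [MeasurableSpace Z]

theorem measurable_splice (J : Set ι) :
    Measurable fun p : (ι → S) × (ι → S) => splice J p.1 p.2 := by
  refine measurable_pi_lambda _ fun i => ?_
  by_cases hJ : i ∈ J
  · simp only [splice, hJ, if_true]; fun_prop
  · simp only [splice, hJ, if_false]; fun_prop

variable (ν : Measure S) [IsProbabilityMeasure ν]

theorem measurePreserving_splice (J : Set ι) :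
    MeasurePreserving (fun p : (ι → S) × (ι → S) => splice J p.1 p.2)
      ((Measure.infinitePi fun _ : ι => ν).prod (Measure.infinitePi fun _ : ι => ν))
      (Measure.infinitePi fun _ : ι => ν) := by
  classical
  refine ⟨measurable_splice J, Measure.eq_infinitePi _ fun s t ht => ?_⟩
  rw [Measure.map_apply (measurable_splice J)
    (MeasurableSet.pi s.countable_toSet fun i _ => ht i)]
  have : (fun p : (ι → S) × (ι → S) => splice J p.1 p.2) ⁻¹' (s : Set ι).pi t =
      ((s.filter (· ∈ J) : Finset ι) : Set ι).pi t ×ˢ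
        ((s.filter (· ∉ J) : Finset ι) : Set ι).pi t := by
    ext ⟨y, y'⟩
    simp only [Set.mem_preimage, Set.mem_pi, Set.mem_prod, Finset.coe_filter, Set.mem_ofPred_eq,
      Finset.mem_coe]
    constructor
    · intro h
      refine ⟨fun i hi => ?_, fun i hi => ?_⟩
      · simpa [splice, hi.2] using h i hi.1
      · simpa [splice, hi.2] using h i hi.1
    · rintro ⟨h, h'⟩ i hi
      by_cases hJ : i ∈ J
      · simpa [splice, hJ] using h i ⟨hi, hJ⟩
      · simpa [splice, hJ] using h' i ⟨hi, hJ⟩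
  rw [this, Measure.prod_prod, Measure.infinitePi_pi _ fun i _ => ht i,
    Measure.infinitePi_pi _ fun i _ => ht i, Finset.prod_filter_mul_prod_filter_not]

/-- The function `f` with its coordinates outside of `J` averaged out. This is the conditional
expectation of `f` with respect to the coordinates in `J` and the coordinate in `Z`. -/
def resample (J : Set ι) : BddMeas ((ι → S) × Z) →ₗ[ℝ] BddMeas ((ι → S) × Z) where
  toFun f := ⟨fun p => ∫ y', f.1 (splice J p.1 y', p.2) ∂Measure.infinitePi fun _ : ι => ν, by
    obtain ⟨f, hf, C, hC⟩ := f
    constructor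
    · have : Measurable fun q : ((ι → S) × Z) × (ι → S) => f (splice J q.1.1 q.2, q.1.2) :=
        hf.comp (((measurable_splice J).comp
          ((measurable_fst.comp measurable_fst).prodMk measurable_snd)).prodMk
          (measurable_snd.comp measurable_fst))
      exact this.stronglyMeasurable.integral_prod_right'.measurable
    · refine ⟨C, fun p => ?_⟩
      have := norm_integral_le_of_norm_le_const
        (μ := Measure.infinitePi fun _ : ι => ν) (f := fun y' => f (splice J p.1 y', p.2))
        (ae_of_all _ fun y' => hC _)
      simpa using this⟩
  map_add' f g := Subtype.ext <| funext fun p => by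
    have h : ∀ f : BddMeas ((ι → S) × Z), Integrable (fun y' => f.1 (splice J p.1 y', p.2))
        (Measure.infinitePi fun _ : ι => ν) := fun f => by
      obtain ⟨C, hC⟩ := f.2.2
      exact integrable_of_abs_le (f.2.1.comp (((measurable_splice J).comp
        measurable_prodMk_left).prodMk measurable_const)) (fun y' => hC _)
    exact integral_add (h f) (h g)
  map_smul' c f := Subtype.ext <| funext fun p => integral_const_mul c _

variable {ν}

theorem resample_apply (J : Set ι) (f : BddMeas ((ι → S) × Z)) (p : (ι → S) × Z) :
    (resample ν J f).1 p = ∫ y', f.1 (splice J p.1 y', p.2) ∂Measure.infinitePi fun _ : ι => ν :=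
  rfl

/-- Replacing the coordinates outside of `K` by independent copies does not change the mean. -/
theorem integral_splice (K : Set ι) {f : (ι → S) → ℝ} (hf : f ∈ BddMeas (ι → S)) :
    ∫ y, f y ∂(Measure.infinitePi fun _ : ι => ν) =
      ∫ y, ∫ y', f (splice K y y') ∂(Measure.infinitePi fun _ : ι => ν)
        ∂(Measure.infinitePi fun _ : ι => ν) := by
  rw [← BddMeas.integral_comp (measurePreserving_splice ν K) ⟨f, hf⟩]
  exact integral_prod _ (BddMeas.integrable (BddMeas.comp _ (measurable_splice K) ⟨f, hf⟩) _)

theorem section_mem_bddMeas (f : BddMeas ((ι → S) × Z)) (z : Z) :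
    (fun y => f.1 (y, z)) ∈ BddMeas (ι → S) :=
  ⟨f.2.1.comp measurable_prodMk_right, f.2.2.imp fun _ h _ => h _⟩

/-- Conditional expectations for independent coordinates commute. With the pointwise definition of
`resample` this holds everywhere. -/
theorem resample_resample (J K : Set ι) (f : BddMeas ((ι → S) × Z)) :
    resample ν J (resample ν K f) = resample ν (J ∩ K) f := by
  refine Subtype.ext (funext fun p => ?_)
  simp only [resample_apply, splice_splice]
  exact (integral_splice K (f := fun y => f.1 (splice (J ∩ K) p.1 y, p.2))
    ⟨f.2.1.comp (((measurable_splice _).comp measurable_prodMk_left).prodMk measurable_const),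
      f.2.2.imp fun _ h _ => h _⟩).symm

theorem resample_eq_of_dependsOn {J : Set ι} {f : BddMeas ((ι → S) × Z)}
    (h : ∀ z, DependsOn (fun y => f.1 (y, z)) J) : resample ν J f = f := by
  refine Subtype.ext (funext fun p => ?_)
  rw [resample_apply]
  have : ∀ y', f.1 (splice J p.1 y', p.2) = f.1 p := fun y' =>
    h p.2 fun i hi => splice_of_mem hi _ _
  simp [this]

theorem dependsOn_resample (J : Set ι) (f : BddMeas ((ι → S) × Z)) (z : Z) :
    DependsOn (fun y => (resample ν J f).1 (y, z)) J := by
  intro y y' h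
  simp only [resample_apply]
  refine integral_congr_ae (ae_of_all _ fun y'' => ?_)
  have : splice J y y'' = splice J y' y'' := by
    funext i
    by_cases hi : i ∈ J
    · simp [splice, hi, h i hi]
    · simp [splice, hi]
  simp only [this]

variable (ζ : Measure Z) [IsProbabilityMeasure ζ]

theorem pairing_resample_left (J : Set ι) (f g : BddMeas ((ι → S) × Z)) :
    BddMeas.pairing ((Measure.infinitePi fun _ : ι => ν).prod ζ) (resample ν J f) g =
      BddMeas.pairing ((Measure.infinitePi fun _ : ι => ν).prod ζ) (resample ν J f)
        (resample ν J g) := by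
  rw [BddMeas.pairing_apply, BddMeas.pairing_apply,
    integral_prod_symm _ (BddMeas.integrable_mul _ _ _),
    integral_prod_symm _ (BddMeas.integrable_mul _ _ _)]
  refine integral_congr_ae (ae_of_all _ fun z => ?_)
  simp only
  refine (integral_splice J (section_mem_bddMeas (BddMeas.mul (resample ν J f) g) z)).trans ?_
  refine integral_congr_ae (ae_of_all _ fun y => ?_)
  simp only [BddMeas.mul, resample_apply, splice_splice_self]
  rw [integral_const_mul]

/-- Resampling is self-adjoint. -/
theorem pairing_resample (J : Set ι) (f g : BddMeas ((ι → S) × Z)) :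
    BddMeas.pairing ((Measure.infinitePi fun _ : ι => ν).prod ζ) (resample ν J f) g =
      BddMeas.pairing ((Measure.infinitePi fun _ : ι => ν).prod ζ) f (resample ν J g) := by
  rw [pairing_resample_left, BddMeas.pairing_comm, ← pairing_resample_left, BddMeas.pairing_comm]

/-- Martingale convergence for resampling outside of an increasing sequence of sets. -/
theorem tendsto_pairing_sub_resample {b : ℕ → Set ι} (hb : Monotone b) (hbu : ⋃ k, b k = Set.univ)
    (f : BddMeas ((ι → S) × Z)) :
    Tendsto (fun k => BddMeas.pairing ((Measure.infinitePi fun _ : ι => ν).prod ζ)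
      (f - resample ν (b k) f) (f - resample ν (b k) f)) atTop (𝓝 0) := by
  set m := (Measure.infinitePi fun _ : ι => ν).prod ζ with hm
  have : Nonempty S := ν.nonempty_of_neZero
  let φ : ∀ k, (ι → S) × Z → (b k → S) × Z := fun k p => ((b k).domRestrict p.1, p.2)
  have hφ : ∀ k, Measurable (φ k) := fun k =>
    (measurable_pi_lambda _ fun i => (measurable_pi_apply i.1).comp measurable_fst).prodMk
      measurable_snd
  let ℱ : Filtration ℕ (inferInstance : MeasurableSpace ((ι → S) × Z)) :=
    { seq := fun k => MeasurableSpace.comap (φ k) inferInstance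
      mono' := by
        intro k l hkl
        have hr : Measurable fun q : (b l → S) × Z =>
            (((fun i => q.1 ⟨i.1, hb hkl i.2⟩ : b k → S), q.2) : (b k → S) × Z) :=
          (measurable_pi_lambda _ fun i => (measurable_pi_apply _).comp measurable_fst).prodMk
            measurable_snd
        change MeasurableSpace.comap _ _ ≤ MeasurableSpace.comap _ _
        rw [show φ k = (fun q : (b l → S) × Z =>
            (((fun i => q.1 ⟨i.1, hb hkl i.2⟩ : b k → S), q.2) : (b k → S) × Z)) ∘ φ l from rfl,
          ← MeasurableSpace.comap_comp]
        exact MeasurableSpace.comap_mono hr.comap_le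
      le' := fun k => (hφ k).comap_le }
  have hcoord : ∀ k, ∀ i ∈ b k, Measurable[ℱ k] fun p : (ι → S) × Z => p.1 i := fun k i hi =>
    ((measurable_pi_apply (⟨i, hi⟩ : b k)).comp measurable_fst).comp
      (comap_measurable (φ k))
  have hsnd : ∀ k, Measurable[ℱ k] fun p : (ι → S) × Z => p.2 := fun k =>
    (measurable_snd (α := b k → S)).comp (comap_measurable (φ k))
  have htop : (⨆ k, ℱ k) = (inferInstance : MeasurableSpace ((ι → S) × Z)) := by
    refine le_antisymm (iSup_le fun k => ℱ.le k) ?_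
    have h1 : Measurable[⨆ k, ℱ k] fun p : (ι → S) × Z => p.1 :=
      @measurable_pi_lambda _ _ _ (⨆ k, ℱ k) _ _ fun i => by
        obtain ⟨k, hk⟩ := Set.mem_iUnion.1 (hbu ▸ Set.mem_univ i)
        exact (hcoord k i hk).mono (le_iSup ℱ k) le_rfl
    have h2 : Measurable[⨆ k, ℱ k] fun p : (ι → S) × Z => p.2 :=
      (hsnd 0).mono (le_iSup ℱ 0) le_rfl
    have h3 : Measurable[⨆ k, ℱ k] (id : (ι → S) × Z → (ι → S) × Z) :=
      h1.prodMk h2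
    simpa using h3.comap_le
  -- resampling is the conditional expectation for the coordinates in `b k`
  have hcond : ∀ k, (resample ν (b k) f).1 =ᵐ[m] m[f.1 | ℱ k] := by
    intro k
    refine ae_eq_condExp_of_forall_setIntegral_eq (ℱ.le k) (BddMeas.integrable f m)
      (fun s _ _ => (BddMeas.integrable (resample ν (b k) f) m).integrableOn) ?_ ?_
    · rintro s ⟨t, ht, rfl⟩ -
      have hmeas : MeasurableSet (φ k ⁻¹' t) := hφ k ht
      set χ : BddMeas ((ι → S) × Z) := ⟨(φ k ⁻¹' t).indicator fun _ => 1,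
        measurable_const.indicator hmeas, 1, fun p => by
          by_cases hp : p ∈ φ k ⁻¹' t <;> simp [hp]⟩ with hχ
      have hdep : resample ν (b k) χ = χ := resample_eq_of_dependsOn fun z y y' h => by
        have : φ k (y, z) = φ k (y', z) := by
          simp only [φ, Prod.mk.injEq, and_true]
          exact funext fun i => h i.1 i.2
        have hiff : (y, z) ∈ φ k ⁻¹' t ↔ (y', z) ∈ φ k ⁻¹' t := by
          rw [Set.mem_preimage, Set.mem_preimage, this]
        change (φ k ⁻¹' t).indicator (fun _ => (1 : ℝ)) (y, z) =
          (φ k ⁻¹' t).indicator (fun _ => (1 : ℝ)) (y', z)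
        by_cases hy : (y', z) ∈ φ k ⁻¹' t
        · rw [Set.indicator_of_mem hy, Set.indicator_of_mem (hiff.2 hy)]
        · rw [Set.indicator_of_notMem hy, Set.indicator_of_notMem (mt hiff.1 hy)]
      have hint : ∀ g : BddMeas ((ι → S) × Z),
          ∫ p in φ k ⁻¹' t, g.1 p ∂m = BddMeas.pairing m g χ := fun g => by
        rw [BddMeas.pairing_apply, ← integral_indicator hmeas]
        refine integral_congr_ae (ae_of_all _ fun p => ?_)
        by_cases hp : p ∈ φ k ⁻¹' t <;> simp [hχ, hp]
      rw [hint, hint, pairing_resample, hdep]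
    · obtain ⟨s0⟩ := this
      have hψ : Measurable[ℱ k] fun p : (ι → S) × Z => (splice (b k) p.1 (fun _ => s0), p.2) := by
        refine Measurable.prodMk ?_ (hsnd k)
        refine @measurable_pi_lambda _ _ _ (ℱ k) _ _ fun i => ?_
        by_cases hi : i ∈ b k
        · simpa only [splice, hi, if_true] using hcoord k i hi
        · simp only [splice, hi, if_false]
          exact @measurable_const _ _ _ (ℱ k) _
      have heq : (resample ν (b k) f).1 = (resample ν (b k) f).1 ∘
          fun p : (ι → S) × Z => (splice (b k) p.1 (fun _ => s0), p.2) := funext fun p =>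
        dependsOn_resample (b k) f p.2 fun i hi => (splice_of_mem hi _ _).symm
      rw [heq]
      exact (Measurable.stronglyMeasurable
        ((resample ν (b k) f).2.1.comp hψ)).aestronglyMeasurable
  have hlim : ∀ᵐ p ∂m, Tendsto (fun k => (resample ν (b k) f).1 p) atTop (𝓝 (f.1 p)) := by
    have h1 := tendsto_ae_condExp (μ := m) (ℱ := ℱ) f.1
    have h2 : m[f.1 | ⨆ k, ℱ k] = f.1 :=
      condExp_of_stronglyMeasurable (iSup_le fun k => ℱ.le k)
        (by rw [htop]; exact f.2.1.stronglyMeasurable) (BddMeas.integrable f m)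
    rw [h2] at h1
    filter_upwards [h1, ae_all_iff.2 hcond] with p hp hp'
    simpa only [hp'] using hp
  obtain ⟨C, hC⟩ := f.2.2
  have hRC : ∀ k p, |(resample ν (b k) f).1 p| ≤ C := fun k p => by
    have := norm_integral_le_of_norm_le_const (μ := Measure.infinitePi fun _ : ι => ν)
      (f := fun y' => f.1 (splice (b k) p.1 y', p.2)) (ae_of_all _ fun y' => hC _)
    simpa [resample_apply] using this
  have := tendsto_integral_of_dominated_convergence (μ := m)
    (F := fun k p => (f - resample ν (b k) f).1 p * (f - resample ν (b k) f).1 p)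
    (f := fun _ => 0) (fun _ => (2 * C) * (2 * C))
    (fun k => (BddMeas.integrable_mul _ _ m).aestronglyMeasurable) (integrable_const _)
    (fun k => ae_of_all _ fun p => by
      have h1 : |f.1 p - (resample ν (b k) f).1 p| ≤ 2 * C := by
        linarith [abs_sub (f.1 p) ((resample ν (b k) f).1 p), hC p, hRC k p]
      change ‖(f.1 p - (resample ν (b k) f).1 p) * (f.1 p - (resample ν (b k) f).1 p)‖ ≤ _
      rw [norm_mul]
      exact mul_le_mul h1 h1 (norm_nonneg _) ((abs_nonneg _).trans h1))
    (by
      filter_upwards [hlim] with p hp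
      have h1 : Tendsto (fun k => f.1 p - (resample ν (b k) f).1 p) atTop (𝓝 0) := by
        simpa using (tendsto_const_nhds (x := f.1 p)).sub hp
      simpa using h1.mul h1)
  rw [integral_zero] at this
  exact this

end Resample

/-! ### Spectral gap of the skew product -/

section SpectralGap

theorem measurePreserving_reindex {ι : Type*} {S : Type*} [MeasurableSpace S] (ν : Measure S)
    [IsProbabilityMeasure ν] (e : ι → ι) (he : Function.Injective e) :
    MeasurePreserving (fun (y : ι → S) j => y (e j)) (Measure.infinitePi fun _ : ι => ν)
      (Measure.infinitePi fun _ : ι => ν) :=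
  ⟨measurable_pi_lambda _ fun _ => measurable_pi_apply _,
    Measure.map_infinitePi_infinitePi_of_inj he⟩

variable {G : Type*} [Group G]

variable {Z : Type*} [MulAction G Z]

/-- The left translation of the edges of the Cayley tree. -/
def edgeShift (s : FreeGroup (Fin 2)) (j : FreeGroup (Fin 2) × Fin 2) :
    FreeGroup (Fin 2) × Fin 2 := (s * j.1, j.2)

theorem edgeShift_injective (s : FreeGroup (Fin 2)) : Function.Injective (edgeShift s) := by
  rintro ⟨t, i⟩ ⟨t', i'⟩ h
  simpa [edgeShift] using h

/-- The action of the generator `i` on the skew product with fibre `Z`, with the Bernoulli space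
written as the space of labellings of the edges of the Cayley tree by elements of `G`. -/
def edgeSkew (i : Fin 2) (p : (FreeGroup (Fin 2) × Fin 2 → G) × Z) :
    (FreeGroup (Fin 2) × Fin 2 → G) × Z :=
  (fun j => p.1 (edgeShift (FreeGroup.of i)⁻¹ j), p.1 (1, i) • p.2)

/-- The right inverse of `edgeSkew i`. -/
def edgeSkewInv (i : Fin 2) (p : (FreeGroup (Fin 2) × Fin 2 → G) × Z) :
    (FreeGroup (Fin 2) × Fin 2 → G) × Z :=
  (fun j => p.1 (edgeShift (FreeGroup.of i) j), (p.1 (FreeGroup.of i, i))⁻¹ • p.2)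

theorem edgeSkew_edgeSkewInv (i : Fin 2) (p : (FreeGroup (Fin 2) × Fin 2 → G) × Z) :
    edgeSkew i (edgeSkewInv i p) = p := by
  simp [edgeSkew, edgeSkewInv, edgeShift]

variable [MeasurableSpace G] [MeasurableSpace Z] [MeasurableInv G] (ν : Measure G)
  [IsProbabilityMeasure ν] (ζ : Measure Z) [IsProbabilityMeasure ζ]

theorem measurePreserving_edgeSkew (hZ : Measurable fun p : G × Z => p.1 • p.2)
    (hζ : ∀ g : G, MeasurePreserving (fun z : Z => g • z) ζ ζ) (i : Fin 2) :
    MeasurePreserving (edgeSkew (G := G) (Z := Z) i)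
      ((Measure.infinitePi fun _ => ν).prod ζ) ((Measure.infinitePi fun _ => ν).prod ζ) :=
  (measurePreserving_reindex ν _ (edgeShift_injective (FreeGroup.of i)⁻¹)).skew_product
    (g := fun y z => y (1, i) • z)
    (hZ.comp ((((measurable_pi_apply (1, i)).comp measurable_fst).prodMk measurable_snd :
      Measurable fun p : (FreeGroup (Fin 2) × Fin 2 → G) × Z => (p.1 (1, i), p.2))))
    (ae_of_all _ fun _ => (hζ _).map_eq)

theorem measurePreserving_edgeSkewInv (hZ : Measurable fun p : G × Z => p.1 • p.2)
    (hζ : ∀ g : G, MeasurePreserving (fun z : Z => g • z) ζ ζ) (i : Fin 2) :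
    MeasurePreserving (edgeSkewInv (G := G) (Z := Z) i)
      ((Measure.infinitePi fun _ => ν).prod ζ) ((Measure.infinitePi fun _ => ν).prod ζ) :=
  (measurePreserving_reindex ν _ (edgeShift_injective (FreeGroup.of i))).skew_product
    (g := fun y z => (y (FreeGroup.of i, i))⁻¹ • z)
    (hZ.comp ((((measurable_pi_apply (FreeGroup.of i, i)).comp measurable_fst).inv.prodMk
      measurable_snd : Measurable fun p : (FreeGroup (Fin 2) × Fin 2 → G) × Z =>
        ((p.1 (FreeGroup.of i, i))⁻¹, p.2))))
    (ae_of_all _ fun _ => (hζ _).map_eq)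

/-- The generator `i` maps functions supported on the ball of radius `k` around the unit to functions
supported on the part of the next larger ball in the direction of the inverse of `i`. -/
theorem resample_comp_edgeSkew (hZ : Measurable fun p : G × Z => p.1 • p.2)
    (hζ : ∀ g : G, MeasurePreserving (fun z : Z => g • z) ζ ζ) (i : Fin 2) (k : ℕ)
    (f : BddMeas ((FreeGroup (Fin 2) × Fin 2 → G) × Z)) :
    resample ν (edgeBallToward (i, false) (k + 1))
        (BddMeas.comp _ (measurePreserving_edgeSkew ν ζ hZ hζ i).measurable
          (resample ν (edgeBall 1 k) f)) =
      BddMeas.comp _ (measurePreserving_edgeSkew ν ζ hZ hζ i).measurable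
        (resample ν (edgeBall 1 k) f) := by
  refine resample_eq_of_dependsOn fun z y y' h => ?_
  have h1 : y (1, i) = y' (1, i) := by
    refine h _ ⟨⟨?_, ?_⟩, ?_, ?_⟩ <;> simp [letter_false, FreeGroup.norm_inv_eq]
  simp only [BddMeas.comp_apply, edgeSkew, h1]
  refine dependsOn_resample _ f _ fun j hj => h _ ?_
  have key : ∀ v : FreeGroup (Fin 2), (1⁻¹ * v).norm ≤ k →
      (1⁻¹ * ((FreeGroup.of i)⁻¹ * v)).norm ≤ k + 1 ∧
      ((letter (i, false))⁻¹ * ((FreeGroup.of i)⁻¹ * v)).norm ≤ k + 1 := by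
    intro v hv
    rw [inv_one, one_mul] at hv ⊢
    refine ⟨(FreeGroup.norm_mul_le _ _).trans ?_, ?_⟩
    · rw [FreeGroup.norm_inv_eq, FreeGroup.norm_of]; omega
    · rw [letter_false, inv_inv, mul_inv_cancel_left]; omega
  have e1 := key _ hj.1
  have e2 := key _ hj.2
  refine ⟨⟨e1.1, ?_⟩, e1.2, ?_⟩
  · simpa only [edgeShift, mul_assoc] using e2.1
  · simpa only [edgeShift, mul_assoc] using e2.2

/-- The generator `i` maps the functions on a ball that are orthogonal to those on its part in the
direction of `i` to functions that are orthogonal to the functions on the ball. -/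
theorem pairing_comp_edgeSkew_eq_zero (hZ : Measurable fun p : G × Z => p.1 • p.2)
    (hζ : ∀ g : G, MeasurePreserving (fun z : Z => g • z) ζ ζ) (i : Fin 2) (k : ℕ)
    (f h : BddMeas ((FreeGroup (Fin 2) × Fin 2 → G) × Z)) :
    BddMeas.pairing ((Measure.infinitePi fun _ => ν).prod ζ)
      (BddMeas.comp _ (measurePreserving_edgeSkew ν ζ hZ hζ i).measurable
        (resample ν (edgeBall 1 k) f - resample ν (edgeBallToward (i, true) k) f))
      (resample ν (edgeBall 1 k) h) = 0 := by
  have hT' := measurePreserving_edgeSkewInv ν ζ hZ hζ i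
  rw [← BddMeas.pairing_comp hT']
  set w := BddMeas.comp _ hT'.measurable (resample ν (edgeBall 1 k) h) with hw
  -- the edges on which `w` depends
  set C : Set (FreeGroup (Fin 2) × Fin 2) := edgeBall (FreeGroup.of i) k ∪ {(FreeGroup.of i, i)}
    with hC
  have hCw : resample ν C w = w := by
    refine resample_eq_of_dependsOn fun z y y' h => ?_
    have h1 : y (FreeGroup.of i, i) = y' (FreeGroup.of i, i) := h _ (Or.inr rfl)
    simp only [hw, BddMeas.comp_apply, edgeSkewInv, h1]
    refine dependsOn_resample _ _ _ fun j hj => h _ (Or.inl ?_)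
    obtain ⟨e1, e2⟩ := hj
    rw [inv_one, one_mul] at e1 e2
    constructor
    · rwa [edgeShift, inv_mul_cancel_left]
    · simpa only [edgeShift, mul_assoc, inv_mul_cancel_left] using e2
  have hinter : edgeBall 1 k ∩ C = edgeBallToward (i, true) k ∩ C := by
    ext j
    simp only [edgeBallToward, letter_true, hC, Set.mem_inter_iff, Set.mem_union,
      Set.mem_singleton_iff]
    constructor
    · rintro ⟨h1, h2 | rfl⟩
      · exact ⟨⟨h1, h2⟩, Or.inl h2⟩
      · refine ⟨⟨h1, ?_⟩, Or.inr rfl⟩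
        have hk : 1 ≤ k := by simpa using h1.1
        constructor <;> simp [FreeGroup.norm_inv_eq, hk]
    · rintro ⟨⟨h1, -⟩, h2⟩
      exact ⟨h1, h2⟩
  have hid : BddMeas.comp _ hT'.measurable
      (BddMeas.comp _ (measurePreserving_edgeSkew ν ζ hZ hζ i).measurable
        (resample ν (edgeBall 1 k) f - resample ν (edgeBallToward (i, true) k) f)) =
      resample ν (edgeBall 1 k) f - resample ν (edgeBallToward (i, true) k) f :=
    Subtype.ext <| funext fun p => by
      rw [BddMeas.comp_apply, BddMeas.comp_apply, edgeSkew_edgeSkewInv]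
  rw [hid, ← hCw, map_sub, LinearMap.sub_apply, pairing_resample, pairing_resample,
    resample_resample, resample_resample, hinter, sub_self]

/-- The spectral gap of the skew product: a function that is almost invariant under the two
generators is close to a function of the fibre coordinate. -/
theorem edge_spectral_gap (hZ : Measurable fun p : G × Z => p.1 • p.2)
    (hζ : ∀ g : G, MeasurePreserving (fun z : Z => g • z) ζ ζ)
    (f : BddMeas ((FreeGroup (Fin 2) × Fin 2 → G) × Z)) :
    ∫ p, (f.1 p - ∫ y, f.1 (y, p.2) ∂Measure.infinitePi fun _ => ν) ^ 2
        ∂(Measure.infinitePi fun _ => ν).prod ζ ≤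
      48 * ∑ i, ∫ p, (f.1 (edgeSkew i p) - f.1 p) ^ 2 ∂(Measure.infinitePi fun _ => ν).prod ζ := by
  set m := (Measure.infinitePi fun _ : FreeGroup (Fin 2) × Fin 2 => ν).prod ζ with hm
  set B := BddMeas.pairing m with hB
  set V : Fin 2 → _ →ₗ[ℝ] _ := fun i =>
    BddMeas.comp _ (measurePreserving_edgeSkew ν ζ hZ hζ i).measurable with hV
  set R := resample (ι := FreeGroup (Fin 2) × Fin 2) (Z := Z) ν with hR
  have hVB : ∀ i f g, B (V i f) (V i g) = B f g := fun i =>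
    BddMeas.pairing_comp (measurePreserving_edgeSkew ν ζ hZ hζ i)
  have hp : ∀ x, 0 ≤ B x x := BddMeas.pairing_self_nonneg m
  have hadd : ∀ x y, B (x + y) (x + y) ≤ 2 * B x x + 2 * B y y := BddMeas.pairing_add_self_le m
  have hLHS : ∫ p, (f.1 p - ∫ y, f.1 (y, p.2) ∂Measure.infinitePi fun _ => ν) ^ 2 ∂m =
      B (f - R (edgeBall 1 0) f) (f - R (edgeBall 1 0) f) := by
    rw [hB, BddMeas.pairing_apply]
    refine integral_congr_ae (ae_of_all _ fun p => ?_)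
    have : (R (edgeBall 1 0) f).1 p = ∫ y, f.1 (y, p.2) ∂Measure.infinitePi fun _ => ν := by
      rw [hR, resample_apply, edgeBall_zero]
      have : ∀ y : FreeGroup (Fin 2) × Fin 2 → G, splice ∅ p.1 y = y := fun y =>
        funext fun j => splice_of_notMem (Set.notMem_empty j) _ _
      simp only [this]
    simp only [← this]
    exact sq _
  have hRHS : ∀ i, ∫ p, (f.1 (edgeSkew i p) - f.1 p) ^ 2 ∂m = B (V i f - f) (V i f - f) := by
    intro i
    rw [hB, BddMeas.pairing_apply]
    exact integral_congr_ae (ae_of_all _ fun p => sq _)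
  rw [hLHS]
  simp only [hRHS]
  have hfin : ∀ N, B (R (edgeBall 1 N) f - R (edgeBall 1 0) f)
      (R (edgeBall 1 N) f - R (edgeBall 1 0) f) ≤
      6 * ∑ i, B (V i (R (edgeBall 1 N) f) - R (edgeBall 1 N) f)
        (V i (R (edgeBall 1 N) f) - R (edgeBall 1 N) f) := by
    intro N
    have := form_sub_le_of_paradoxical (B := B) (R := R) (V := V) (b := edgeBall 1)
      (bg := edgeBallToward) (N := N) (f := R (edgeBall 1 N) f)
      (BddMeas.pairing_comm m) hp (pairing_resample ζ) resample_resample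
      (fun g k => Set.inter_subset_left)
      (fun g k => Set.subset_inter (edgeBall_mono 1 k.le_succ)
        (edgeBall_subset (by simp [norm_letter]) k))
      (fun g g' k h => edgeBallToward_inter_subset h k) hVB
      (fun i k f => resample_comp_edgeSkew ν ζ hZ hζ i k f)
      (fun i k f h => pairing_comp_edgeSkew_eq_zero ν ζ hZ hζ i k f h)
      (by rw [hR, resample_resample, Set.inter_self])
    rwa [show R (edgeBall 1 0) (R (edgeBall 1 N) f) = R (edgeBall 1 0) f by
      rw [hR, resample_resample, Set.inter_eq_left.2 (edgeBall_mono 1 N.zero_le)]] at this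
  -- the approximation by functions of finitely many edges costs a factor in the constant
  set ε : ℕ → ℝ := fun N => B (f - R (edgeBall 1 N) f) (f - R (edgeBall 1 N) f) with hε
  have hbound : ∀ N, B (f - R (edgeBall 1 0) f) (f - R (edgeBall 1 0) f) ≤
      48 * ∑ i, B (V i f - f) (V i f - f) + 200 * ε N := by
    intro N
    set g := R (edgeBall 1 N) f with hg
    have hneg : B (g - f) (g - f) = ε N := by
      rw [hε, ← neg_sub f g]; simp only [map_neg, LinearMap.neg_apply, neg_neg]; rfl
    have h1 : ∀ i, B (V i g - g) (V i g - g) ≤ 4 * B (V i f - f) (V i f - f) + 6 * ε N := by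
      intro i
      have e1 := hadd (V i (g - f)) ((V i f - f) + (f - g))
      have e2 := hadd (V i f - f) (f - g)
      rw [hVB, hneg] at e1
      rw [show V i (g - f) + ((V i f - f) + (f - g)) = V i g - g by rw [map_sub]; abel] at e1
      have : B (f - g) (f - g) = ε N := rfl
      linarith
    have h2 := hadd (f - g) (g - R (edgeBall 1 0) f)
    rw [sub_add_sub_cancel] at h2
    have h3 := hfin N
    have h4 : B (f - g) (f - g) = ε N := rfl
    have h5 := hp (f - g)
    rw [Fin.sum_univ_two] at h3 ⊢
    linarith [h1 0, h1 1]
  have hlim : Tendsto ε atTop (𝓝 0) :=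
    tendsto_pairing_sub_resample ζ (fun _ _ h => edgeBall_mono 1 h) iUnion_edgeBall f
  refine ge_of_tendsto' (x := atTop)
    (f := fun N => 48 * ∑ i, B (V i f - f) (V i f - f) + 200 * ε N) ?_ hbound
  simpa using (tendsto_const_nhds (x := 48 * ∑ i, B (V i f - f) (V i f - f))).add
    (hlim.const_mul 200)

end SpectralGap

/-! ### The Bernoulli space and the cocycle of the skew product -/

namespace BernoulliSpace

section Edges

variable {G : Type*}

/-- The point of the Bernoulli space given by a labelling of the edges of the Cayley tree. -/
def ofEdges (y : FreeGroup (Fin 2) × Fin 2 → G) : BernoulliSpace G := fun t => (y (t, 0), y (t, 1))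

/-- The labelling of the edges of the Cayley tree given by a point of the Bernoulli space. -/
def toEdges (x : BernoulliSpace G) (j : FreeGroup (Fin 2) × Fin 2) : G :=
  if j.2 = 0 then (x j.1).1 else (x j.1).2

theorem toEdges_ofEdges (y : FreeGroup (Fin 2) × Fin 2 → G) : toEdges (ofEdges y) = y := by
  funext ⟨t, i⟩
  fin_cases i <;> rfl

theorem ofEdges_toEdges (x : BernoulliSpace G) : ofEdges (toEdges x) = x := rfl

theorem smul_apply (s : FreeGroup (Fin 2)) (x : BernoulliSpace G) (t : FreeGroup (Fin 2)) :
    (s • x) t = x (s⁻¹ * t) := rfl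

variable [MeasurableSpace G]

theorem measurable_toEdges : Measurable (toEdges : BernoulliSpace G → _) := by
  refine measurable_pi_lambda _ fun j => ?_
  have h : Measurable fun x : BernoulliSpace G => x j.1 := measurable_pi_apply j.1
  unfold toEdges
  split_ifs
  · exact measurable_fst.comp h
  · exact measurable_snd.comp h

theorem measurable_smul (s : FreeGroup (Fin 2)) :
    Measurable fun x : BernoulliSpace G => s • x :=
  measurable_pi_lambda _ fun t => measurable_pi_apply (s⁻¹ * t)

theorem measurable_ofEdges : Measurable (ofEdges : _ → BernoulliSpace G) :=
  measurable_pi_lambda _ fun t => (measurable_pi_apply (t, 0)).prodMk (measurable_pi_apply (t, 1))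

variable (G) in
/-- The measurable identification of edge labellings with points of the Bernoulli space. -/
def edgesEquiv : (FreeGroup (Fin 2) × Fin 2 → G) ≃ᵐ BernoulliSpace G where
  toFun := ofEdges
  invFun := toEdges
  left_inv := toEdges_ofEdges
  right_inv := ofEdges_toEdges
  measurable_toFun := measurable_ofEdges
  measurable_invFun := measurable_toEdges

variable (ν : Measure G) [IsProbabilityMeasure ν]

instance : IsProbabilityMeasure (bernoulliMeasure ν) :=
  inferInstanceAs (IsProbabilityMeasure (Measure.infinitePi _))

theorem measurePreserving_ofEdges :
    MeasurePreserving ofEdges (Measure.infinitePi fun _ => ν) (bernoulliMeasure ν) := by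
  have h1 := Measure.infinitePi_map_curry (fun (_ : FreeGroup (Fin 2)) (_ : Fin 2) => ν)
  have hpair : MeasurePreserving (fun y : Fin 2 → G => (y 0, y 1))
      (Measure.infinitePi fun _ => ν) (ν.prod ν) := by
    rw [Measure.infinitePi_eq_pi]
    exact measurePreserving_piFinTwo fun _ => ν
  have h2 := Measure.infinitePi_map_pi (ι := FreeGroup (Fin 2))
    (fun _ => Measure.infinitePi fun _ : Fin 2 => ν)
    (f := fun _ (y : Fin 2 → G) => (y 0, y 1)) (fun _ => hpair.measurable)
  have hm : Measurable fun (x : FreeGroup (Fin 2) → Fin 2 → G) t => (x t 0, x t 1) :=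
    measurable_pi_lambda _ fun t => hpair.measurable.comp (measurable_pi_apply t)
  rw [hpair.map_eq, ← h1, Measure.map_map hm (MeasurableEquiv.measurable _)] at h2
  exact ⟨hm.comp (MeasurableEquiv.measurable (MeasurableEquiv.curry _ _ G)), h2⟩

theorem measurePreserving_toEdges :
    MeasurePreserving toEdges (bernoulliMeasure ν) (Measure.infinitePi fun _ => ν) :=
  (measurePreserving_ofEdges ν).symm (edgesEquiv G)

theorem measurePreserving_smul (s : FreeGroup (Fin 2)) :
    MeasurePreserving (fun x : BernoulliSpace G => s • x) (bernoulliMeasure ν)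
      (bernoulliMeasure ν) :=
  measurePreserving_reindex (ν.prod ν) (fun t => s⁻¹ * t) (mul_right_injective s⁻¹)

theorem measure_forall_pow_eq_zero {A : Set (G × G)} (hA : MeasurableSet A)
    (hA1 : (ν.prod ν) A < 1) {s : FreeGroup (Fin 2)} (hs : s ≠ 1) :
    bernoulliMeasure ν {x | ∀ n : ℕ, x (s ^ n) ∈ A} = 0 := by
  have hinj : Function.Injective fun n : ℕ => s ^ n := IsMulTorsionFree.pow_right_injective hs
  have hle : ∀ N : ℕ, bernoulliMeasure ν {x | ∀ n : ℕ, x (s ^ n) ∈ A} ≤ (ν.prod ν) A ^ N := by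
    intro N
    calc _ ≤ bernoulliMeasure ν
          ((((Finset.range N).image fun n => s ^ n : Finset (FreeGroup (Fin 2))) :
            Set (FreeGroup (Fin 2))).pi fun _ => A) := by
          refine measure_mono fun x hx t ht => ?_
          obtain ⟨n, -, rfl⟩ := Finset.mem_image.1 (Finset.mem_coe.1 ht)
          exact hx n
      _ = (ν.prod ν) A ^ N := by
          refine (Measure.infinitePi_pi (fun _ : FreeGroup (Fin 2) => ν.prod ν)
            fun _ _ => hA).trans ?_
          rw [Finset.prod_const, Finset.card_image_of_injective _ hinj, Finset.card_range]
  exact le_antisymm (ge_of_tendsto' (ENNReal.tendsto_pow_atTop_nhds_zero_of_lt_one hA1) hle)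
    zero_le

/-- The Bernoulli action is essentially free as soon as some event has probability strictly between
`0` and `1`: a point fixed by `s ≠ 1` has constant labels along the infinite set of powers of `s`. -/
theorem ae_smul_ne {E : Set G} (hE : MeasurableSet E) (h0 : 0 < ν E) (h1 : 0 < ν Eᶜ) :
    ∀ᵐ x ∂bernoulliMeasure ν, ∀ s : FreeGroup (Fin 2), s • x = x → s = 1 := by
  rw [ae_all_iff]
  intro s
  by_cases hs : s = 1
  · exact ae_of_all _ fun _ _ => hs
  have hlt : ∀ F : Set G, MeasurableSet F → 0 < ν Fᶜ → (ν.prod ν) (F ×ˢ Set.univ) < 1 := by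
    intro F hF h
    rw [Measure.prod_prod, measure_univ, mul_one]
    have := prob_compl_eq_one_sub (μ := ν) hF
    rw [this] at h
    exact tsub_pos_iff_lt.1 h
  have e1 := measure_forall_pow_eq_zero ν (hE.prod MeasurableSet.univ) (hlt E hE h1) hs
  have e2 := measure_forall_pow_eq_zero ν (hE.compl.prod MeasurableSet.univ)
    (hlt Eᶜ hE.compl (by rwa [compl_compl])) hs
  filter_upwards [measure_eq_zero_iff_ae_notMem.1 e1, measure_eq_zero_iff_ae_notMem.1 e2]
    with x hx1 hx2 hsx
  exfalso
  have hpow : ∀ n : ℕ, x (s ^ n) = x 1 := by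
    intro n
    induction n with
    | zero => rw [pow_zero]
    | succ n ih =>
      rw [← ih]
      conv_lhs => rw [← hsx]
      rw [smul_apply, pow_succ', inv_mul_cancel_left]
  by_cases h : (x 1).1 ∈ E
  · exact hx1 fun n => by rw [hpow]; exact ⟨h, trivial⟩
  · exact hx2 fun n => by rw [hpow]; exact ⟨h, trivial⟩

end Edges

end BernoulliSpace

namespace SkewSpace

section Measurable

variable {G : Type*} [MeasurableSpace G]

theorem measurable_mk : Measurable fun p : BernoulliSpace G × G => (⟨p.1, p.2⟩ : SkewSpace G) :=
  measurable_comap_iff.2 measurable_id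

theorem measurable_toProd : Measurable (equivProd G) := comap_measurable _

theorem measurable_base : Measurable (base : SkewSpace G → BernoulliSpace G) :=
  measurable_fst.comp measurable_toProd

theorem measurable_fiber : Measurable (fiber : SkewSpace G → G) :=
  measurable_snd.comp measurable_toProd

variable (G) in
/-- The measurable identification of `Ω` with `X × G`. -/
def measurableEquivProd :
    SkewSpace G ≃ᵐ BernoulliSpace G × G where
  toEquiv := equivProd G
  measurable_toFun := measurable_toProd
  measurable_invFun := measurable_mk

variable (ν : Measure G) [IsProbabilityMeasure ν]

theorem measurePreserving_mk :
    MeasurePreserving (fun p : BernoulliSpace G × G => (⟨p.1, p.2⟩ : SkewSpace G))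
      ((bernoulliMeasure ν).prod ν) (SkewSpace.measure ν) :=
  ⟨measurable_mk, rfl⟩

theorem measurePreserving_toProd :
    MeasurePreserving (equivProd G) (SkewSpace.measure ν) ((bernoulliMeasure ν).prod ν) :=
  (measurePreserving_mk ν).symm (measurableEquivProd G).symm

instance : IsProbabilityMeasure (SkewSpace.measure ν) :=
  Measure.isProbabilityMeasure_map measurable_mk.aemeasurable

end Measurable

section Action

variable {G : Type*} [Group G]

/-- The cocycle of the skew product: `s • (x, h) = (s • x, cocycle s x * h)`. -/
def cocycle (s : FreeGroup (Fin 2)) (x : BernoulliSpace G) : G := (s • (⟨x, 1⟩ : SkewSpace G)).fiber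

theorem of_smul (i : Fin 2) (ω : SkewSpace G) :
    FreeGroup.of i • ω = ⟨FreeGroup.of i • ω.base, ω.base.toEdges (1, i) * ω.fiber⟩ := by
  change (FreeGroup.lift generatorPerm (FreeGroup.of i)) ω = _
  rw [FreeGroup.lift_apply_of]
  rfl

theorem base_smul (s : FreeGroup (Fin 2)) (ω : SkewSpace G) : (s • ω).base = s • ω.base := by
  induction s using FreeGroup.induction_on generalizing ω with
  | C1 => rw [one_smul, one_smul]
  | of i => rw [of_smul]
  | inv_of i h =>
    rw [eq_inv_smul_iff, ← h, smul_inv_smul]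
  | mul s t hs ht => rw [mul_smul, hs, ht, mul_smul]

theorem smul_mk (s : FreeGroup (Fin 2)) (x : BernoulliSpace G) (h : G) :
    s • (⟨x, h⟩ : SkewSpace G) = ⟨s • x, cocycle s x * h⟩ := by
  have e : (⟨x, h⟩ : SkewSpace G) = h⁻¹ • (⟨x, 1⟩ : SkewSpace G) := by
    rw [smul_def, inv_inv, one_mul]
  rw [e, smul_comm, smul_def, inv_inv, base_smul]
  rfl

theorem cocycle_of (i : Fin 2) (x : BernoulliSpace G) :
    cocycle (FreeGroup.of i) x = x.toEdges (1, i) := by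
  rw [cocycle, of_smul, mul_one]

theorem cocycle_mul (s t : FreeGroup (Fin 2)) (x : BernoulliSpace G) :
    cocycle (s * t) x = cocycle s (t • x) * cocycle t x := by
  rw [cocycle, mul_smul, smul_mk t, smul_mk s, mul_one]

theorem cocycle_one (x : BernoulliSpace G) : cocycle 1 x = 1 := by
  rw [cocycle, one_smul]

theorem cocycle_inv (s : FreeGroup (Fin 2)) (x : BernoulliSpace G) :
    cocycle s⁻¹ x = (cocycle s (s⁻¹ • x))⁻¹ := by
  rw [eq_inv_iff_mul_eq_one, ← cocycle_one (s⁻¹ • x), ← inv_mul_cancel s, cocycle_mul,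
    smul_inv_smul]

variable [MeasurableSpace G] [MeasurableMul₂ G] [MeasurableInv G]

theorem measurable_cocycle (s : FreeGroup (Fin 2)) :
    Measurable (cocycle s : BernoulliSpace G → G) := by
  have hof : ∀ i, Measurable (cocycle (FreeGroup.of i) : BernoulliSpace G → G) := fun i => by
    simp only [funext (cocycle_of (G := G) i)]
    exact (measurable_pi_apply (1, i)).comp BernoulliSpace.measurable_toEdges
  induction s using FreeGroup.induction_on with
  | C1 => simpa only [funext cocycle_one] using measurable_const
  | of i => exact hof i
  | inv_of i =>
    simp only [funext (cocycle_inv (G := G) (FreeGroup.of i))]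
    exact ((hof i).comp (BernoulliSpace.measurable_smul _)).inv
  | mul s t hs ht =>
    simp only [funext (cocycle_mul (G := G) s t)]
    exact (hs.comp (BernoulliSpace.measurable_smul t)).mul ht

theorem measurable_smul_free (s : FreeGroup (Fin 2)) :
    Measurable fun ω : SkewSpace G => s • ω := by
  have : (fun ω : SkewSpace G => s • ω) = fun ω =>
      (⟨s • ω.base, cocycle s ω.base * ω.fiber⟩ : SkewSpace G) :=
    funext fun ω => smul_mk s ω.base ω.fiber
  rw [this]
  exact measurable_mk.comp (((BernoulliSpace.measurable_smul s).comp measurable_base).prodMk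
    (((measurable_cocycle s).comp measurable_base).mul measurable_fiber))

theorem measurable_smul_group : Measurable fun p : G × SkewSpace G => p.1 • p.2 :=
  measurable_mk.comp ((measurable_base.comp measurable_snd).prodMk
    ((measurable_fiber.comp measurable_snd).mul measurable_fst.inv))

variable {Z : Type*} [MeasurableSpace Z] [MulAction G Z]

/-- The spectral gap of the skew product of the Bernoulli action with a pmp action of `G`. -/
theorem spectral_gap (ν : Measure G) [IsProbabilityMeasure ν] (ζ : Measure Z) [IsProbabilityMeasure ζ]
    (hZ : Measurable fun p : G × Z => p.1 • p.2)
    (hζ : ∀ g : G, MeasurePreserving (fun z : Z => g • z) ζ ζ)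
    (f : BddMeas (BernoulliSpace G × Z)) :
    ∫ p, (f.1 p - ∫ x, f.1 (x, p.2) ∂bernoulliMeasure ν) ^ 2 ∂(bernoulliMeasure ν).prod ζ ≤
      48 * ∑ i, ∫ p, (f.1 (FreeGroup.of i • p.1, cocycle (FreeGroup.of i) p.1 • p.2) - f.1 p) ^ 2
        ∂(bernoulliMeasure ν).prod ζ := by
  have hE := BernoulliSpace.measurePreserving_ofEdges ν
  have hEZ : MeasurePreserving (Prod.map BernoulliSpace.ofEdges id)
      ((Measure.infinitePi fun _ => ν).prod ζ) ((bernoulliMeasure ν).prod ζ) :=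
    hE.prod (MeasurePreserving.id ζ)
  have := edge_spectral_gap ν ζ hZ hζ (BddMeas.comp _ hEZ.measurable f)
  have hembE : MeasurableEmbedding (BernoulliSpace.ofEdges (G := G)) :=
    (BernoulliSpace.edgesEquiv G).measurableEmbedding
  have hemb : MeasurableEmbedding (Prod.map (BernoulliSpace.ofEdges (G := G)) (id : Z → Z)) :=
    ((BernoulliSpace.edgesEquiv G).prodCongr (MeasurableEquiv.refl Z)).measurableEmbedding
  simp only [← hEZ.integral_comp hemb, ← hE.integral_comp hembE, Prod.map, cocycle_of,
    BernoulliSpace.toEdges_ofEdges, id]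
  exact this

end Action

end SkewSpace

/-! ### Convergence of bounded sequences to zero in mean -/

section Mean

variable {P Q : Type*} [MeasurableSpace P] [MeasurableSpace Q]

theorem measurable_integral_right {m : Measure Q} [SFinite m] {f : P × Q → ℝ} (hf : Measurable f) :
    Measurable fun p => ∫ q, f (p, q) ∂m :=
  hf.stronglyMeasurable.integral_prod_right'.measurable

theorem abs_integral_le_of_abs_le {m : Measure P} [IsProbabilityMeasure m] {f : P → ℝ} {C : ℝ}
    (h : ∀ p, |f p| ≤ C) : |∫ p, f p ∂m| ≤ C := by
  simpa using norm_integral_le_of_norm_le_const (μ := m) (f := f) (ae_of_all _ h)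

theorem abs_abs_sub_le {a b C : ℝ} (ha : |a| ≤ C) (hb : |b| ≤ C) : |(|a - b|)| ≤ 2 * C := by
  rw [abs_abs]
  linarith [abs_sub a b]

/-- For bounded sequences, convergence to zero in mean only depends on the measure class. -/
theorem tendsto_integral_comp_zero {m : Measure P} {m' : Measure Q} [IsFiniteMeasure m]
    [IsFiniteMeasure m'] {Ψ : P → Q} (hΨ : Measure.QuasiMeasurePreserving Ψ m m') {v : ℕ → Q → ℝ}
    (hv : ∀ n, Measurable (v n)) {C : ℝ} (hC : ∀ n q, |v n q| ≤ C) (h0 : ∀ n q, 0 ≤ v n q)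
    (h : Tendsto (fun n => ∫ q, v n q ∂m') atTop (𝓝 0)) :
    Tendsto (fun n => ∫ p, v n (Ψ p) ∂m) atTop (𝓝 0) := by
  refine tendsto_of_subseq_tendsto fun ns hns => ?_
  have h1 : Tendsto (fun k => eLpNorm (v (ns k) - 0) 1 m') atTop (𝓝 0) := by
    have : ∀ k, eLpNorm (v (ns k) - 0) 1 m' = ENNReal.ofReal (∫ q, v (ns k) q ∂m') := by
      intro k
      rw [sub_zero, eLpNorm_one_eq_lintegral_enorm,
        ofReal_integral_eq_lintegral_ofReal (integrable_of_abs_le (hv _) (hC _))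
          (ae_of_all _ (h0 _))]
      refine lintegral_congr fun q => ?_
      rw [Real.enorm_eq_ofReal (h0 _ _)]
    simp only [this]
    simpa using ENNReal.tendsto_ofReal (h.comp hns)
  have h2 := tendstoInMeasure_of_tendsto_eLpNorm one_ne_zero
    (fun k => (hv (ns k)).aestronglyMeasurable) aestronglyMeasurable_zero h1
  obtain ⟨ms, -, hms⟩ := h2.exists_seq_tendsto_ae
  refine ⟨ms, ?_⟩
  have := tendsto_integral_of_dominated_convergence (μ := m)
    (F := fun k p => v (ns (ms k)) (Ψ p)) (f := fun _ => 0) (fun _ => C)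
    (fun k => ((hv _).comp hΨ.measurable).aestronglyMeasurable) (integrable_const _)
    (fun k => ae_of_all _ fun p => hC _ _) (hΨ.ae hms)
  simpa using this

/-- Convergence to zero in mean square implies convergence to zero in mean. -/
theorem tendsto_integral_abs_of_sq {m : Measure P} [IsProbabilityMeasure m] {v : ℕ → P → ℝ}
    (hv : ∀ n, Measurable (v n)) {C : ℝ} (hC : ∀ n p, |v n p| ≤ C)
    (h : Tendsto (fun n => ∫ p, v n p ^ 2 ∂m) atTop (𝓝 0)) :
    Tendsto (fun n => ∫ p, |v n p| ∂m) atTop (𝓝 0) := by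
  have hle : ∀ n, ∫ p, |v n p| ∂m ≤ Real.sqrt (∫ p, v n p ^ 2 ∂m) := by
    intro n
    set t := ∫ p, |v n p| ∂m with ht
    refine Real.le_sqrt_of_sq_le ?_
    have i1 : Integrable (fun p => v n p ^ 2) m := integrable_of_abs_le ((hv n).pow_const 2)
      (C := C ^ 2) fun p => by
        rw [abs_pow]; exact pow_le_pow_left₀ (abs_nonneg _) (hC n p) 2
    have i2 : Integrable (fun p => |v n p|) m := (integrable_of_abs_le (hv n) (hC n)).abs
    have h0 : 0 ≤ ∫ p, (|v n p| - t) ^ 2 ∂m := integral_nonneg fun p => sq_nonneg _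
    have h1 : ∫ p, (|v n p| - t) ^ 2 ∂m = ∫ p, v n p ^ 2 ∂m - 2 * t * t + t ^ 2 := by
      have : ∀ p, (|v n p| - t) ^ 2 = v n p ^ 2 - 2 * t * |v n p| + t ^ 2 := fun p => by
        rw [sub_sq, sq_abs]; ring
      simp only [this]
      rw [integral_add (f := fun p => v n p ^ 2 - 2 * t * |v n p|) (i1.sub (i2.const_mul _))
        (integrable_const _), integral_sub i1 (i2.const_mul _), integral_const_mul]
      simp [← ht]
    rw [h1] at h0
    nlinarith
  refine squeeze_zero (fun n => integral_nonneg fun p => abs_nonneg _) hle ?_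
  simpa using h.sqrt

end Mean

/-! ### Displacement functions on a locally compact group -/

section Displacement

variable {G : Type*} [Group G] [TopologicalSpace G] [IsTopologicalGroup G]
  [LocallyCompactSpace G] [SecondCountableTopology G] [MeasurableSpace G] [BorelSpace G]

open scoped Pointwise in
/-- Subadditive symmetric functions on `G` that converge to zero in mean converge to zero uniformly
on compact sets: average the inequality `D g ≤ D (g * h) + D h` over `h` in a compact set. -/
theorem tendstoUniformlyOn_of_subadditive {ν : Measure G} [IsProbabilityMeasure ν]
    (hν : Measure.haar ≪ ν) {D : ℕ → G → ℝ} (hD : ∀ n, Measurable (D n)) {C : ℝ}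
    (hC : ∀ n g, |D n g| ≤ C) (h0 : ∀ n g, 0 ≤ D n g) (hsymm : ∀ n g, D n g⁻¹ = D n g)
    (hsub : ∀ n g h, D n (g * h) ≤ D n g + D n h)
    (h : Tendsto (fun n => ∫ g, D n g ∂ν) atTop (𝓝 0)) {K : Set G} (hK : IsCompact K) :
    TendstoUniformlyOn D (fun _ => 0) atTop K := by
  obtain ⟨U, hU, hU1⟩ := exists_compact_mem_nhds (1 : G)
  set A := closure U with hA
  have hAc : IsCompact A := hU.closure
  have hA0 : 0 < (Measure.haar : Measure G) A :=
    (Measure.measure_pos_of_mem_nhds _ hU1).trans_le (measure_mono subset_closure)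
  have hAfin : (Measure.haar : Measure G) A ≠ ∞ := hAc.measure_lt_top.ne
  set B := closure (A ∪ K * A) with hB
  have hBc : IsCompact B := (hAc.union (hK.mul hAc)).closure
  have hBm : MeasurableSet B := isClosed_closure.measurableSet
  have hAm : MeasurableSet A := isClosed_closure.measurableSet
  have : IsFiniteMeasure ((Measure.haar : Measure G).restrict B) :=
    ⟨by rw [Measure.restrict_apply_univ]; exact hBc.measure_lt_top⟩
  have hlim : Tendsto (fun n => ∫ g in B, D n g ∂Measure.haar) atTop (𝓝 0) :=
    tendsto_integral_comp_zero (m := (Measure.haar : Measure G).restrict B) (m' := ν) (Ψ := id)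
      ⟨measurable_id, by
        rw [Measure.map_id]; exact Measure.absolutelyContinuous_of_le Measure.restrict_le_self
          |>.trans hν⟩ hD hC h0 h
  have hint : ∀ n, IntegrableOn (D n) B Measure.haar := fun n => integrable_of_abs_le (hD n) (hC n)
  set c := (Measure.haar : Measure G).real A with hc
  have hc0 : 0 < c := ENNReal.toReal_pos hA0.ne' hAfin
  have hkey : ∀ n, ∀ g ∈ K, c * D n g ≤ 2 * ∫ g in B, D n g ∂Measure.haar := by
    intro n g hg
    have hAB : A ⊆ B := Set.subset_union_left.trans subset_closure
    have hgA : (fun h => g * h) '' A ⊆ B := by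
      rintro _ ⟨h, hh, rfl⟩
      exact subset_closure (Or.inr (Set.mul_mem_mul hg hh))
    have hpre : A ⊆ (fun h => g * h) ⁻¹' B := fun h hh => hgA ⟨h, hh, rfl⟩
    have hmp := measurePreserving_mul_left (Measure.haar : Measure G) g
    have hemb : MeasurableEmbedding fun h : G => g * h := measurableEmbedding_mulLeft g
    have e1 : ∫ h in (fun h => g * h) ⁻¹' B, D n (g * h) ∂Measure.haar =
        ∫ h in B, D n h ∂Measure.haar := hmp.setIntegral_preimage_emb hemb (D n) B
    have i1 : IntegrableOn (fun h => D n (g * h)) ((fun h => g * h) ⁻¹' B) Measure.haar :=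
      (hmp.integrableOn_comp_preimage hemb).2 (hint n)
    calc c * D n g = ∫ _ in A, D n g ∂Measure.haar := by
          rw [setIntegral_const, smul_eq_mul]
      _ ≤ ∫ h in A, (D n (g * h) + D n h) ∂Measure.haar := by
          refine setIntegral_mono_on (integrableOn_const hAfin)
            ((i1.mono_set hpre).add ((hint n).mono_set hAB)) hAm fun h _ => ?_
          have := hsub n (g * h) h⁻¹
          rwa [mul_inv_cancel_right, hsymm] at this
      _ = ∫ h in A, D n (g * h) ∂Measure.haar + ∫ h in A, D n h ∂Measure.haar :=
          integral_add (i1.mono_set hpre) ((hint n).mono_set hAB)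
      _ ≤ ∫ h in (fun h => g * h) ⁻¹' B, D n (g * h) ∂Measure.haar +
            ∫ h in B, D n h ∂Measure.haar :=
          add_le_add
            (setIntegral_mono_set i1 (ae_of_all _ fun _ => h0 _ _) hpre.eventuallyLE)
            (setIntegral_mono_set (hint n) (ae_of_all _ fun _ => h0 _ _) hAB.eventuallyLE)
      _ = 2 * ∫ g in B, D n g ∂Measure.haar := by rw [e1]; ring
  rw [Metric.tendstoUniformlyOn_iff]
  intro ε hε
  filter_upwards [hlim.eventually_lt_const (show 0 < c * ε / 2 by positivity)] with n hn g hg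
  rw [dist_zero_left, Real.norm_of_nonneg (h0 n g)]
  have := hkey n g hg
  by_contra hcon
  push Not at hcon
  nlinarith [mul_le_mul_of_nonneg_left hcon hc0.le]

variable {Z : Type*} [MeasurableSpace Z] [MulAction G Z]

omit [TopologicalSpace G] [IsTopologicalGroup G] [LocallyCompactSpace G]
  [SecondCountableTopology G] [MeasurableSpace G] [BorelSpace G] in
/-- The displacement `g ↦ ‖k ∘ g - k‖₁` is symmetric. -/
theorem displacement_inv {ζ : Measure Z} (hζ : ∀ g : G, MeasurePreserving (fun z : Z => g • z) ζ ζ)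
    {k : Z → ℝ} (hk : Measurable k) (g : G) :
    ∫ z, |k (g⁻¹ • z) - k z| ∂ζ = ∫ z, |k (g • z) - k z| ∂ζ := by
  have h : Measurable fun z => |k (g⁻¹ • z) - k z| :=
    ((hk.comp (hζ g⁻¹).measurable).sub hk).abs
  rw [← (hζ g).map_eq, integral_map (hζ g).measurable.aemeasurable h.aestronglyMeasurable,
    (hζ g).map_eq]
  simp only [inv_smul_smul, abs_sub_comm]

omit [TopologicalSpace G] [IsTopologicalGroup G] [LocallyCompactSpace G]
  [SecondCountableTopology G] [MeasurableSpace G] [BorelSpace G] in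
/-- The displacement `g ↦ ‖k ∘ g - k‖₁` is subadditive. -/
theorem displacement_mul_le {ζ : Measure Z} [IsFiniteMeasure ζ]
    (hζ : ∀ g : G, MeasurePreserving (fun z : Z => g • z) ζ ζ)
    {k : Z → ℝ} (hk : Measurable k) {C : ℝ} (hC : ∀ z, |k z| ≤ C) (g h : G) :
    ∫ z, |k ((g * h) • z) - k z| ∂ζ ≤
      ∫ z, |k (g • z) - k z| ∂ζ + ∫ z, |k (h • z) - k z| ∂ζ := by
  have hm : ∀ g h : G, Measurable fun z => |k (g • z) - k (h • z)| := fun g h =>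
    ((hk.comp (hζ g).measurable).sub (hk.comp (hζ h).measurable)).abs
  have hi : ∀ g h : G, Integrable (fun z => |k (g • z) - k (h • z)|) ζ := fun g h =>
    integrable_of_abs_le (hm g h) fun z => abs_abs_sub_le (hC _) (hC _)
  have e1 : ∫ z, |k (g • z) - k z| ∂ζ = ∫ z, |k ((g * h) • z) - k (h • z)| ∂ζ := by
    have := hm g 1
    simp only [one_smul] at this
    conv_lhs => rw [← (hζ h).map_eq,
      integral_map (hζ h).measurable.aemeasurable this.aestronglyMeasurable]
    simp only [mul_smul]
  have i1 := hi h 1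
  have i2 := hi (g * h) 1
  simp only [one_smul] at i1 i2
  rw [e1, ← integral_add (hi _ _) i1]
  exact integral_mono i2 ((hi _ _).add i1) fun z => abs_sub_le _ _ _

end Displacement

/-! ### Coordinates on the orbit space -/

namespace SkewSpace

section Orbit

variable {G : Type*} [Group G] {Z : Type*} [MulAction G Z]

/-- The skew product action of the free group on `X × Z`. -/
def skewAct (s : FreeGroup (Fin 2)) (p : BernoulliSpace G × Z) : BernoulliSpace G × Z :=
  (s • p.1, cocycle s p.1 • p.2)

/-- The map `X × Z × G → F₂ \ Ω × Z`, `(x, w, h) ↦ (F₂ (x, h), h⁻¹ w)`. In these coordinates the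
diagonal action of `G` only moves `h`, and the invariance under the free group becomes invariance
under the skew product action on `X × Z`, up to moving `h`. -/
def toOrbit (q : (BernoulliSpace G × Z) × G) : OrbitSpace (FreeGroup (Fin 2)) (SkewSpace G) × Z :=
  (OrbitSpace.mk (FreeGroup (Fin 2)) ⟨q.1.1, q.2⟩, q.2⁻¹ • q.1.2)

theorem toOrbit_skewAct (s : FreeGroup (Fin 2)) (p : BernoulliSpace G × Z) (h : G) :
    toOrbit (skewAct s p, cocycle s p.1 * h) = toOrbit (p, h) := by
  refine Prod.ext ?_ ?_
  · have : OrbitSpace.mk (FreeGroup (Fin 2)) (s • (⟨p.1, h⟩ : SkewSpace G)) =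
        OrbitSpace.mk (FreeGroup (Fin 2)) ⟨p.1, h⟩ :=
      Quotient.sound' ⟨s, rfl⟩
    rwa [smul_mk] at this
  · simp only [toOrbit, skewAct, mul_inv_rev, mul_smul, inv_smul_smul]

theorem toOrbit_mul_inv (p : BernoulliSpace G × Z) (h g : G) :
    toOrbit (p, h * g⁻¹) = g • toOrbit (p, h) := by
  refine Prod.ext rfl ?_
  simp only [toOrbit, mul_inv_rev, inv_inv, mul_smul, Prod.smul_mk]

end Orbit

section Measure

variable {G : Type*} [Group G] [TopologicalSpace G] [IsTopologicalGroup G]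
  [LocallyCompactSpace G] [SecondCountableTopology G] [MeasurableSpace G] [BorelSpace G]
  {ν : Measure G} [IsProbabilityMeasure ν]

instance : IsProbabilityMeasure (OrbitSpace.measure (FreeGroup (Fin 2)) (SkewSpace.measure ν)) :=
  Measure.isProbabilityMeasure_map (measurable_iff_comap_le.2
    (MeasurableSpace.comap_le_iff_le_map.2 le_rfl)).aemeasurable

omit [Group G] [TopologicalSpace G] [IsTopologicalGroup G] [LocallyCompactSpace G]
  [SecondCountableTopology G] [MeasurableSpace G] [BorelSpace G] in
theorem _root_.OrbitSpace.measurable_mk {H Ω : Type*} [Group H] [MulAction H Ω]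
    [MeasurableSpace Ω] : Measurable (OrbitSpace.mk H : Ω → OrbitSpace H Ω) :=
  fun _ h => h

omit [TopologicalSpace G] [IsTopologicalGroup G] [LocallyCompactSpace G]
  [SecondCountableTopology G] [BorelSpace G] in
theorem measurePreserving_orbit_mk :
    MeasurePreserving (fun p : BernoulliSpace G × G =>
        OrbitSpace.mk (FreeGroup (Fin 2)) (⟨p.1, p.2⟩ : SkewSpace G))
      ((bernoulliMeasure ν).prod ν)
      (OrbitSpace.measure (FreeGroup (Fin 2)) (SkewSpace.measure ν)) :=
  MeasurePreserving.comp (g := OrbitSpace.mk (FreeGroup (Fin 2)))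
    ⟨OrbitSpace.measurable_mk, rfl⟩ (measurePreserving_mk ν)

variable {Z : Type*} [MeasurableSpace Z] [MulAction G Z] {ζ : Measure Z} [IsProbabilityMeasure ζ]

/-- For fixed `h`, the coordinate change `w ↦ h⁻¹ w` preserves `ζ`. -/
theorem measurePreserving_toOrbit (hZ : Measurable fun p : G × Z => p.1 • p.2)
    (hζ : ∀ g : G, MeasurePreserving (fun z : Z => g • z) ζ ζ) :
    MeasurePreserving (toOrbit (G := G) (Z := Z)) (((bernoulliMeasure ν).prod ζ).prod ν)
      ((OrbitSpace.measure (FreeGroup (Fin 2)) (SkewSpace.measure ν)).prod ζ) := by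
  have h1 : MeasurePreserving (fun q : (BernoulliSpace G × Z) × G => ((q.1.1, q.2), q.1.2))
      (((bernoulliMeasure ν).prod ζ).prod ν) (((bernoulliMeasure ν).prod ν).prod ζ) :=
    ((measurePreserving_prodAssoc (bernoulliMeasure ν) ν ζ).symm MeasurableEquiv.prodAssoc).comp
      (((MeasurePreserving.id _).prod Measure.measurePreserving_swap).comp
        (measurePreserving_prodAssoc (bernoulliMeasure ν) ζ ν))
  have h2 : Measurable (Function.uncurry fun (p : BernoulliSpace G × G) (z : Z) => p.2⁻¹ • z) :=
    hZ.comp ((measurable_snd.comp measurable_fst).inv.prodMk measurable_snd :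
      Measurable fun q : (BernoulliSpace G × G) × Z => (q.1.2⁻¹, q.2))
  exact ((measurePreserving_orbit_mk (ν := ν)).skew_product (g := fun p z => p.2⁻¹ • z) h2
    (ae_of_all _ fun p => (hζ _).map_eq)).comp h1

theorem measurePreserving_skewAct (hZ : Measurable fun p : G × Z => p.1 • p.2)
    (hζ : ∀ g : G, MeasurePreserving (fun z : Z => g • z) ζ ζ) (s : FreeGroup (Fin 2)) :
    MeasurePreserving (skewAct (G := G) (Z := Z) s) ((bernoulliMeasure ν).prod ζ)
      ((bernoulliMeasure ν).prod ζ) :=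
  (BernoulliSpace.measurePreserving_smul ν s).skew_product (g := fun x z => cocycle s x • z)
    (hZ.comp (((measurable_cocycle s).comp measurable_fst).prodMk measurable_snd :
      Measurable fun q : BernoulliSpace G × Z => (cocycle s q.1, q.2)))
    (ae_of_all _ fun _ => (hζ _).map_eq)

/-- With Haar measure in place of `ν`, the skew product action preserves the measure. -/
theorem quasiMeasurePreserving_skewAct (hν₁ : ν ≪ Measure.haar) (hν₂ : Measure.haar ≪ ν)
    (hZ : Measurable fun p : G × Z => p.1 • p.2)
    (hζ : ∀ g : G, MeasurePreserving (fun z : Z => g • z) ζ ζ) (s : FreeGroup (Fin 2)) :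
    Measure.QuasiMeasurePreserving
      (fun q : (BernoulliSpace G × Z) × G => (skewAct s q.1, cocycle s q.1.1 * q.2))
      (((bernoulliMeasure ν).prod ζ).prod ν) (((bernoulliMeasure ν).prod ζ).prod ν) := by
  have h : MeasurePreserving
      (fun q : (BernoulliSpace G × Z) × G => (skewAct s q.1, cocycle s q.1.1 * q.2))
      (((bernoulliMeasure ν).prod ζ).prod Measure.haar)
      (((bernoulliMeasure ν).prod ζ).prod Measure.haar) :=
    (measurePreserving_skewAct hZ hζ s).skew_product
      (g := fun p h => cocycle s p.1 * h)
      (((measurable_cocycle s).comp (measurable_fst.comp measurable_fst)).mul measurable_snd)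
      (ae_of_all _ fun p => map_mul_left_eq_self _ _)
  exact h.quasiMeasurePreserving.mono (Measure.AbsolutelyContinuous.rfl.prod hν₁)
    (Measure.AbsolutelyContinuous.rfl.prod hν₂)

theorem quasiMeasurePreserving_inv_mul_pair (hν₁ : ν ≪ Measure.haar) (hν₂ : Measure.haar ≪ ν)
    {A : Type*} [MeasurableSpace A] (α : Measure A) [SFinite α] :
    Measure.QuasiMeasurePreserving (fun q : (A × G) × G => ((q.1.1, q.2), q.2⁻¹ * q.1.2))
      ((α.prod ν).prod ν) ((α.prod ν).prod ν) := by
  have h : MeasurePreserving (fun q : (A × G) × G => ((q.1.1, q.2), q.2⁻¹ * q.1.2))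
      ((α.prod Measure.haar).prod Measure.haar) ((α.prod Measure.haar).prod Measure.haar) :=
    ((measurePreserving_prodAssoc α Measure.haar Measure.haar).symm MeasurableEquiv.prodAssoc).comp
      (((MeasurePreserving.id _).prod
        (measurePreserving_prod_inv_mul_swap Measure.haar Measure.haar)).comp
        (measurePreserving_prodAssoc α Measure.haar Measure.haar))
  exact h.quasiMeasurePreserving.mono ((Measure.AbsolutelyContinuous.rfl.prod hν₁).prod hν₁)
    ((Measure.AbsolutelyContinuous.rfl.prod hν₂).prod hν₂)

end Measure

end SkewSpace

/-! ### Averaging almost invariant functions -/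

theorem MeasureTheory.MeasurePreserving.integral_comp_of_measurable {P Q : Type*}
    [MeasurableSpace P] [MeasurableSpace Q] {m : Measure P} {m' : Measure Q} {T : P → Q}
    (hT : MeasurePreserving T m m') {f : Q → ℝ} (hf : Measurable f) :
    ∫ p, f (T p) ∂m = ∫ q, f q ∂m' := by
  rw [← hT.map_eq, integral_map hT.measurable.aemeasurable hf.aestronglyMeasurable]

theorem integral_le_add_add {P : Type*} [MeasurableSpace P] {m : Measure P} {f f₁ f₂ f₃ : P → ℝ}
    (h : Integrable f m) (h₁ : Integrable f₁ m) (h₂ : Integrable f₂ m) (h₃ : Integrable f₃ m)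
    (hle : ∀ p, f p ≤ f₁ p + f₂ p + f₃ p) :
    ∫ p, f p ∂m ≤ ∫ p, f₁ p ∂m + ∫ p, f₂ p ∂m + ∫ p, f₃ p ∂m := by
  calc _ ≤ ∫ p, ((f₁ + f₂) p + f₃ p) ∂m := integral_mono h ((h₁.add h₂).add h₃) hle
    _ = _ := by rw [integral_add (h₁.add h₂) h₃]; simp only [Pi.add_apply]; rw [integral_add h₁ h₂]

theorem OrbitSpace.measurable_smul {H G Ω : Type*} [Group H] [Group G] [MulAction H Ω]
    [MulAction G Ω] [SMulCommClass H G Ω] [MeasurableSpace Ω] {g : G}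
    (hg : Measurable fun ω : Ω => g • ω) : Measurable fun y : OrbitSpace H Ω => g • y :=
  fun _ hs => hg (OrbitSpace.measurable_mk hs)

namespace SkewSpace

section Transfer

variable {G : Type*} [Group G] [TopologicalSpace G] [IsTopologicalGroup G]
  [LocallyCompactSpace G] [SecondCountableTopology G] [MeasurableSpace G] [BorelSpace G]
  {ν : Measure G} [IsProbabilityMeasure ν]
  {Z : Type*} [MeasurableSpace Z] [MulAction G Z] {ζ : Measure Z} [IsProbabilityMeasure ζ]

variable (ν) in
/-- The average over `h` of a function on `F₂ \ Ω × Z` in the coordinates of `toOrbit`. -/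
def fiberMean (F : OrbitSpace (FreeGroup (Fin 2)) (SkewSpace G) × Z → ℝ)
    (p : BernoulliSpace G × Z) : ℝ := ∫ h, F (toOrbit (p, h)) ∂ν

variable (ν) in
/-- The average over `X` and `G` of a function on `F₂ \ Ω × Z` in the coordinates of `toOrbit`. -/
def totalMean (F : OrbitSpace (FreeGroup (Fin 2)) (SkewSpace G) × Z → ℝ) (w : Z) : ℝ :=
  ∫ x, fiberMean ν F (x, w) ∂bernoulliMeasure ν

omit [TopologicalSpace G] [IsTopologicalGroup G] [LocallyCompactSpace G]
  [SecondCountableTopology G] [BorelSpace G] [MeasurableSpace Z] in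
theorem abs_fiberMean_le {F : OrbitSpace (FreeGroup (Fin 2)) (SkewSpace G) × Z → ℝ} {C : ℝ}
    (hC : ∀ q, |F q| ≤ C) (p : BernoulliSpace G × Z) : |fiberMean ν F p| ≤ C :=
  abs_integral_le_of_abs_le fun _ => hC _

omit [TopologicalSpace G] [IsTopologicalGroup G] [LocallyCompactSpace G]
  [SecondCountableTopology G] [BorelSpace G] [MeasurableSpace Z] in
theorem abs_totalMean_le {F : OrbitSpace (FreeGroup (Fin 2)) (SkewSpace G) × Z → ℝ} {C : ℝ}
    (hC : ∀ q, |F q| ≤ C) (w : Z) : |totalMean ν F w| ≤ C :=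
  abs_integral_le_of_abs_le fun _ => abs_fiberMean_le hC _

theorem measurable_fiberMean (hZ : Measurable fun p : G × Z => p.1 • p.2)
    (hζ : ∀ g : G, MeasurePreserving (fun z : Z => g • z) ζ ζ)
    {F : OrbitSpace (FreeGroup (Fin 2)) (SkewSpace G) × Z → ℝ} (hF : Measurable F) :
    Measurable (fiberMean ν F) :=
  measurable_integral_right (hF.comp (measurePreserving_toOrbit (ν := ν) hZ hζ).measurable)

theorem measurable_totalMean (hZ : Measurable fun p : G × Z => p.1 • p.2)
    (hζ : ∀ g : G, MeasurePreserving (fun z : Z => g • z) ζ ζ)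
    {F : OrbitSpace (FreeGroup (Fin 2)) (SkewSpace G) × Z → ℝ} (hF : Measurable F) :
    Measurable (totalMean ν F) :=
  measurable_integral_right (P := Z) (f := fun q => fiberMean ν F (q.2, q.1))
    ((measurable_fiberMean hZ hζ hF).comp measurable_swap)

/-- Almost invariance under `G` means almost independence of the coordinate `h` of `toOrbit`. -/
theorem tendsto_toOrbit_sub_fiberMean (hν₁ : ν ≪ Measure.haar) (hν₂ : Measure.haar ≪ ν)
    (hZ : Measurable fun p : G × Z => p.1 • p.2)
    (hζ : ∀ g : G, MeasurePreserving (fun z : Z => g • z) ζ ζ)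
    {F : ℕ → OrbitSpace (FreeGroup (Fin 2)) (SkewSpace G) × Z → ℝ} (hF : ∀ n, Measurable (F n))
    {C : ℝ} (hC : ∀ n q, |F n q| ≤ C)
    (hinv : ∀ g : G, Tendsto (fun n => ∫ q, |F n (g • q) - F n q|
      ∂(OrbitSpace.measure (FreeGroup (Fin 2)) (SkewSpace.measure ν)).prod ζ) atTop (𝓝 0)) :
    Tendsto (fun n => ∫ q, |F n (toOrbit q) - fiberMean ν (F n) q.1|
      ∂((bernoulliMeasure ν).prod ζ).prod ν) atTop (𝓝 0) := by
  have hΘ := measurePreserving_toOrbit (ν := ν) hZ hζ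
  set α := (bernoulliMeasure ν).prod ζ with hα
  have hFT : ∀ n, Measurable fun q => F n (toOrbit q) := fun n => (hF n).comp hΘ.measurable
  have htrans : ∀ g : G, Tendsto (fun n => ∫ q : (BernoulliSpace G × Z) × G,
      |F n (toOrbit (q.1, q.2 * g)) - F n (toOrbit q)| ∂α.prod ν) atTop (𝓝 0) := by
    intro g
    refine (hinv g⁻¹).congr fun n => ?_
    have hsm : Measurable fun q : OrbitSpace (FreeGroup (Fin 2)) (SkewSpace G) × Z => g⁻¹ • q :=
      ((OrbitSpace.measurable_smul
        (measurable_smul_group.comp measurable_prodMk_left)).comp measurable_fst).prodMk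
        ((hζ g⁻¹).measurable.comp measurable_snd)
    rw [← hΘ.integral_comp_of_measurable (f := fun q => |F n (g⁻¹ • q) - F n q|)
      (((hF n).comp hsm).sub (hF n)).abs]
    refine integral_congr_ae (ae_of_all _ fun q => ?_)
    change |F n (g⁻¹ • toOrbit (q.1, q.2)) - _| = _
    rw [← toOrbit_mul_inv, inv_inv]
  set u : ℕ → ((BernoulliSpace G × Z) × G) × G → ℝ := fun n q =>
    |F n (toOrbit (q.1.1, q.1.2 * q.2)) - F n (toOrbit q.1)| with hu
  have hum : ∀ n, Measurable (u n) := fun n =>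
    (((hFT n).comp ((measurable_fst.comp measurable_fst).prodMk
      ((measurable_snd.comp measurable_fst).mul measurable_snd))).sub
      ((hFT n).comp measurable_fst)).abs
  have huC : ∀ n q, |u n q| ≤ 2 * C := fun n q => abs_abs_sub_le (hC _ _) (hC _ _)
  have hu0 : Tendsto (fun n => ∫ q, u n q ∂(α.prod ν).prod ν) atTop (𝓝 0) := by
    have h1 : ∀ n, ∫ q, u n q ∂(α.prod ν).prod ν = ∫ g, ∫ q, u n (q, g) ∂α.prod ν ∂ν :=
      fun n => integral_prod_symm _ (integrable_of_abs_le (hum n) (huC n))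
    simp only [h1]
    have := tendsto_integral_of_dominated_convergence (μ := ν)
      (F := fun n g => ∫ q, u n (q, g) ∂α.prod ν) (f := fun _ => 0) (fun _ => 2 * C)
      (fun n => (measurable_integral_right (P := G) (f := fun r => u n (r.2, r.1))
        ((hum n).comp measurable_swap)).aestronglyMeasurable) (integrable_const _)
      (fun n => ae_of_all _ fun g => abs_integral_le_of_abs_le fun q => huC n _)
      (ae_of_all _ htrans)
    simpa using this
  have hpair := tendsto_integral_comp_zero
    (quasiMeasurePreserving_inv_mul_pair (ν := ν) hν₁ hν₂ α) hum huC
    (fun n q => abs_nonneg _) hu0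
  simp only [hu, mul_inv_cancel_left] at hpair
  refine squeeze_zero (fun n => integral_nonneg fun q => abs_nonneg _) (fun n => ?_) hpair
  have hm : Measurable fun q : ((BernoulliSpace G × Z) × G) × G =>
      |F n (toOrbit (q.1.1, q.1.2)) - F n (toOrbit (q.1.1, q.2))| :=
    (((hFT n).comp measurable_fst).sub ((hFT n).comp
      ((measurable_fst.comp measurable_fst).prodMk measurable_snd))).abs
  have hmC : ∀ q : ((BernoulliSpace G × Z) × G) × G,
      |(|F n (toOrbit (q.1.1, q.1.2)) - F n (toOrbit (q.1.1, q.2))|)| ≤ 2 * C :=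
    fun q => abs_abs_sub_le (hC _ _) (hC _ _)
  rw [integral_prod _ (integrable_of_abs_le hm hmC)]
  refine integral_mono
    (integrable_of_abs_le ((hFT n).sub ((measurable_fiberMean hZ hζ (hF n)).comp
      measurable_fst)).abs fun q => abs_abs_sub_le (hC _ _) (abs_fiberMean_le (hC n) _))
    (integrable_of_abs_le (measurable_integral_right hm)
      fun q => abs_integral_le_of_abs_le fun k => hmC (q, k)) fun q => ?_
  have hi : Integrable (fun k => F n (toOrbit (q.1, k))) ν :=
    integrable_of_abs_le ((hFT n).comp measurable_prodMk_left) fun k => hC _ _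
  have : F n (toOrbit q) - fiberMean ν (F n) q.1 =
      ∫ k, (F n (toOrbit (q.1, q.2)) - F n (toOrbit (q.1, k))) ∂ν := by
    rw [integral_sub (integrable_const _) hi]
    simp [fiberMean]
  simp only [this]
  exact abs_integral_le_integral_abs

/-- The fibre means of almost invariant functions are almost invariant under the skew product action
of the free group, because the functions themselves live on the orbit space. -/
theorem tendsto_fiberMean_skewAct (hν₁ : ν ≪ Measure.haar) (hν₂ : Measure.haar ≪ ν)
    (hZ : Measurable fun p : G × Z => p.1 • p.2)
    (hζ : ∀ g : G, MeasurePreserving (fun z : Z => g • z) ζ ζ)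
    {F : ℕ → OrbitSpace (FreeGroup (Fin 2)) (SkewSpace G) × Z → ℝ} (hF : ∀ n, Measurable (F n))
    {C : ℝ} (hC : ∀ n q, |F n q| ≤ C)
    (hlim : Tendsto (fun n => ∫ q, |F n (toOrbit q) - fiberMean ν (F n) q.1|
      ∂((bernoulliMeasure ν).prod ζ).prod ν) atTop (𝓝 0)) (s : FreeGroup (Fin 2)) :
    Tendsto (fun n => ∫ p, |fiberMean ν (F n) (skewAct s p) - fiberMean ν (F n) p|
      ∂(bernoulliMeasure ν).prod ζ) atTop (𝓝 0) := by
  have hΘ := measurePreserving_toOrbit (ν := ν) hZ hζ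
  have hT := quasiMeasurePreserving_skewAct hν₁ hν₂ hZ hζ s
  set α := (bernoulliMeasure ν).prod ζ with hα
  set v : ℕ → (BernoulliSpace G × Z) × G → ℝ := fun n q =>
    |F n (toOrbit q) - fiberMean ν (F n) q.1| with hv
  have hvm : ∀ n, Measurable (v n) := fun n =>
    (((hF n).comp hΘ.measurable).sub ((measurable_fiberMean hZ hζ (hF n)).comp measurable_fst)).abs
  have hvC : ∀ n q, |v n q| ≤ 2 * C := fun n q =>
    abs_abs_sub_le (hC _ _) (abs_fiberMean_le (hC n) _)
  have h1 := tendsto_integral_comp_zero hT hvm hvC (fun n q => abs_nonneg _) hlim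
  refine squeeze_zero (fun n => integral_nonneg fun q => abs_nonneg _) (fun n => ?_)
    (by simpa using h1.add hlim)
  have hfm := measurable_fiberMean (ν := ν) hZ hζ (hF n)
  have hdm : Measurable fun p => |fiberMean ν (F n) (skewAct s p) - fiberMean ν (F n) p| :=
    ((hfm.comp (measurePreserving_skewAct (ν := ν) hZ hζ s).measurable).sub hfm).abs
  have e1 : ∫ p, |fiberMean ν (F n) (skewAct s p) - fiberMean ν (F n) p| ∂α =
      ∫ q : (BernoulliSpace G × Z) × G,
        |fiberMean ν (F n) (skewAct s q.1) - fiberMean ν (F n) q.1| ∂α.prod ν :=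
    ((measurePreserving_fst (μ := α) (ν := ν)).integral_comp_of_measurable hdm).symm
  have i1 : Integrable (fun q : (BernoulliSpace G × Z) × G =>
      v n (skewAct s q.1, cocycle s q.1.1 * q.2)) (α.prod ν) :=
    integrable_of_abs_le ((hvm n).comp hT.measurable) fun q => hvC n _
  have i2 : Integrable (v n) (α.prod ν) := integrable_of_abs_le (hvm n) (hvC n)
  rw [e1, ← integral_add i1 i2]
  refine integral_mono (integrable_of_abs_le (hdm.comp measurable_fst)
    fun q => abs_abs_sub_le (abs_fiberMean_le (hC n) _) (abs_fiberMean_le (hC n) _))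
    (i1.add i2) fun q => ?_
  simp only [hv, toOrbit_skewAct]
  rw [abs_sub_comm (F n (toOrbit (q.1, q.2))) (fiberMean ν (F n) (skewAct s q.1))]
  exact abs_sub_le _ _ _

/-- A bounded sequence of functions on `F₂ \ Ω × Z` that is almost invariant under the diagonal
action of `G` is asymptotically a sequence of almost invariant functions of the `Z`-coordinate. -/
theorem almost_invariant_eq_totalMean (hν₁ : ν ≪ Measure.haar) (hν₂ : Measure.haar ≪ ν)
    (hZ : Measurable fun p : G × Z => p.1 • p.2)
    (hζ : ∀ g : G, MeasurePreserving (fun z : Z => g • z) ζ ζ)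
    {F : ℕ → OrbitSpace (FreeGroup (Fin 2)) (SkewSpace G) × Z → ℝ} (hF : ∀ n, Measurable (F n))
    {C : ℝ} (hC : ∀ n q, |F n q| ≤ C)
    (hinv : ∀ g : G, Tendsto (fun n => ∫ q, |F n (g • q) - F n q|
      ∂(OrbitSpace.measure (FreeGroup (Fin 2)) (SkewSpace.measure ν)).prod ζ) atTop (𝓝 0)) :
    (∀ K : Set G, IsCompact K → TendstoUniformlyOn
      (fun n g => ∫ z, |totalMean ν (F n) (g • z) - totalMean ν (F n) z| ∂ζ) (fun _ => 0) atTop K) ∧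
    Tendsto (fun n => ∫ q, |F n q - totalMean ν (F n) q.2|
      ∂(OrbitSpace.measure (FreeGroup (Fin 2)) (SkewSpace.measure ν)).prod ζ) atTop (𝓝 0) := by
  have hΘ := measurePreserving_toOrbit (ν := ν) hZ hζ
  have hlim := tendsto_toOrbit_sub_fiberMean hν₁ hν₂ hZ hζ hF hC hinv
  have hact := tendsto_fiberMean_skewAct hν₁ hν₂ hZ hζ hF hC hlim
  set α := (bernoulliMeasure ν).prod ζ with hα
  set f : ℕ → BernoulliSpace G × Z → ℝ := fun n => fiberMean ν (F n) with hf
  set k : ℕ → Z → ℝ := fun n => totalMean ν (F n) with hk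
  have hfm : ∀ n, Measurable (f n) := fun n => measurable_fiberMean hZ hζ (hF n)
  have hkm : ∀ n, Measurable (k n) := fun n => measurable_totalMean hZ hζ (hF n)
  have hfC : ∀ n p, |f n p| ≤ C := fun n => abs_fiberMean_le (hC n)
  have hkC : ∀ n w, |k n w| ≤ C := fun n => abs_totalMean_le (hC n)
  have hTm := fun s => measurePreserving_skewAct (ν := ν) hZ hζ s
  -- the spectral gap
  have hfk : Tendsto (fun n => ∫ p, |f n p - k n p.2| ∂α) atTop (𝓝 0) := by
    refine tendsto_integral_abs_of_sq (fun n => (hfm n).sub ((hkm n).comp measurable_snd))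
      (C := 2 * C) (fun n p => ?_) ?_
    · rw [← abs_abs]; exact abs_abs_sub_le (hfC n _) (hkC n _)
    have hsq : ∀ i : Fin 2, Tendsto (fun n => ∫ p, (f n (skewAct (FreeGroup.of i) p) - f n p) ^ 2 ∂α)
        atTop (𝓝 0) := by
      intro i
      have := (hact (FreeGroup.of i)).const_mul (2 * C)
      rw [mul_zero] at this
      refine squeeze_zero (fun n => integral_nonneg fun q => sq_nonneg _) (fun n => ?_) this
      have hd : Measurable fun p => f n (skewAct (FreeGroup.of i) p) - f n p :=
        ((hfm n).comp (hTm _).measurable).sub (hfm n)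
      have hb : ∀ p, |f n (skewAct (FreeGroup.of i) p) - f n p| ≤ 2 * C := fun p => by
        rw [← abs_abs]; exact abs_abs_sub_le (hfC n _) (hfC n _)
      rw [← integral_const_mul]
      refine integral_mono (integrable_of_abs_le (hd.pow_const 2) (C := (2 * C) ^ 2) fun p => ?_)
        ((integrable_of_abs_le hd hb).abs.const_mul _) fun p => ?_
      · rw [abs_pow]; exact pow_le_pow_left₀ (abs_nonneg _) (hb p) 2
      · simp only
        rw [← sq_abs, sq]
        exact mul_le_mul_of_nonneg_right (hb p) (abs_nonneg _)
    have hsum := ((hsq 0).add (hsq 1)).const_mul 48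
    rw [add_zero, mul_zero] at hsum
    refine squeeze_zero (fun n => integral_nonneg fun q => sq_nonneg _) (fun n => ?_) hsum
    have := spectral_gap ν ζ hZ hζ ⟨f n, hfm n, C, hfC n⟩
    rw [Fin.sum_univ_two] at this
    exact this
  -- the averages over `X` and `G` are almost invariant in the mean
  have hcm : ∀ n, Measurable fun q : G × Z => |k n (q.1 • q.2) - k n q.2| := fun n =>
    (((hkm n).comp hZ).sub ((hkm n).comp measurable_snd)).abs
  have hcC : ∀ n (q : G × Z), |(|k n (q.1 • q.2) - k n q.2|)| ≤ 2 * C := fun n q =>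
    abs_abs_sub_le (hkC n _) (hkC n _)
  have hkν : Tendsto (fun n => ∫ q : G × Z, |k n (q.1 • q.2) - k n q.2| ∂ν.prod ζ)
      atTop (𝓝 0) := by
    set a := FreeGroup.of (0 : Fin 2) with ha
    have hlaw : MeasurePreserving (fun p : BernoulliSpace G × Z => (cocycle a p.1, p.2))
        α (ν.prod ζ) := by
      have : MeasurePreserving (cocycle a : BernoulliSpace G → G) (bernoulliMeasure ν) ν := by
        have h := (measurePreserving_eval_infinitePi
          (fun _ : FreeGroup (Fin 2) × Fin 2 => ν) (1, 0)).comp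
          (BernoulliSpace.measurePreserving_toEdges ν)
        rwa [ha, funext (cocycle_of (G := G) 0)]
      exact this.prod (MeasurePreserving.id ζ)
    have hfk' : Tendsto (fun n => ∫ p, |f n (skewAct a p) - k n (skewAct a p).2| ∂α)
        atTop (𝓝 0) :=
      hfk.congr fun n => ((hTm a).integral_comp_of_measurable
        ((hfm n).sub ((hkm n).comp measurable_snd)).abs).symm
    have hsum := (hfk'.add (hact a)).add hfk
    rw [add_zero, add_zero] at hsum
    refine squeeze_zero (fun n => integral_nonneg fun q => abs_nonneg _) (fun n => ?_) hsum
    rw [← hlaw.integral_comp_of_measurable (hcm n)]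
    have i1 : Integrable (fun p => |f n (skewAct a p) - k n (skewAct a p).2|) α :=
      integrable_of_abs_le (((hfm n).sub ((hkm n).comp measurable_snd)).abs.comp
        (hTm a).measurable) fun p => abs_abs_sub_le (hfC n _) (hkC n _)
    have i2 : Integrable (fun p => |f n (skewAct a p) - f n p|) α :=
      integrable_of_abs_le (((hfm n).comp (hTm a).measurable).sub (hfm n)).abs
        fun p => abs_abs_sub_le (hfC n _) (hfC n _)
    have i3 : Integrable (fun p => |f n p - k n p.2|) α :=
      integrable_of_abs_le ((hfm n).sub ((hkm n).comp measurable_snd)).abs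
        fun p => abs_abs_sub_le (hfC n _) (hkC n _)
    refine integral_le_add_add (integrable_of_abs_le ((hcm n).comp hlaw.measurable)
      fun p => hcC n _) i1 i2 i3 fun p => ?_
    change |k n (skewAct a p).2 - k n p.2| ≤ |f n (skewAct a p) - k n (skewAct a p).2| +
      |f n (skewAct a p) - f n p| + |f n p - k n p.2|
    rw [abs_sub_comm (f n (skewAct a p)) (k n (skewAct a p).2)]
    exact (abs_sub_le _ (f n p) _).trans (add_le_add_left (abs_sub_le _ _ _) _)
  have hD : Tendsto (fun n => ∫ g, ∫ z, |k n (g • z) - k n z| ∂ζ ∂ν) atTop (𝓝 0) :=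
    hkν.congr fun n => integral_prod _ (integrable_of_abs_le (hcm n) (hcC n))
  refine ⟨fun K hK => tendstoUniformlyOn_of_subadditive hν₂
    (D := fun n g => ∫ z, |k n (g • z) - k n z| ∂ζ)
    (fun n => measurable_integral_right (hcm n))
    (fun n g => abs_integral_le_of_abs_le fun z => hcC n (g, z))
    (fun n g => integral_nonneg fun z => abs_nonneg _)
    (fun n g => displacement_inv hζ (hkm n) g)
    (fun n g h => displacement_mul_le hζ (hkm n) (hkC n) g h) hD hK, ?_⟩
  have hsnd : MeasurePreserving (fun q : (BernoulliSpace G × Z) × G => (q.2, q.1.2))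
      (α.prod ν) (ν.prod ζ) :=
    (Measure.measurePreserving_swap (μ := ζ) (ν := ν)).comp
      ((measurePreserving_snd (μ := bernoulliMeasure ν) (ν := ζ)).prod (MeasurePreserving.id ν))
  have hinvm : ∀ n, Measurable fun q : G × Z => |k n (q.1⁻¹ • q.2) - k n q.2| := fun n =>
    (hcm n).comp (measurable_fst.inv.prodMk measurable_snd)
  have hkν' : Tendsto (fun n => ∫ q : (BernoulliSpace G × Z) × G,
      |k n (q.2⁻¹ • q.1.2) - k n q.1.2| ∂α.prod ν) atTop (𝓝 0) := by
    refine hD.congr fun n => ?_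
    rw [hsnd.integral_comp_of_measurable (f := fun q : G × Z => |k n (q.1⁻¹ • q.2) - k n q.2|)
      (hinvm n), integral_prod _ (integrable_of_abs_le (hinvm n) fun q => hcC n (q.1⁻¹, q.2))]
    simp only [displacement_inv hζ (hkm n)]
  have hfk' : Tendsto (fun n => ∫ q : (BernoulliSpace G × Z) × G, |f n q.1 - k n q.1.2| ∂α.prod ν)
      atTop (𝓝 0) :=
    hfk.congr fun n => ((measurePreserving_fst (μ := α) (ν := ν)).integral_comp_of_measurable
      ((hfm n).sub ((hkm n).comp measurable_snd)).abs).symm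
  have hsum := (hlim.add hfk').add hkν'
  rw [add_zero, add_zero] at hsum
  refine squeeze_zero (fun n => integral_nonneg fun q => abs_nonneg _) (fun n => ?_) hsum
  have hm0 : Measurable fun q : OrbitSpace (FreeGroup (Fin 2)) (SkewSpace G) × Z =>
      |F n q - k n q.2| := ((hF n).sub ((hkm n).comp measurable_snd)).abs
  rw [← hΘ.integral_comp_of_measurable hm0]
  have i1 : Integrable (fun q => |F n (toOrbit q) - f n q.1|) (α.prod ν) :=
    integrable_of_abs_le (((hF n).comp hΘ.measurable).sub ((hfm n).comp measurable_fst)).abs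
      fun q => abs_abs_sub_le (hC n _) (hfC n _)
  have i2 : Integrable (fun q : (BernoulliSpace G × Z) × G => |f n q.1 - k n q.1.2|) (α.prod ν) :=
    integrable_of_abs_le (((hfm n).sub ((hkm n).comp measurable_snd)).abs.comp measurable_fst)
      fun q => abs_abs_sub_le (hfC n _) (hkC n _)
  have i3 : Integrable (fun q : (BernoulliSpace G × Z) × G =>
      |k n (q.2⁻¹ • q.1.2) - k n q.1.2|) (α.prod ν) :=
    integrable_of_abs_le ((hinvm n).comp hsnd.measurable)
      fun q => abs_abs_sub_le (hkC n _) (hkC n _)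
  refine integral_le_add_add (integrable_of_abs_le (hm0.comp hΘ.measurable)
    fun q => abs_abs_sub_le (hC n _) (hkC n _)) i1 i2 i3 fun q => ?_
  change |F n (toOrbit q) - k n (q.2⁻¹ • q.1.2)| ≤ |F n (toOrbit q) - f n q.1| +
    |f n q.1 - k n q.1.2| + |k n (q.2⁻¹ • q.1.2) - k n q.1.2|
  rw [abs_sub_comm (k n (q.2⁻¹ • q.1.2)) (k n q.1.2)]
  exact (abs_sub_le _ (k n q.1.2) _).trans (add_le_add_left (abs_sub_le _ _ _) _)

end Transfer

end SkewSpace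

/-! ### Strong ergodicity with real functions -/

section RealFunctions

variable {G : Type*} [Group G] [TopologicalSpace G] {Y : Type*} [MeasurableSpace Y] [MulAction G Y]
  {m : Measure Y} [IsProbabilityMeasure m]

/-- Strong ergodicity follows from the concentration of almost invariant sequences of bounded
measurable real functions. -/
theorem isStronglyErgodicAction_of_real (hns : IsNonsingular G m)
    (H : ∀ (F : ℕ → Y → ℝ) (C : ℝ), (∀ n, Measurable (F n)) → (∀ n y, |F n y| ≤ C) →
      (∀ g : G, Tendsto (fun n => ∫ y, |F n (g • y) - F n y| ∂m) atTop (𝓝 0)) →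
      ∃ c : ℕ → ℝ, Tendsto (fun n => ∫ y, |F n y - c n| ∂m) atTop (𝓝 0)) :
    IsStronglyErgodicAction G m := by
  intro F C hF hC hinv
  have hFint : ∀ n, Integrable (F n) m := fun n => Integrable.of_bound (hF n) C (hC n)
  -- a continuous real linear part of `F`, made measurable and bounded everywhere
  have key : ∀ L : ℂ → ℝ, Measurable L → (∀ a b, |L a - L b| ≤ ‖a - b‖) → L 0 = 0 →
      ∃ c : ℕ → ℝ, Tendsto (fun n => ∫ y, |L (F n y) - c n| ∂m) atTop (𝓝 0) := by
    intro L hL hL1 hL0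
    set R : ℕ → Y → ℝ := fun n y => max (-|C|) (min |C| (L ((hF n).mk _ y))) with hR
    have hRm : ∀ n, Measurable (R n) := fun n =>
      measurable_const.max (measurable_const.min
        (hL.comp (hF n).stronglyMeasurable_mk.measurable))
    have hRC : ∀ n y, |R n y| ≤ |C| := fun n y =>
      abs_le.2 ⟨le_max_left _ _, max_le (neg_le_self (abs_nonneg C)) (min_le_left _ _)⟩
    have hRF : ∀ n, ∀ᵐ y ∂m, R n y = L (F n y) := fun n => by
      filter_upwards [(hF n).ae_eq_mk, hC n] with y hy hyC
      have h1 : |L (F n y)| ≤ |C| := by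
        have := hL1 (F n y) 0
        rw [hL0, sub_zero, sub_zero] at this
        exact this.trans (hyC.trans (le_abs_self C))
      rw [hR]
      simp only [← hy]
      rw [min_eq_right (abs_le.1 h1).2, max_eq_right (abs_le.1 h1).1]
    obtain ⟨c, hc⟩ := H R |C| hRm hRC fun g => by
      have hg := ((hinv {g} isCompact_singleton).tendsto_at (Set.mem_singleton g))
      refine squeeze_zero (fun n => integral_nonneg fun y => abs_nonneg _) (fun n => ?_) hg
      refine integral_mono_ae
        (integrable_of_abs_le (((hRm n).comp (hns g).measurable).sub (hRm n)).abs
          fun y => abs_abs_sub_le (hRC n _) (hRC n _))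
        (Integrable.norm (Integrable.sub ?_ (hFint n))) ?_
      · exact Integrable.of_bound ((hF n).comp_quasiMeasurePreserving (hns g)) C
          ((hns g).ae (hC n))
      · filter_upwards [hRF n, (hns g).ae (hRF n)] with y h1 h2
        rw [h1, h2]
        exact hL1 _ _
    refine ⟨c, hc.congr fun n => integral_congr_ae ?_⟩
    filter_upwards [hRF n] with y hy
    rw [hy]
  obtain ⟨c, hc⟩ := key Complex.re Complex.measurable_re
    (fun a b => by rw [← Complex.sub_re]; exact Complex.abs_re_le_norm _) Complex.zero_re
  obtain ⟨d, hd⟩ := key Complex.im Complex.measurable_im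
    (fun a b => by rw [← Complex.sub_im]; exact Complex.abs_im_le_norm _) Complex.zero_im
  have hsum := (hc.add hd).const_mul 2
  rw [add_zero, mul_zero] at hsum
  refine squeeze_zero (fun n => integral_nonneg fun y => norm_nonneg _) (fun n => ?_) hsum
  set v : ℂ := ⟨c n, d n⟩ with hv
  have i0 : Integrable (fun y => F n y - v) m := (hFint n).sub (integrable_const _)
  have hmean : v - ∫ z, F n z ∂m = -∫ z, (F n z - v) ∂m := by
    rw [integral_sub (hFint n) (integrable_const _)]; simp
  have h1 : ∫ y, ‖F n y - ∫ z, F n z ∂m‖ ∂m ≤ 2 * ∫ y, ‖F n y - v‖ ∂m := by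
    calc _ ≤ ∫ y, (‖F n y - v‖ + ∫ z, ‖F n z - v‖ ∂m) ∂m := by
          refine integral_mono ((hFint n).sub (integrable_const _)).norm
            (i0.norm.add (integrable_const _)) fun y => ?_
          calc ‖F n y - ∫ z, F n z ∂m‖ = ‖(F n y - v) + (v - ∫ z, F n z ∂m)‖ := by
                rw [sub_add_sub_cancel]
            _ ≤ ‖F n y - v‖ + ‖v - ∫ z, F n z ∂m‖ := norm_add_le _ _
            _ ≤ _ := by
                rw [hmean, norm_neg]
                exact add_le_add le_rfl (norm_integral_le_integral_norm _)
      _ = _ := by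
          rw [integral_add i0.norm (integrable_const _)]
          simp only [integral_const, probReal_univ, smul_eq_mul]
          ring
  refine h1.trans (mul_le_mul_of_nonneg_left ?_ zero_le_two)
  have ire : Integrable (fun y => |(F n y).re - c n|) m :=
    ((hFint n).re.sub (integrable_const _)).abs
  have iim : Integrable (fun y => |(F n y).im - d n|) m :=
    ((hFint n).im.sub (integrable_const _)).abs
  rw [← integral_add ire iim]
  exact integral_mono i0.norm (ire.add iim) fun y => Complex.norm_le_abs_re_add_abs_im _

theorem IsStronglyErgodicAction.tendsto_real (h : IsStronglyErgodicAction G m)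
    {k : ℕ → Y → ℝ} {C : ℝ} (hk : ∀ n, Measurable (k n)) (hC : ∀ n y, |k n y| ≤ C)
    (hinv : ∀ K : Set G, IsCompact K →
      TendstoUniformlyOn (fun n g => ∫ y, |k n (g • y) - k n y| ∂m) (fun _ => 0) atTop K) :
    Tendsto (fun n => ∫ y, |k n y - ∫ z, k n z ∂m| ∂m) atTop (𝓝 0) := by
  have := h (fun n y => (k n y : ℂ)) C
    (fun n => (Complex.measurable_ofReal.comp (hk n)).aestronglyMeasurable)
    (fun n => ae_of_all _ fun y => by rw [Complex.norm_real]; exact hC n y)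
    (fun K hK => by
      simp only [← Complex.ofReal_sub, Complex.norm_real, Real.norm_eq_abs]
      exact hinv K hK)
  have hint : ∀ n, ∫ z, (k n z : ℂ) ∂m = ((∫ z, k n z ∂m : ℝ) : ℂ) := fun n => integral_ofReal
  simpa only [hint, ← Complex.ofReal_sub, Complex.norm_real, Real.norm_eq_abs] using this

theorem ae_eq_of_integral_abs_sub_eq_zero {P : Type*} [MeasurableSpace P] {m : Measure P}
    [IsFiniteMeasure m] {f g : P → ℝ} (hf : Measurable f) (hg : Measurable g) {C : ℝ}
    (hfC : ∀ p, |f p| ≤ C) (hgC : ∀ p, |g p| ≤ C) (h : ∫ p, |f p - g p| ∂m = 0) :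
    ∀ᵐ p ∂m, f p = g p := by
  have hi : Integrable (fun p => |f p - g p|) m :=
    integrable_of_abs_le (hf.sub hg).abs fun p => abs_abs_sub_le (hfC p) (hgC p)
  filter_upwards [(integral_eq_zero_iff_of_nonneg (fun p => abs_nonneg _) hi).1 h] with p hp
  exact sub_eq_zero.1 (abs_eq_zero.1 hp)

end RealFunctions

/-! ### The action on the orbit space -/

namespace SkewSpace

section OrbitAction

variable {G : Type*} [Group G] [TopologicalSpace G] [IsTopologicalGroup G]
  [LocallyCompactSpace G] [SecondCountableTopology G] [MeasurableSpace G] [BorelSpace G]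
  {ν : Measure G} [IsProbabilityMeasure ν]

theorem isNonsingular_group (hν₁ : ν ≪ Measure.haar) (hν₂ : Measure.haar ≪ ν) :
    IsNonsingular G (SkewSpace.measure ν) := by
  intro g
  have h1 : Measure.QuasiMeasurePreserving (fun h : G => h * g⁻¹) ν ν :=
    (quasiMeasurePreserving_mul_right Measure.haar g⁻¹).mono hν₁ hν₂
  have h2 : Measure.QuasiMeasurePreserving
      (fun p : BernoulliSpace G × G => (p.1, p.2 * g⁻¹))
      ((bernoulliMeasure ν).prod ν) ((bernoulliMeasure ν).prod ν) := by
    have h : ((bernoulliMeasure ν).prod ν).map (Prod.map id fun h : G => h * g⁻¹) =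
        (bernoulliMeasure ν).prod (ν.map fun h : G => h * g⁻¹) := by
      rw [← Measure.map_prod_map _ _ measurable_id h1.measurable, Measure.map_id]
    refine ⟨measurable_fst.prodMk (measurable_snd.mul_const _), ?_⟩
    exact h.absolutelyContinuous.trans (Measure.AbsolutelyContinuous.rfl.prod h1.absolutelyContinuous)
  exact ((measurePreserving_mk ν).quasiMeasurePreserving.comp h2).comp
    (measurePreserving_toProd ν).quasiMeasurePreserving

theorem isNonsingular_orbit (hν₁ : ν ≪ Measure.haar) (hν₂ : Measure.haar ≪ ν) :
    IsNonsingular G (OrbitSpace.measure (FreeGroup (Fin 2)) (SkewSpace.measure ν)) := by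
  intro g
  have hg := isNonsingular_group hν₁ hν₂ g
  have hm := OrbitSpace.measurable_smul (H := FreeGroup (Fin 2)) hg.measurable
  refine ⟨hm, Measure.AbsolutelyContinuous.mk fun s hs h0 => ?_⟩
  rw [OrbitSpace.measure, Measure.map_apply OrbitSpace.measurable_mk hs] at h0
  rw [OrbitSpace.measure, Measure.map_apply hm hs,
    Measure.map_apply OrbitSpace.measurable_mk (hm hs)]
  exact hg.preimage_null h0

variable {Z : Type*} [MeasurableSpace Z] [MulAction G Z] {ζ : Measure Z}

/-- The indicator function of an invariant set is a constant almost invariant sequence, hence a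
function of the `Z`-coordinate. -/
theorem isErgodicAction_prod (hν₁ : ν ≪ Measure.haar) (hν₂ : Measure.haar ≪ ν)
    (hpmp : IsPMPAction G ζ) (herg : IsErgodicAction G ζ) :
    IsErgodicAction G
      ((OrbitSpace.measure (FreeGroup (Fin 2)) (SkewSpace.measure ν)).prod ζ) := by
  have := hpmp.isProbabilityMeasure
  intro A hA hinv
  set η := OrbitSpace.measure (FreeGroup (Fin 2)) (SkewSpace.measure ν) with hη
  set F : OrbitSpace (FreeGroup (Fin 2)) (SkewSpace G) × Z → ℝ := A.indicator fun _ => 1 with hF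
  have hFm : Measurable F := measurable_const.indicator hA
  have hFC : ∀ q, |F q| ≤ 1 := fun q => by by_cases h : q ∈ A <;> simp [hF, h]
  obtain ⟨h1, h2⟩ := almost_invariant_eq_totalMean hν₁ hν₂ hpmp.measurable hpmp.measurePreserving
    (F := fun _ => F) (fun _ => hFm) (fun _ => hFC) (fun g => by
      have : ∫ q, |F (g • q) - F q| ∂η.prod ζ = 0 := by
        refine integral_eq_zero_of_ae ?_
        filter_upwards [(hinv g).mem_iff] with q hq
        have hq' : g • q ∈ A ↔ q ∈ A := hq
        by_cases h : q ∈ A <;> simp [hF, hq', h]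
      simp [← hη, this])
  set k := totalMean ν F with hk
  have hkm : Measurable k := measurable_totalMean hpmp.measurable hpmp.measurePreserving hFm
  have hkC : ∀ z, |k z| ≤ 1 := abs_totalMean_le hFC
  have hFk : ∀ᵐ q ∂η.prod ζ, F q = k q.2 := by
    have h0 := tendsto_nhds_unique h2 tendsto_const_nhds
    exact ae_eq_of_integral_abs_sub_eq_zero hFm (hkm.comp measurable_snd) hFC (fun q => hkC q.2) h0.symm
  have hkinv : ∀ g : G, ∀ᵐ z ∂ζ, k (g • z) = k z := by
    intro g
    have h0 := tendsto_nhds_unique ((h1 {g} isCompact_singleton).tendsto_at (Set.mem_singleton g))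
      tendsto_const_nhds
    exact ae_eq_of_integral_abs_sub_eq_zero (hkm.comp (hpmp.measurePreserving g).measurable) hkm
      (fun z => hkC (g • z)) hkC h0.symm
  have hB : MeasurableSet {z | 1 / 2 < k z} := measurableSet_lt measurable_const hkm
  have hAB : A =ᵐ[η.prod ζ] Prod.snd ⁻¹' {z | 1 / 2 < k z} := by
    filter_upwards [hFk] with q hq
    refine propext ?_
    change q ∈ A ↔ 1 / 2 < k q.2
    rw [← hq]
    by_cases h : q ∈ A
    · simp [hF, h]; norm_num
    · simp [hF, h]
  have hsnd : MeasurePreserving (Prod.snd) (η.prod ζ) ζ := measurePreserving_snd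
  rw [measure_congr hAB, measure_congr hAB.compl, ← Set.preimage_compl,
    hsnd.measure_preimage hB.nullMeasurableSet, hsnd.measure_preimage hB.compl.nullMeasurableSet]
  refine herg _ hB fun g => ?_
  filter_upwards [hkinv g] with z hz
  refine propext ?_
  change 1 / 2 < k (g • z) ↔ 1 / 2 < k z
  rw [hz]

theorem exists_tendsto_prod (hν₁ : ν ≪ Measure.haar) (hν₂ : Measure.haar ≪ ν)
    (hpmp : IsPMPAction G ζ) (herg : IsStronglyErgodicAction G ζ)
    {F : ℕ → OrbitSpace (FreeGroup (Fin 2)) (SkewSpace G) × Z → ℝ} (hF : ∀ n, Measurable (F n))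
    {C : ℝ} (hC : ∀ n q, |F n q| ≤ C)
    (hinv : ∀ g : G, Tendsto (fun n => ∫ q, |F n (g • q) - F n q|
      ∂(OrbitSpace.measure (FreeGroup (Fin 2)) (SkewSpace.measure ν)).prod ζ) atTop (𝓝 0)) :
    ∃ c : ℕ → ℝ, Tendsto (fun n => ∫ q, |F n q - c n|
      ∂(OrbitSpace.measure (FreeGroup (Fin 2)) (SkewSpace.measure ν)).prod ζ) atTop (𝓝 0) := by
  have := hpmp.isProbabilityMeasure
  set η := OrbitSpace.measure (FreeGroup (Fin 2)) (SkewSpace.measure ν) with hη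
  obtain ⟨h1, h2⟩ := almost_invariant_eq_totalMean hν₁ hν₂ hpmp.measurable hpmp.measurePreserving
    hF hC hinv
  set k : ℕ → Z → ℝ := fun n => totalMean ν (F n) with hk
  have hkm : ∀ n, Measurable (k n) := fun n =>
    measurable_totalMean hpmp.measurable hpmp.measurePreserving (hF n)
  have hkC : ∀ n z, |k n z| ≤ C := fun n => abs_totalMean_le (hC n)
  have h3 := herg.tendsto_real hkm hkC h1
  have hsnd : MeasurePreserving (Prod.snd) (η.prod ζ) ζ := measurePreserving_snd
  set c : ℕ → ℝ := fun n => ∫ z, k n z ∂ζ with hc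
  have hcC : ∀ n, |c n| ≤ C := fun n => abs_integral_le_of_abs_le (hkC n)
  refine ⟨c, ?_⟩
  have hsum := h2.add h3
  rw [add_zero] at hsum
  refine squeeze_zero (fun n => integral_nonneg fun y => abs_nonneg _) (fun n => ?_) hsum
  have hm : Measurable fun z => |k n z - c n| := ((hkm n).sub_const _).abs
  rw [← hsnd.integral_comp_of_measurable hm]
  have i1 : Integrable (fun q => |F n q - k n q.2|) (η.prod ζ) :=
    integrable_of_abs_le ((hF n).sub ((hkm n).comp measurable_snd)).abs
      fun q => abs_abs_sub_le (hC n q) (hkC n _)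
  have i2 : Integrable (fun q : _ × Z => |k n q.2 - c n|) (η.prod ζ) :=
    integrable_of_abs_le (hm.comp measurable_snd) fun q => abs_abs_sub_le (hkC n _) (hcC n)
  rw [← integral_add i1 i2]
  exact integral_mono (integrable_of_abs_le ((hF n).sub_const _).abs
    fun q => abs_abs_sub_le (hC n q) (hcC n)) (i1.add i2) fun q => abs_sub_le _ _ _

theorem isStronglyErgodicAction_prod (hν₁ : ν ≪ Measure.haar) (hν₂ : Measure.haar ≪ ν)
    (hpmp : IsPMPAction G ζ) (herg : IsStronglyErgodicAction G ζ) :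
    IsStronglyErgodicAction G
      ((OrbitSpace.measure (FreeGroup (Fin 2)) (SkewSpace.measure ν)).prod ζ) := by
  have := hpmp.isProbabilityMeasure
  refine isStronglyErgodicAction_of_real (fun g => ?_) fun F C hF hC hinv =>
    exists_tendsto_prod hν₁ hν₂ hpmp herg hF hC hinv
  have h1 := isNonsingular_orbit hν₁ hν₂ g
  have h2 := (hpmp.measurePreserving g)
  refine ⟨(h1.measurable.comp measurable_fst).prodMk (h2.measurable.comp measurable_snd), ?_⟩
  have h : ((OrbitSpace.measure (FreeGroup (Fin 2)) (SkewSpace.measure ν)).prod ζ).map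
      (Prod.map (fun y => g • y) fun z : Z => g • z) = _ :=
    (Measure.map_prod_map _ _ h1.measurable h2.measurable).symm
  exact h.absolutelyContinuous.trans
    (h1.absolutelyContinuous.prod h2.quasiMeasurePreserving.absolutelyContinuous)

theorem isStronglyErgodicAction_orbit (hν₁ : ν ≪ Measure.haar) (hν₂ : Measure.haar ≪ ν) :
    IsStronglyErgodicAction G
      (OrbitSpace.measure (FreeGroup (Fin 2)) (SkewSpace.measure ν)) := by
  -- the product with the trivial action on a point
  let _ : MulAction G PUnit.{1} :=
    { smul := fun _ => id, one_smul := fun _ => rfl, mul_smul := fun _ _ _ => rfl }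
  have hpmp : IsPMPAction G (Measure.dirac PUnit.unit.{1}) :=
    ⟨inferInstance, inferInstance, measurable_snd, fun g => MeasurePreserving.id _⟩
  have herg : IsStronglyErgodicAction G (Measure.dirac PUnit.unit.{1}) := by
    intro F C _ _ _
    simp
  refine isStronglyErgodicAction_of_real (isNonsingular_orbit hν₁ hν₂) fun F C hF hC hinv => ?_
  set η := OrbitSpace.measure (FreeGroup (Fin 2)) (SkewSpace.measure ν) with hη
  have hfst : MeasurePreserving (Prod.fst) (η.prod (Measure.dirac PUnit.unit.{1})) η :=
    measurePreserving_fst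
  obtain ⟨c, hc⟩ := exists_tendsto_prod hν₁ hν₂ hpmp herg (F := fun n q => F n q.1)
    (fun n => (hF n).comp measurable_fst) (fun n q => hC n q.1) fun g =>
      (hinv g).congr fun n => (hfst.integral_comp_of_measurable
        (((hF n).comp (isNonsingular_orbit hν₁ hν₂ g).measurable).sub (hF n)).abs).symm
  exact ⟨c, hc.congr fun n => hfst.integral_comp_of_measurable
    (f := fun y => |F n y - c n|) ((hF n).sub_const _).abs⟩

end OrbitAction

end SkewSpace

/-! ### Convolution operators and the law of the cocycle -/

section Convolution

variable {G : Type*} [Group G] [TopologicalSpace G] [IsTopologicalGroup G]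
  [LocallyCompactSpace G] [MeasurableSpace G] [BorelSpace G]

/-- The left translation by `g` as a linear isometry of `L²(G)`. -/
def leftRegularIsometry (g : G) :
    Lp ℂ 2 (Measure.haar : Measure G) →ₗᵢ[ℂ] Lp ℂ 2 (Measure.haar : Measure G) where
  toFun := leftRegular g
  map_add' := smul_add _
  map_smul' c ξ := smul_comm _ c ξ
  norm_map' ξ := DomMulAct.norm_smul_Lp _ ξ

theorem leftRegular_mul (g g' : G) (ξ : Lp ℂ 2 (Measure.haar : Measure G)) :
    leftRegular (g * g') ξ = leftRegular g (leftRegular g' ξ) := by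
  rw [leftRegular, leftRegular, leftRegular, mul_inv_rev, DomMulAct.mk_mul, mul_smul]

theorem leftRegular_one (ξ : Lp ℂ 2 (Measure.haar : Measure G)) : leftRegular 1 ξ = ξ := by
  rw [leftRegular, inv_one, DomMulAct.mk_one, one_smul]

theorem inner_leftRegular (g : G) (ξ η : Lp ℂ 2 (Measure.haar : Measure G)) :
    inner ℂ (leftRegular g⁻¹ ξ) η = inner ℂ ξ (leftRegular g η) := by
  have h := (leftRegularIsometry g).inner_map_map (leftRegular g⁻¹ ξ) η
  rw [← h]
  change inner ℂ (leftRegular g (leftRegular g⁻¹ ξ)) (leftRegular g η) = _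
  rw [← leftRegular_mul, mul_inv_cancel, leftRegular_one]

variable [SecondCountableTopology G]

theorem convolutionOperator_apply (m : Measure G) [IsProbabilityMeasure m]
    (ξ : Lp ℂ 2 (Measure.haar : Measure G)) :
    convolutionOperator m ξ = ∫ g, leftRegular g ξ ∂m := rfl

theorem continuous_leftRegular (ξ : Lp ℂ 2 (Measure.haar : Measure G)) :
    Continuous fun g : G => leftRegular g ξ := by
  have h : Continuous fun g : G => (DomMulAct.mk g⁻¹ : Gᵈᵐᵃ) :=
    DomMulAct.continuous_mk.comp continuous_inv
  have : Fact ((2 : ℝ≥0∞) ≠ ∞) := ⟨by simp⟩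
  exact h.smul continuous_const

instance (m : Measure G) [IsProbabilityMeasure m] : IsProbabilityMeasure m.inv :=
  Measure.isProbabilityMeasure_map measurable_inv.aemeasurable

/-- The convolution operator of the image of `m` under inversion is the adjoint of that of `m`. -/
theorem convolutionOperator_inv (m : Measure G) [IsProbabilityMeasure m] :
    convolutionOperator m.inv = ContinuousLinearMap.adjoint (convolutionOperator m) := by
  rw [ContinuousLinearMap.eq_adjoint_iff]
  intro ξ η
  have hi : Integrable (fun g : G => leftRegular g⁻¹ ξ) m :=
    Integrable.of_bound ((continuous_leftRegular ξ).comp continuous_inv).aestronglyMeasurable ‖ξ‖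
      (ae_of_all _ fun g => (DomMulAct.norm_smul_Lp _ ξ).le)
  have e : convolutionOperator m.inv ξ = ∫ g, leftRegular g⁻¹ ξ ∂m :=
    integral_map measurable_inv.aemeasurable (continuous_leftRegular ξ).aestronglyMeasurable
  rw [e, convolutionOperator_apply, ← inner_conj_symm, ← integral_inner hi, ← integral_conj,
    ← integral_inner (integrable_leftRegular m η)]
  refine integral_congr_ae (ae_of_all _ fun g => ?_)
  change (starRingEnd ℂ) (inner ℂ η (leftRegular g⁻¹ ξ)) = inner ℂ ξ (leftRegular g η)
  rw [← inner_leftRegular g ξ η]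
  exact inner_conj_symm (𝕜 := ℂ) (leftRegular g⁻¹ ξ) η

theorem norm_convolutionOperator_inv (m : Measure G) [IsProbabilityMeasure m] :
    ‖convolutionOperator m.inv‖ = ‖convolutionOperator m‖ := by
  rw [convolutionOperator_inv]
  exact LinearIsometryEquiv.norm_map _ _

theorem convolutionOperator_mconv (m m' : Measure G) [IsProbabilityMeasure m]
    [IsProbabilityMeasure m'] [IsProbabilityMeasure (m.mconv m')] :
    convolutionOperator (m.mconv m') = (convolutionOperator m).comp (convolutionOperator m') := by
  ext1 ξ
  have hc : Continuous fun p : G × G => leftRegular (p.1 * p.2) ξ :=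
    (continuous_leftRegular ξ).comp continuous_mul
  have hi : Integrable (fun p : G × G => leftRegular (p.1 * p.2) ξ) (m.prod m') :=
    Integrable.of_bound hc.aestronglyMeasurable ‖ξ‖
      (ae_of_all _ fun g => (DomMulAct.norm_smul_Lp _ ξ).le)
  have e : convolutionOperator (m.mconv m') ξ = ∫ p, leftRegular (p.1 * p.2) ξ ∂m.prod m' :=
    integral_map measurable_mul.aemeasurable (continuous_leftRegular ξ).aestronglyMeasurable
  rw [e, integral_prod _ hi, ContinuousLinearMap.comp_apply, convolutionOperator_apply m]
  refine integral_congr_ae (ae_of_all _ fun g => ?_)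
  simp only [leftRegular_mul]
  exact (leftRegularIsometry g).toContinuousLinearMap.integral_comp_comm
    (integrable_leftRegular m' ξ)

theorem norm_convolutionOperator_dirac_one_le :
    ‖convolutionOperator (Measure.dirac (1 : G))‖ ≤ 1 := by
  refine ContinuousLinearMap.opNorm_le_bound _ zero_le_one fun ξ => ?_
  rw [convolutionOperator_apply, integral_dirac' _ _ (continuous_leftRegular ξ).stronglyMeasurable, leftRegular_one,
    one_mul]

end Convolution

/-- Every element of the free group is obtained from `1` by repeatedly adding a letter on the left
without cancellation. -/
theorem FreeGroup.induction_letter_mul {P : FreeGroup (Fin 2) → Prop} (one : P 1)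
    (letter_mul : ∀ g v, (letter g * v).norm = v.norm + 1 → P v → P (letter g * v))
    (s : FreeGroup (Fin 2)) : P s := by
  obtain ⟨n, hn⟩ : ∃ n, s.norm = n := ⟨_, rfl⟩
  induction n generalizing s with
  | zero => rwa [FreeGroup.norm_eq_zero.1 hn]
  | succ n ih =>
    rcases h : s.toWord with _ | ⟨g, l⟩
    · simp [FreeGroup.norm, h] at hn
    · have e : s = letter g * FreeGroup.mk l := by
        rw [letter, FreeGroup.mul_mk, ← FreeGroup.mk_toWord (x := s), h]; rfl
      have h1 : (FreeGroup.mk l : FreeGroup (Fin 2)).norm ≤ n := by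
        have := FreeGroup.norm_mk_le (L₁ := l)
        have h2 : s.norm = l.length + 1 := by rw [FreeGroup.norm, h]; rfl
        omega
      have h3 := FreeGroup.norm_mul_le (letter g) (FreeGroup.mk l)
      rw [norm_letter, ← e] at h3
      rw [e]
      refine letter_mul g _ ?_ (ih _ ?_)
      · rw [← e]; omega
      · omega

namespace SkewSpace

section CocycleLaw

variable {G : Type*} [Group G]

/-- The edge between `v⁻¹` and `(letter g * v)⁻¹`. -/
def stepEdge (g : Fin 2 × Bool) (v : FreeGroup (Fin 2)) : FreeGroup (Fin 2) × Fin 2 :=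
  (if g.2 then v⁻¹ else (letter g * v)⁻¹, g.1)

theorem cocycle_letter_mul (g : Fin 2 × Bool) (v : FreeGroup (Fin 2)) (x : BernoulliSpace G) :
    cocycle (letter g * v) x =
      (if g.2 then x.toEdges (stepEdge g v) else (x.toEdges (stepEdge g v))⁻¹) * cocycle v x := by
  obtain ⟨i, _ | _⟩ := g
  · rw [cocycle_mul, letter_false, cocycle_inv, cocycle_of, ← mul_smul]
    simp only [stepEdge, letter_false]
    fin_cases i <;> simp [BernoulliSpace.toEdges, BernoulliSpace.smul_apply]
  · rw [cocycle_mul, letter_true, cocycle_of]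
    simp only [stepEdge]
    fin_cases i <;> simp [BernoulliSpace.toEdges, BernoulliSpace.smul_apply]

theorem stepEdge_mem (g : Fin 2 × Bool) (v : FreeGroup (Fin 2)) {k : ℕ} :
    stepEdge g v ∈ edgeBall 1 k ↔ v.norm ≤ k ∧ (letter g * v).norm ≤ k := by
  have key : ∀ w : FreeGroup (Fin 2), (1⁻¹ * w⁻¹).norm = w.norm := fun w => by
    rw [inv_one, one_mul, FreeGroup.norm_inv_eq]
  obtain ⟨i, _ | _⟩ := g
  · have h : (letter (i, false) * v)⁻¹ * (FreeGroup.of i)⁻¹ = v⁻¹ := by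
      rw [letter_false]; group
    change (1⁻¹ * (letter (i, false) * v)⁻¹).norm ≤ k ∧
      (1⁻¹ * ((letter (i, false) * v)⁻¹ * (FreeGroup.of i)⁻¹)).norm ≤ k ↔ _
    rw [h, key, key, and_comm]
  · have h : v⁻¹ * (FreeGroup.of i)⁻¹ = (letter (i, true) * v)⁻¹ := by
      rw [letter_true]; group
    change (1⁻¹ * v⁻¹).norm ≤ k ∧ (1⁻¹ * (v⁻¹ * (FreeGroup.of i)⁻¹)).norm ≤ k ↔ _
    rw [h, key, key]

/-- The cocycle at `s` only depends on the edges of the path from the unit to `s⁻¹`. -/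
theorem cocycle_congr (s : FreeGroup (Fin 2)) {x x' : BernoulliSpace G}
    (h : ∀ j ∈ edgeBall 1 s.norm, x.toEdges j = x'.toEdges j) : cocycle s x = cocycle s x' := by
  induction s using FreeGroup.induction_letter_mul with
  | one => rw [cocycle_one, cocycle_one]
  | letter_mul g v hv ih =>
    have e := h (stepEdge g v) ((stepEdge_mem g v).2 ⟨by omega, le_rfl⟩)
    rw [cocycle_letter_mul, cocycle_letter_mul, e,
      ih fun j hj => h j (edgeBall_mono 1 (by omega) hj)]

variable [MeasurableSpace G]

/-- The law of `x ↦ (cocycle s x)⁻¹`. -/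
def cocycleLaw (ν : Measure G) [IsProbabilityMeasure ν] (s : FreeGroup (Fin 2)) : Measure G :=
  (bernoulliMeasure ν).map fun x => (cocycle s x)⁻¹

variable (ν : Measure G) [IsProbabilityMeasure ν]

/-- A function of the coordinates other than `j` is independent of the coordinate at `j`. -/
theorem _root_.map_prodMk_eval_eq_prod {ι S T : Type*} [MeasurableSpace S] [MeasurableSpace T]
    (ν : Measure S) [IsProbabilityMeasure ν] (j : ι) {A : (ι → S) → T} (hA : Measurable A)
    (hAj : ∀ y y', (∀ i ≠ j, y i = y' i) → A y = A y') :
    (Measure.infinitePi fun _ : ι => ν).map (fun y => (A y, y j)) =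
      ((Measure.infinitePi fun _ : ι => ν).map A).prod ν := by
  set π := Measure.infinitePi fun _ : ι => ν
  have hs := measurePreserving_splice ν ({j} : Set ι)
  have hj : MeasurePreserving (Function.eval j) π ν := measurePreserving_eval_infinitePi _ j
  have hm : Measurable fun y : ι → S => (A y, y j) := hA.prodMk (measurable_pi_apply j)
  have e : (fun p : (ι → S) × (ι → S) => (A (splice {j} p.1 p.2), splice {j} p.1 p.2 j)) =
      Prod.map A (Function.eval j) ∘ Prod.swap := by
    funext p
    refine Prod.ext (hAj _ _ fun i hi => splice_of_notMem (by simpa using hi) _ _)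
      (splice_of_mem rfl _ _)
  calc π.map (fun y => (A y, y j))
      = ((π.prod π).map fun p => splice {j} p.1 p.2).map (fun y => (A y, y j)) := by rw [hs.map_eq]
    _ = (π.prod π).map (Prod.map A (Function.eval j) ∘ Prod.swap) := by
        rw [Measure.map_map hm hs.measurable, ← e]; rfl
    _ = (π.map A).prod ν := by
        rw [← Measure.map_map (hA.prodMap hj.measurable) measurable_swap, Measure.prod_swap,
          ← Measure.map_prod_map _ _ hA hj.measurable, hj.map_eq]

variable [MeasurableMul₂ G] [MeasurableInv G]

instance (s : FreeGroup (Fin 2)) : IsProbabilityMeasure (cocycleLaw ν s) :=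
  Measure.isProbabilityMeasure_map (measurable_cocycle s).inv.aemeasurable

omit [MeasurableMul₂ G] [MeasurableInv G] in
theorem cocycleLaw_one : cocycleLaw ν 1 = Measure.dirac 1 := by
  simp [cocycleLaw, cocycle_one]

theorem cocycleLaw_eq_map (s : FreeGroup (Fin 2)) :
    cocycleLaw ν s = (Measure.infinitePi fun _ => ν).map
      fun y => (cocycle s (BernoulliSpace.ofEdges y))⁻¹ := by
  have hE := BernoulliSpace.measurePreserving_ofEdges ν
  have hm : Measurable fun x : BernoulliSpace G => (cocycle s x)⁻¹ := (measurable_cocycle s).inv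
  rw [cocycleLaw, ← hE.map_eq, Measure.map_map hm hE.measurable]
  rfl

/-- Along a reduced word, the increments of the cocycle are independent. -/
theorem cocycleLaw_letter_mul {g : Fin 2 × Bool} {v : FreeGroup (Fin 2)}
    (h : (letter g * v).norm = v.norm + 1) :
    cocycleLaw ν (letter g * v) = (cocycleLaw ν v).mconv (if g.2 then ν.inv else ν) := by
  set j := stepEdge g v with hj
  -- the last edge of the path to `(letter g * v)⁻¹` is not used by the path to `v⁻¹`
  have hjv : j ∉ edgeBall 1 v.norm := fun hc => by
    have := ((stepEdge_mem g v).1 hc).2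
    omega
  set A : (FreeGroup (Fin 2) × Fin 2 → G) → G := fun y => (cocycle v (BernoulliSpace.ofEdges y))⁻¹
  have hE := BernoulliSpace.measurePreserving_ofEdges ν
  have hA : Measurable A := (measurable_cocycle v).inv.comp hE.measurable
  have hAj : ∀ y y' : FreeGroup (Fin 2) × Fin 2 → G, (∀ i ≠ j, y i = y' i) → A y = A y' := by
    intro y y' hy
    refine congrArg Inv.inv (cocycle_congr v fun i hi => ?_)
    rw [BernoulliSpace.toEdges_ofEdges, BernoulliSpace.toEdges_ofEdges]
    exact hy i fun hc => hjv (hc ▸ hi)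
  have key := map_prodMk_eval_eq_prod ν j hA hAj
  have hlaw : (Measure.infinitePi fun _ => ν).map A = cocycleLaw ν v := (cocycleLaw_eq_map ν v).symm
  set f : G → G := fun u => if g.2 then u⁻¹ else u with hf
  have hfm : Measurable f := by
    rw [hf]; split_ifs; exacts [measurable_inv, measurable_id]
  have hfν : ν.map f = if g.2 then ν.inv else ν := by
    rw [hf]; split_ifs; exacts [rfl, Measure.map_id]
  have : SFinite (ν.map f) := inferInstance
  have e : (fun y => (cocycle (letter g * v) (BernoulliSpace.ofEdges y))⁻¹) =
      (fun p : G × G => p.1 * p.2) ∘ Prod.map id f ∘ fun y => (A y, y j) := by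
    funext y
    simp only [cocycle_letter_mul, BernoulliSpace.toEdges_ofEdges, Function.comp_apply, Prod.map,
      hf, A, mul_inv_rev, id, ← hj]
    split_ifs <;> simp
  have hm : Measurable fun y => (A y, y j) := hA.prodMk (measurable_pi_apply j)
  rw [cocycleLaw_eq_map, ← hfν]
  rw [e, ← Measure.map_map measurable_mul ((measurable_id.prodMap hfm).comp hm),
    ← Measure.map_map (measurable_id.prodMap hfm) hm, key, hlaw,
    ← Measure.map_prod_map _ _ measurable_id hfm, Measure.map_id]
  rfl

end CocycleLaw

theorem norm_convolutionOperator_cocycleLaw_le {G : Type*} [Group G] [TopologicalSpace G]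
    [IsTopologicalGroup G] [LocallyCompactSpace G] [SecondCountableTopology G] [MeasurableSpace G]
    [BorelSpace G] (ν : Measure G) [IsProbabilityMeasure ν] (s : FreeGroup (Fin 2)) :
    ‖convolutionOperator (cocycleLaw ν s)‖ ≤ ‖convolutionOperator ν‖ ^ s.norm := by
  induction s using FreeGroup.induction_letter_mul with
  | one =>
    simp only [cocycleLaw_one, FreeGroup.norm_one, pow_zero]
    exact norm_convolutionOperator_dirac_one_le
  | letter_mul g v hv ih =>
    have hp : IsProbabilityMeasure (if g.2 then ν.inv else ν) := by split_ifs <;> infer_instance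
    have hn : ‖convolutionOperator (if g.2 then ν.inv else ν)‖ = ‖convolutionOperator ν‖ := by
      split_ifs
      exacts [norm_convolutionOperator_inv ν, rfl]
    simp only [cocycleLaw_letter_mul ν hv]
    rw [convolutionOperator_mconv, hv, pow_succ, ← hn]
    refine (ContinuousLinearMap.opNorm_comp_le _ _).trans ?_
    rw [hn]
    exact mul_le_mul_of_nonneg_right ih (norm_nonneg _)

end SkewSpace

/-! ### Summability along the orbits of the free group -/

/-- The number of words of length `n + 1` in two free generators is `4 * 3 ^ n`. The proof bounds
the sum over the words that start with a given letter, by induction on the length. -/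
theorem tsum_pow_norm_lt_top {r : ℝ≥0∞} (hr : 3 * r < 1) :
    ∑' s : FreeGroup (Fin 2), r ^ s.norm < ⊤ := by
  classical
  -- `c` solves `c = r * (1 + 3 * c)`
  set c : ℝ≥0∞ := r * (1 - 3 * r)⁻¹ with hc
  have hr0 : (1 - 3 * r) ≠ 0 := (tsub_pos_of_lt hr).ne'
  have hr1 : (1 - 3 * r) ≠ ⊤ := ENNReal.sub_ne_top ENNReal.one_ne_top
  have hrt : r ≠ ⊤ := by
    rintro rfl
    simp at hr
  have hct : c ≠ ⊤ := ENNReal.mul_ne_top hrt (ENNReal.inv_ne_top.2 hr0)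
  have hcc : r + r * (3 * c) = c := by
    have h1 : c * (1 - 3 * r) = r := by
      rw [hc, mul_assoc, ENNReal.inv_mul_cancel hr0 hr1, mul_one]
    calc r + r * (3 * c) = c * (1 - 3 * r) + c * (3 * r) := by rw [h1]; ring
      _ = c := by rw [← mul_add, tsub_add_cancel_of_le hr.le, mul_one]
  -- the words of length at most `n` that start with `g`
  set S : Fin 2 × Bool → ℕ → FreeGroup (Fin 2) → Prop := fun g n s =>
    ((letter g)⁻¹ * s).norm < s.norm ∧ s.norm ≤ n with hS
  have hstart : ∀ s : FreeGroup (Fin 2), s = 1 ∨ ∃ g, ((letter g)⁻¹ * s).norm < s.norm := by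
    intro s
    induction s using FreeGroup.induction_letter_mul with
    | one => exact Or.inl rfl
    | letter_mul g v hv _ => exact Or.inr ⟨g, by rw [inv_mul_cancel_left]; omega⟩
  have hsplit : ∀ (n : ℕ) (s : FreeGroup (Fin 2)) (T : Finset (Fin 2 × Bool)),
      (∀ g, ((letter g)⁻¹ * s).norm < s.norm → g ∈ T) → s.norm ≤ n →
      r ^ s.norm ≤ (if s = 1 then 1 else 0) + ∑ g ∈ T, if S g n s then r ^ s.norm else 0 := by
    intro n s T hT hn
    rcases hstart s with rfl | ⟨g, hg⟩
    · simp
    · refine le_add_left ?_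
      have := Finset.single_le_sum (f := fun g => if S g n s then r ^ s.norm else 0)
        (fun _ _ => zero_le) (hT g hg)
      simpa only [hS, hg, hn, and_self, if_true] using this
  have hW : ∀ n g, ∑' s, (if S g n s then r ^ s.norm else 0) ≤ c := by
    intro n
    induction n with
    | zero =>
      intro g
      have : ∀ s, ¬ S g 0 s := fun s h => by
        have h1 := h.1
        have h2 := h.2
        omega
      simp [this]
    | succ n ih =>
      intro g
      have hcard : (Finset.univ.erase (g.1, !g.2)).card = 3 := by
        rw [Finset.card_erase_of_mem (Finset.mem_univ _)]; rfl
      rw [← (Equiv.mulLeft (letter g)).tsum_eq]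
      calc ∑' v, (if S g (n + 1) (letter g * v) then r ^ (letter g * v).norm else 0)
          ≤ ∑' v, r * ((if v = 1 then 1 else 0) +
              ∑ g' ∈ Finset.univ.erase (g.1, !g.2), if S g' n v then r ^ v.norm else 0) := by
            refine ENNReal.tsum_le_tsum fun v => ?_
            by_cases h : S g (n + 1) (letter g * v)
            · rw [if_pos h]
              have h1 := h.1
              have h2 := h.2
              rw [inv_mul_cancel_left] at h1
              have h3 : (letter g * v).norm = v.norm + 1 := by
                have := FreeGroup.norm_mul_le (letter g) v
                rw [norm_letter] at this
                omega
              rw [h3, pow_succ']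
              refine mul_le_mul' le_rfl ?_
              refine hsplit n v _ (fun g' hg' => ?_) (by omega)
              refine Finset.mem_erase.2 ⟨?_, Finset.mem_univ _⟩
              rintro rfl
              rw [letter_not, inv_inv] at hg'
              exact lt_asymm hg' h1
            · rw [if_neg h]
              exact zero_le
        _ = r * (1 + ∑ g' ∈ Finset.univ.erase (g.1, !g.2),
              ∑' v, if S g' n v then r ^ v.norm else 0) := by
            rw [ENNReal.tsum_mul_left, ENNReal.tsum_add, tsum_ite_eq,
              Summable.tsum_finsetSum fun _ _ => ENNReal.summable]
        _ ≤ r * (1 + ∑ g' ∈ Finset.univ.erase (g.1, !g.2), c) := by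
            gcongr with g' _
            exact ih g'
        _ = c := by
            rw [Finset.sum_const, hcard, mul_add, mul_one, nsmul_eq_mul]
            exact hcc
  have hfin : ∀ T : Finset (FreeGroup (Fin 2)), ∑ s ∈ T, r ^ s.norm ≤ 1 + 4 * c := by
    intro T
    set n := T.sup FreeGroup.norm
    calc ∑ s ∈ T, r ^ s.norm
        ≤ ∑ s ∈ T, ((if s = 1 then 1 else 0) + ∑ g, if S g n s then r ^ s.norm else 0) :=
          Finset.sum_le_sum fun s hs =>
            hsplit n s _ (fun g _ => Finset.mem_univ g) (Finset.le_sup (f := FreeGroup.norm) hs)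
      _ ≤ ∑' s, ((if s = 1 then 1 else 0) + ∑ g, if S g n s then r ^ s.norm else 0) :=
          ENNReal.sum_le_tsum T
      _ = 1 + ∑ g, ∑' s, if S g n s then r ^ s.norm else 0 := by
          rw [ENNReal.tsum_add, tsum_ite_eq, Summable.tsum_finsetSum fun _ _ => ENNReal.summable]
      _ ≤ 1 + ∑ g : Fin 2 × Bool, c := by
          gcongr with g _
          exact hW n g
      _ = 1 + 4 * c := by simp
  rw [ENNReal.tsum_eq_iSup_sum]
  exact (iSup_le hfin).trans_lt
    (ENNReal.add_lt_top.2 ⟨ENNReal.one_lt_top, (ENNReal.mul_ne_top (by simp) hct).lt_top⟩)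

section

variable {G : Type*} [Group G] [TopologicalSpace G] [IsTopologicalGroup G]
  [LocallyCompactSpace G] [SecondCountableTopology G] [MeasurableSpace G] [BorelSpace G]

/-- The norm of the convolution operator of `m` bounds the mean over `m` of the matrix coefficients
of a positive function in `L²(G)`. -/
theorem lintegral_lintegral_mul_translate_le {φ : G → ℝ≥0} (hφ : Measurable φ)
    (hφ2 : ∫⁻ h, (φ h : ℝ≥0∞) ^ 2 ∂(Measure.haar : Measure G) ≠ ⊤) :
    ∃ C : ℝ≥0∞, C ≠ ⊤ ∧ ∀ (m : Measure G) [IsProbabilityMeasure m],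
      ∫⁻ w, ∫⁻ h, (φ h : ℝ≥0∞) * φ (w⁻¹ * h) ∂Measure.haar ∂m ≤
        ENNReal.ofReal ‖convolutionOperator m‖ * C := by
  set f : G → ℂ := fun h => ((φ h : ℝ) : ℂ) with hf
  have hfm : Measurable f := Complex.measurable_ofReal.comp (measurable_coe_nnreal_real.comp hφ)
  have hfL : MemLp f 2 (Measure.haar : Measure G) := by
    refine ⟨hfm.aestronglyMeasurable, ?_⟩
    rw [eLpNorm_lt_top_iff_lintegral_rpow_enorm_lt_top (by simp) (by simp)]
    refine lt_of_eq_of_lt (lintegral_congr fun h => ?_) hφ2.lt_top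
    have : ‖f h‖ₑ = φ h := by
      rw [hf, ← ofReal_norm, Complex.norm_real, Real.norm_of_nonneg (NNReal.coe_nonneg _),
        ENNReal.ofReal_coe_nnreal]
    rw [this]
    norm_num
  set ξ := hfL.toLp f with hξ
  have hcoef : ∀ w : G, 0 ≤ (inner ℂ ξ (leftRegular w ξ)).re ∧ ∫⁻ h, (φ h : ℝ≥0∞) * φ (w⁻¹ * h) ∂Measure.haar =
      ENNReal.ofReal (inner ℂ ξ (leftRegular w ξ)).re := by
    intro w
    have e : ∀ᵐ h ∂(Measure.haar : Measure G), inner ℂ (ξ h) (leftRegular w ξ h) =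
        (((φ h : ℝ) * φ (w⁻¹ * h) : ℝ) : ℂ) := by
      have h1 := hfL.coeFn_toLp
      have h2 := (measurePreserving_mul_left (Measure.haar : Measure G)
        w⁻¹).quasiMeasurePreserving.ae h1
      filter_upwards [h1, h2, leftRegular_coeFn w ξ] with h k1 k2 k3
      rw [k3, hξ, k1, k2]
      simp [hf, mul_comm]
    have hi : Integrable (fun h => (φ h : ℝ) * φ (w⁻¹ * h)) (Measure.haar : Measure G) := by
      have := ((L2.integrable_inner (𝕜 := ℂ) ξ (leftRegular w ξ)).congr e).re
      simpa using this
    rw [L2.inner_def, integral_congr_ae e, integral_complex_ofReal, Complex.ofReal_re]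
    refine ⟨integral_nonneg fun h => by positivity, ?_⟩
    rw [ofReal_integral_eq_lintegral_ofReal hi (ae_of_all _ fun h => by positivity)]
    refine lintegral_congr fun h => ?_
    rw [ENNReal.ofReal_mul (NNReal.coe_nonneg _), ENNReal.ofReal_coe_nnreal,
      ENNReal.ofReal_coe_nnreal]
  refine ⟨ENNReal.ofReal (‖ξ‖ * ‖ξ‖), ENNReal.ofReal_ne_top, fun m _ => ?_⟩
  have hi : Integrable (fun w => inner ℂ ξ (leftRegular w ξ)) m :=
    (integrable_leftRegular m ξ).const_inner ξ
  simp only [(hcoef _).2]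
  have hre : Integrable (fun w => (inner ℂ ξ (leftRegular w ξ)).re) m := hi.re
  rw [← ofReal_integral_eq_lintegral_ofReal hre (ae_of_all _ fun w => (hcoef w).1),
    ← ENNReal.ofReal_mul (norm_nonneg _)]
  refine ENNReal.ofReal_le_ofReal ?_
  have e : ∫ w, (inner ℂ ξ (leftRegular w ξ)).re ∂m = (inner ℂ ξ (convolutionOperator m ξ)).re := by
    rw [convolutionOperator_apply, ← integral_inner (integrable_leftRegular m ξ)]
    exact integral_re hi
  refine e.trans_le ?_
  refine (Complex.re_le_norm _).trans ((norm_inner_le_norm _ _).trans ?_)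
  have := (convolutionOperator m).le_opNorm ξ
  nlinarith [norm_nonneg ξ]

end

namespace SkewSpace

variable {G : Type*} [Group G] [TopologicalSpace G] [IsTopologicalGroup G]
  [LocallyCompactSpace G] [SecondCountableTopology G] [MeasurableSpace G] [BorelSpace G]
  {ν : Measure G} [IsProbabilityMeasure ν]

/-- The sum of the mean matrix coefficients along the free group is dominated by
`∑ ‖convolutionOperator ν‖ ^ ‖s‖`, which is finite because the norm is less than `1 / 3`. -/
theorem exists_tsum_lt_top (hν₁ : ν ≪ Measure.haar) (hν : ‖convolutionOperator ν‖ < 1 / 3) :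
    ∃ φ : G → ℝ≥0, Measurable φ ∧ (∀ h, 0 < φ h) ∧ ∀ᵐ ω ∂SkewSpace.measure ν,
      ∑' s : FreeGroup (Fin 2), (φ (s • ω).fiber : ℝ≥0∞) < ⊤ := by
  obtain ⟨ψ, hψ0, hψm, hψ1⟩ := exists_pos_lintegral_lt_of_sigmaFinite
    (Measure.haar : Measure G) one_ne_zero
  -- a positive function in `L²(G)`
  set φ : G → ℝ≥0 := fun h => NNReal.sqrt (ψ h) with hφ
  have hφm : Measurable φ := NNReal.continuous_sqrt.measurable.comp hψm
  have hφ0 : ∀ h, 0 < φ h := fun h => NNReal.sqrt_pos.2 (hψ0 h)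
  have hφ2 : ∫⁻ h, (φ h : ℝ≥0∞) ^ 2 ∂(Measure.haar : Measure G) ≠ ⊤ := by
    have : ∀ h, (φ h : ℝ≥0∞) ^ 2 = ψ h := fun h => by
      rw [hφ, ← ENNReal.coe_pow, NNReal.sq_sqrt]
    simp only [this]
    exact (hψ1.trans ENNReal.one_lt_top).ne
  obtain ⟨C, hC, hbound⟩ := lintegral_lintegral_mul_translate_le hφm hφ2
  refine ⟨φ, hφm, hφ0, ?_⟩
  set r := ENNReal.ofReal ‖convolutionOperator ν‖
  have hr : 3 * r < 1 := by
    have : (3 : ℝ≥0∞) = ENNReal.ofReal 3 := by simp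
    rw [this, ← ENNReal.ofReal_mul (by norm_num), ENNReal.ofReal_lt_one]
    linarith
  have hφc : Measurable fun h => (φ h : ℝ≥0∞) := measurable_coe_nnreal_ennreal.comp hφm
  have hterm : ∀ s : FreeGroup (Fin 2), Measurable fun p : BernoulliSpace G × G =>
      (φ p.2 : ℝ≥0∞) * φ (cocycle s p.1 * p.2) := fun s =>
    (hφc.comp measurable_snd).mul
      (hφc.comp (((measurable_cocycle s).comp measurable_fst).mul measurable_snd))
  have hs : ∀ s : FreeGroup (Fin 2), ∫⁻ p : BernoulliSpace G × G,
      (φ p.2 : ℝ≥0∞) * φ (cocycle s p.1 * p.2) ∂(bernoulliMeasure ν).prod Measure.haar ≤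
        r ^ s.norm * C := by
    intro s
    have hm : Measurable fun w : G => ∫⁻ h, (φ h : ℝ≥0∞) * φ (w⁻¹ * h) ∂Measure.haar :=
      Measurable.lintegral_prod_right' (f := fun p : G × G => (φ p.2 : ℝ≥0∞) * φ (p.1⁻¹ * p.2))
        ((hφc.comp measurable_snd).mul (hφc.comp (measurable_fst.inv.mul measurable_snd)))
    have h1 := hbound (cocycleLaw ν s)
    have e : ∫⁻ w, ∫⁻ h, (φ h : ℝ≥0∞) * φ (w⁻¹ * h) ∂Measure.haar ∂cocycleLaw ν s = _ :=
      lintegral_map hm (measurable_cocycle s).inv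
    rw [e] at h1
    rw [lintegral_prod _ (hterm s).aemeasurable]
    simp only [inv_inv] at h1
    refine h1.trans ?_
    gcongr
    rw [← ENNReal.ofReal_pow (norm_nonneg _)]
    exact ENNReal.ofReal_le_ofReal (norm_convolutionOperator_cocycleLaw_le ν s)
  have htot : ∫⁻ p : BernoulliSpace G × G, ∑' s : FreeGroup (Fin 2),
      (φ p.2 : ℝ≥0∞) * φ (cocycle s p.1 * p.2) ∂(bernoulliMeasure ν).prod Measure.haar ≠ ⊤ := by
    rw [lintegral_tsum fun s => (hterm s).aemeasurable]
    refine ((ENNReal.tsum_le_tsum hs).trans_lt ?_).ne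
    rw [ENNReal.tsum_mul_right]
    exact ENNReal.mul_lt_top (tsum_pow_norm_lt_top hr) hC.lt_top
  have hae := ae_lt_top (Measurable.tsum fun s => hterm s) htot
  have hae' := (Measure.AbsolutelyContinuous.rfl.prod hν₁ :
    (bernoulliMeasure ν).prod ν ≪ (bernoulliMeasure ν).prod Measure.haar).ae_le hae
  filter_upwards [(measurePreserving_toProd ν).quasiMeasurePreserving.ae hae'] with ω hω
  have hω' : (φ ω.fiber : ℝ≥0∞) * ∑' s : FreeGroup (Fin 2), (φ (s • ω).fiber : ℝ≥0∞) < ⊤ := by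
    rw [← ENNReal.tsum_mul_left]
    refine lt_of_eq_of_lt (tsum_congr fun s => ?_) hω
    have : s • ω = ⟨s • ω.base, cocycle s ω.base * ω.fiber⟩ := smul_mk s ω.base ω.fiber
    rw [this]
    rfl
  exact ENNReal.lt_top_of_mul_ne_top_right hω'.ne (by simpa using (hφ0 ω.fiber).ne')

end SkewSpace

/-! ### Fundamental domains -/

section FundamentalDomain

variable {H : Type*} [Group H] {Ω L : Type*} [MulAction H Ω]

/-- The points of an orbit at which `Λ` is maximal. -/
def orbitMaxima (H : Type*) [Group H] {Ω L : Type*} [MulAction H Ω] [LE L] (Λ : Ω → L) : Set Ω :=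
  {ω | ∀ s : H, Λ (s • ω) ≤ Λ ω}

/-- An injective function attains its maximum at most once on a free orbit. -/
theorem eq_of_smul_mem_orbitMaxima [PartialOrder L] {Λ : Ω → L} (hΛ : Function.Injective Λ)
    {ω : Ω} (hfree : ∀ s : H, s • ω = ω → s = 1) {s t : H} (hs : s • ω ∈ orbitMaxima H Λ)
    (ht : t • ω ∈ orbitMaxima H Λ) : s = t := by
  have h1 := hs (t * s⁻¹)
  have h2 := ht (s * t⁻¹)
  rw [mul_smul, inv_smul_smul] at h1 h2
  have h3 : t • ω = s • ω := hΛ (le_antisymm h1 h2)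
  have h4 := hfree (t⁻¹ * s) (by rw [mul_smul, ← h3, inv_smul_smul])
  exact (inv_mul_eq_one.1 h4).symm

/-- Summability leaves only finitely many points of the orbit where `φ` is large. -/
theorem exists_smul_mem_orbitMaxima {S : Type*} [LinearOrder S] {φ : Ω → ℝ≥0∞}
    (hφ : ∀ ω, φ ω ≠ 0) (ι : Ω → S) {ω : Ω} (h : ∑' s : H, φ (s • ω) < ⊤) :
    ∃ s : H, s • ω ∈ orbitMaxima H fun ω => toLex (φ ω, ι ω) := by
  classical
  have hfin : {s : H | φ ω ≤ φ (s • ω)}.Finite :=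
    ENNReal.finite_const_le_of_tsum_ne_top h.ne (hφ ω)
  have hne : hfin.toFinset.Nonempty := ⟨1, by simp⟩
  obtain ⟨s, hs, hmax⟩ := Finset.exists_max_image hfin.toFinset
    (fun s : H => toLex (φ (s • ω), ι (s • ω))) hne
  rw [Set.Finite.mem_toFinset] at hs
  refine ⟨s, fun t => ?_⟩
  change toLex (φ (t • s • ω), ι (t • s • ω)) ≤ toLex (φ (s • ω), ι (s • ω))
  rw [← mul_smul]
  by_cases ht : φ ω ≤ φ ((t * s) • ω)
  · exact hmax _ (hfin.mem_toFinset.2 ht)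
  · exact Prod.Lex.toLex_le_toLex.2 (Or.inl ((not_le.1 ht).trans_le hs))

variable [MeasurableSpace Ω]

theorem measurableSet_orbitMaxima [Countable H] (hm : ∀ s : H, Measurable fun ω : Ω => s • ω)
    {φ : Ω → ℝ≥0∞} (hφ : Measurable φ) {ι : Ω → ℝ} (hι : Measurable ι) :
    MeasurableSet (orbitMaxima H fun ω : Ω => toLex (φ ω, ι ω)) := by
  have : (orbitMaxima H fun ω : Ω => toLex (φ ω, ι ω)) =
      ⋂ s : H, {ω | φ (s • ω) < φ ω ∨ φ (s • ω) = φ ω ∧ ι (s • ω) ≤ ι ω} := by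
    ext ω
    simp only [orbitMaxima, Set.mem_ofPred_eq, Set.mem_iInter, Prod.Lex.toLex_le_toLex]
  rw [this]
  exact MeasurableSet.iInter fun s => (measurableSet_lt (hφ.comp (hm s)) hφ).union
    ((measurableSet_eq_fun (hφ.comp (hm s)) hφ).inter (measurableSet_le (hι.comp (hm s)) hι))

/-- A measurable choice, for every point of `Ω` whose orbit meets `D`, of a translate of `D` that
contains the point. -/
theorem exists_measurable_inv_smul_mem [Countable H] [MeasurableSpace H]
    (hm : ∀ s : H, Measurable fun ω : Ω => s • ω) {D : Set Ω} (hD : MeasurableSet D) :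
    ∃ σ : Ω → H, Measurable σ ∧ ∀ (ω : Ω) (s : H), s • ω ∈ D → (σ ω)⁻¹ • ω ∈ D := by
  classical
  obtain ⟨e, he⟩ := exists_surjective_nat H
  set p : Ω → ℕ → Prop := fun ω n => (e n)⁻¹ • ω ∈ D ∨ ∀ k, (e k)⁻¹ • ω ∉ D with hp
  have hex : ∀ ω, ∃ n, p ω n := fun ω => by
    by_cases h : ∃ n, (e n)⁻¹ • ω ∈ D
    · obtain ⟨n, hn⟩ := h
      exact ⟨n, Or.inl hn⟩
    · exact ⟨0, Or.inr (not_exists.1 h)⟩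
  have hpm : ∀ n, MeasurableSet {ω | p ω n} := fun n => by
    have : {ω | p ω n} = (fun ω => (e n)⁻¹ • ω) ⁻¹' D ∪ ⋂ k, ((fun ω => (e k)⁻¹ • ω) ⁻¹' D)ᶜ := by
      ext ω; simp [hp]
    rw [this]
    exact (hm _ hD).union (MeasurableSet.iInter fun k => (hm _ hD).compl)
  refine ⟨fun ω => e (Nat.find (hex ω)),
    (measurable_from_top (f := e)).comp (measurable_find hex hpm), fun ω s hs => ?_⟩
  rcases Nat.find_spec (hex ω) with h | h
  · exact h
  · obtain ⟨k, hk⟩ := he s⁻¹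
    exact absurd (by rwa [hk, inv_inv]) (h k)

/-- If a positive function has finite sums along the orbits of an essentially free action of a
countable group, then it attains its maximum finitely often on every orbit. After breaking ties,
the points where it does form a fundamental domain. -/
theorem isDissipativeEssentiallyFree_of_tsum_lt_top [Countable H] [TopologicalSpace H]
    [DiscreteTopology H] [IsTopologicalGroup H] [LocallyCompactSpace H] [MeasurableSpace H]
    [BorelSpace H] [StandardBorelSpace Ω] {γ : Measure Ω} [IsProbabilityMeasure γ]
    (hγ : IsNonsingular H γ) (hfree : IsEssentiallyFree H γ) {φ : Ω → ℝ≥0∞} (hφm : Measurable φ)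
    (hφ : ∀ ω, φ ω ≠ 0) (hsum : ∀ᵐ ω ∂γ, ∑' s : H, φ (s • ω) < ⊤) :
    IsDissipativeEssentiallyFree H γ := by
  -- `ι` breaks the ties in the comparison of the values of `φ`
  obtain ⟨ι, hι⟩ := exists_measurableEmbedding_real Ω
  have hm : ∀ s : H, Measurable fun ω : Ω => s • ω := fun s => (hγ s).measurable
  set Λ : Ω → ℝ≥0∞ ×ₗ ℝ := fun ω => toLex (φ ω, ι ω) with hΛ
  have hΛi : Function.Injective Λ := fun ω ω' h =>
    hι.injective (congrArg Prod.snd (toLex.injective h))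
  set D : Set Ω := orbitMaxima H Λ with hDdef
  have hD : MeasurableSet D := measurableSet_orbitMaxima hm hφm hι.measurable
  have hex : ∀ᵐ ω ∂γ, ∃ s : H, s • ω ∈ D := by
    filter_upwards [hsum] with ω hω using exists_smul_mem_orbitMaxima hφ ι hω
  obtain ⟨σ, hσm, hσ⟩ := exists_measurable_inv_smul_mem hm hD
  have hD0 : γ D ≠ 0 := by
    intro h0
    have h1 : ∀ᵐ ω ∂γ, ∀ s : H, s • ω ∉ D := ae_all_iff.2 fun s =>
      (hγ s).ae (measure_eq_zero_iff_ae_notMem.1 h0)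
    have h2 : ∀ᵐ _ ∂γ, False := by
      filter_upwards [h1, hex] with ω k1 ⟨s, hs⟩ using k1 s hs
    obtain ⟨_, h3⟩ := h2.exists
    exact h3
  set η := ProbabilityTheory.cond γ D with hη
  have hηp : IsProbabilityMeasure η := ProbabilityTheory.cond_isProbabilityMeasure hD0
  have hηγ : η ≪ γ := ProbabilityTheory.cond_absolutelyContinuous
  have hηD : ∀ᵐ y ∂η, y ∈ D := ProbabilityTheory.ae_cond_mem hD
  have hη0 : ∀ A : Set Ω, η A = 0 → γ (D ∩ A) = 0 := fun A hA => by
    rw [hη, ProbabilityTheory.cond_apply hD] at hA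
    rcases mul_eq_zero.1 hA with h | h
    · exact absurd (ENNReal.inv_eq_zero.1 h) (measure_ne_top γ D)
    · exact h
  -- Haar measure charges the points of a discrete group
  have hatom : ∀ {P : H → Prop}, (∀ᵐ s ∂(Measure.haar : Measure H), P s) → ∀ s, P s := by
    intro P hP s
    by_contra hs
    have h1 : (Measure.haar : Measure H) {s} = 0 :=
      measure_mono_null (by simpa using hs) (ae_iff.1 hP)
    exact (isOpen_discrete {s}).measure_ne_zero Measure.haar (Set.singleton_nonempty s) h1
  have hsnd : ∀ {P : Ω → Prop}, (∀ᵐ y ∂η, P y) →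
      ∀ᵐ p ∂(Measure.haar : Measure H).prod η, P p.2 := fun hP =>
    Measure.quasiMeasurePreserving_snd.ae hP
  have hθm : Measurable fun p : H × Ω => p.1 • p.2 := measurable_from_prod_countable_right hm
  refine ⟨Ω, inferInstance, inferInstance, η, hηp, fun p => p.1 • p.2,
    fun ω => (σ ω, (σ ω)⁻¹ • ω), ?_, ?_, ?_, ?_, ?_⟩
  · refine ⟨hθm, Measure.AbsolutelyContinuous.mk fun N hN h0 => ?_⟩
    rw [Measure.map_apply hθm hN, Measure.measure_prod_null (hθm hN)]
    exact ae_of_all _ fun s => hηγ ((hγ s).preimage_null h0)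
  · have hθm' : Measurable fun ω => (σ ω, (σ ω)⁻¹ • ω) :=
      hσm.prodMk (hθm.comp (hσm.inv.prodMk measurable_id))
    refine ⟨hθm', Measure.AbsolutelyContinuous.mk fun M hM h0 => ?_⟩
    rw [Measure.measure_prod_null hM] at h0
    have h1 : ∀ᵐ ω ∂γ, ∀ s : H, s⁻¹ • ω ∉ D ∩ Prod.mk s ⁻¹' M := ae_all_iff.2 fun s =>
      (hγ s⁻¹).ae (measure_eq_zero_iff_ae_notMem.1 (hη0 _ (hatom h0 s)))
    rw [Measure.map_apply hθm' hM, measure_eq_zero_iff_ae_notMem]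
    filter_upwards [h1, hex] with ω k1 ⟨s, hs⟩ hω
    exact k1 (σ ω) ⟨hσ ω s hs, hω⟩
  · filter_upwards [hsnd hηD, hsnd (hηγ.ae_le hfree)] with p h1 h2
    have h3 := hσ (p.1 • p.2) p.1⁻¹ (by rwa [inv_smul_smul])
    rw [← mul_smul] at h3
    have h4 := eq_of_smul_mem_orbitMaxima hΛi h2 h3 (by rwa [one_smul] : (1 : H) • p.2 ∈ D)
    have h5 : σ (p.1 • p.2) = p.1 := inv_mul_eq_one.1 h4
    refine Prod.ext h5 ?_
    change (σ (p.1 • p.2))⁻¹ • p.1 • p.2 = p.2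
    rw [h5, inv_smul_smul]
  · exact ae_of_all _ fun ω => smul_inv_smul _ _
  · exact fun s => ae_of_all _ fun p => mul_smul _ _ _

end FundamentalDomain

/-! ### Standard Borel structures -/

/-- The right uniformity of the group is countably generated, and complete by local compactness. -/
theorem polishSpace_of_locallyCompact (G : Type*) [Group G] [TopologicalSpace G]
    [IsTopologicalGroup G] [T2Space G] [LocallyCompactSpace G] [SecondCountableTopology G] :
    PolishSpace G := by
  let _ := IsTopologicalGroup.rightUniformSpace G
  have : IsRightUniformGroup G := ⟨rfl⟩
  have : CompleteSpace G := IsRightUniformGroup.completeSpace_of_weaklyLocallyCompactSpace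
  have : (uniformity G).IsCountablyGenerated := by
    rw [uniformity_eq_comap_nhds_one]
    infer_instance
  infer_instance

theorem MeasurableEquiv.standardBorelSpace {α β : Type*} [MeasurableSpace α] [MeasurableSpace β]
    [StandardBorelSpace β] (e : α ≃ᵐ β) : StandardBorelSpace α := by
  obtain ⟨tβ, hβ, hpβ⟩ := ‹StandardBorelSpace β›.polish
  let t : TopologicalSpace α := TopologicalSpace.induced e tβ
  have hp : PolishSpace α := e.toEquiv.polishSpace_induced
  have hb : BorelSpace α := ⟨e.measurableEmbedding.comap_eq.symm.trans
    ((congrArg (MeasurableSpace.comap e) hβ.measurable_eq).trans borel_comap.symm)⟩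
  infer_instance

section StandardBorel

variable {G : Type*} [Group G] [TopologicalSpace G] [IsTopologicalGroup G] [T2Space G]
  [LocallyCompactSpace G] [SecondCountableTopology G] [MeasurableSpace G] [BorelSpace G]

theorem BernoulliSpace.standardBorelSpace : StandardBorelSpace (BernoulliSpace G) := by
  have := polishSpace_of_locallyCompact G
  exact StandardBorelSpace.pi_countable (α := fun _ : FreeGroup (Fin 2) => G × G)

theorem SkewSpace.standardBorelSpace : StandardBorelSpace (SkewSpace G) := by
  have := polishSpace_of_locallyCompact G
  have := BernoulliSpace.standardBorelSpace (G := G)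
  exact (SkewSpace.measurableEquivProd G).standardBorelSpace

end StandardBorel

/-! ### Essential freeness -/

/-- The trivial group is amenable. -/
theorem nontrivial_of_not_isAmenableGroup {G : Type*} [Group G] [TopologicalSpace G]
    [IsTopologicalGroup G] (hG : ¬ IsAmenableGroup G) : Nontrivial G := by
  by_contra hn
  rw [not_nontrivial_iff_subsingleton] at hn
  refine hG ⟨⟨⟨fun f => f 1, fun _ _ => rfl⟩, fun _ _ => rfl⟩, fun f hf => hf 1, rfl, fun g f => ?_⟩
  exact congrArg f (Subsingleton.elim _ _)

theorem exists_measurableSet_pos_compl_pos {G : Type*} [Group G] [TopologicalSpace G]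
    [IsTopologicalGroup G] [T2Space G] [LocallyCompactSpace G] [MeasurableSpace G] [BorelSpace G]
    [Nontrivial G] {ν : Measure G} (hν₂ : Measure.haar ≪ ν) :
    ∃ E : Set G, MeasurableSet E ∧ 0 < ν E ∧ 0 < ν Eᶜ := by
  have hpos : ∀ U : Set G, IsOpen U → U.Nonempty → 0 < ν U := fun U hU hne =>
    pos_iff_ne_zero.2 fun h => hU.measure_ne_zero Measure.haar hne (hν₂ h)
  obtain ⟨a, b, hab⟩ := exists_pair_ne G
  obtain ⟨U, V, hU, hV, ha, hb, hd⟩ := t2_separation hab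
  exact ⟨U, hU.measurableSet, hpos U hU ⟨a, ha⟩,
    (hpos V hV ⟨b, hb⟩).trans_le (measure_mono hd.subset_compl_left)⟩

namespace SkewSpace

section

variable {G : Type*} [Group G] [TopologicalSpace G] [IsTopologicalGroup G]
  [LocallyCompactSpace G] [SecondCountableTopology G] [MeasurableSpace G] [BorelSpace G]
  {ν : Measure G} [IsProbabilityMeasure ν]

theorem measurePreserving_base :
    MeasurePreserving (base : SkewSpace G → BernoulliSpace G) (SkewSpace.measure ν)
      (bernoulliMeasure ν) :=
  (measurePreserving_fst (μ := bernoulliMeasure ν) (ν := ν)).comp (measurePreserving_toProd ν)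

theorem isEssentiallyFree_free
    (hfree : IsEssentiallyFree (FreeGroup (Fin 2)) (bernoulliMeasure ν)) :
    IsEssentiallyFree (FreeGroup (Fin 2)) (SkewSpace.measure ν) := by
  filter_upwards [measurePreserving_base.quasiMeasurePreserving.ae hfree] with ω hω s hs
  exact hω s (by rw [← base_smul, hs])

/-- If `g` fixes the orbit of `(x, h)`, then `g • (x, h) = s • (x, h)` for some `s` in the free group.
Comparing the components in `X` gives `s = 1`, and then those in `G` give `g = 1`. -/
theorem isEssentiallyFree_orbit [T2Space G]
    (hfree : IsEssentiallyFree (FreeGroup (Fin 2)) (bernoulliMeasure ν)) :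
    IsEssentiallyFree G (OrbitSpace.measure (FreeGroup (Fin 2)) (SkewSpace.measure ν)) := by
  have := BernoulliSpace.standardBorelSpace (G := G)
  set X₀ : Set (BernoulliSpace G) := {x | ∀ s : FreeGroup (Fin 2), s • x = x → s = 1} with hX₀
  have hX₀m : MeasurableSet X₀ := by
    have : X₀ = ⋂ s : FreeGroup (Fin 2), {x | s • x = x → s = 1} := by
      ext x; simp [hX₀]
    rw [this]
    refine MeasurableSet.iInter fun s => ?_
    by_cases hs : s = 1
    · simp [hs]
    · have : {x : BernoulliSpace G | s • x = x → s = 1} = {x | s • x = x}ᶜ := by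
        ext x; simp [hs]
      rw [this]
      exact (measurableSet_eq_fun (BernoulliSpace.measurable_smul s) measurable_id).compl
  have hX₀inv : ∀ (s : FreeGroup (Fin 2)) (x : BernoulliSpace G), x ∈ X₀ → s • x ∈ X₀ := by
    intro s x hx t ht
    have h := hx (s⁻¹ * t * s) (by rw [mul_smul, mul_smul, ht, inv_smul_smul])
    rwa [mul_assoc, inv_mul_eq_one, eq_comm, mul_eq_right] at h
  -- the orbits over `X₀`
  set B : Set (OrbitSpace (FreeGroup (Fin 2)) (SkewSpace G)) :=
    {y | ∀ ω, OrbitSpace.mk (FreeGroup (Fin 2)) ω = y → ω.base ∈ X₀} with hB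
  have hmk : OrbitSpace.mk (FreeGroup (Fin 2)) ⁻¹' B = base ⁻¹' X₀ := by
    ext ω
    refine ⟨fun h => h ω rfl, fun h ω' hω' => ?_⟩
    obtain ⟨s, rfl⟩ : ∃ s : FreeGroup (Fin 2), s • ω = ω' := Quotient.exact hω'
    rw [base_smul]
    exact hX₀inv s _ h
  have hBm : MeasurableSet B := by
    change MeasurableSet (OrbitSpace.mk (FreeGroup (Fin 2)) ⁻¹' B)
    rw [hmk]
    exact measurable_base hX₀m
  have hBae : ∀ᵐ y ∂OrbitSpace.measure (FreeGroup (Fin 2)) (SkewSpace.measure ν), y ∈ B := by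
    refine (ae_map_iff (p := (· ∈ B)) OrbitSpace.measurable_mk.aemeasurable hBm).2 ?_
    filter_upwards [measurePreserving_base.quasiMeasurePreserving.ae hfree] with ω hω
    exact hmk.symm.subset hω
  filter_upwards [hBae] with y hy g hg
  induction y using Quotient.inductionOn' with
  | h ω =>
    obtain ⟨s, hs⟩ : ∃ s : FreeGroup (Fin 2), s • ω = g • ω := Quotient.exact hg
    have h1 : s • ω.base = ω.base := by rw [← base_smul, hs]; rfl
    rw [hy ω rfl s h1, one_smul] at hs
    have h2 : ω.fiber = ω.fiber * g⁻¹ := congrArg fiber hs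
    exact inv_eq_one.1 (left_eq_mul.1 h2)

/-! ### The measure equivalence embedding -/

theorem isNonsingularAction_free (hν₁ : ν ≪ Measure.haar) (hν₂ : Measure.haar ≪ ν) :
    IsNonsingularAction (FreeGroup (Fin 2)) (SkewSpace.measure ν) := by
  refine ⟨measurable_from_prod_countable_right measurable_smul_free, fun s => ?_⟩
  have h : MeasurePreserving
      (fun q : BernoulliSpace G × G => (s • q.1, cocycle s q.1 * q.2))
      ((bernoulliMeasure ν).prod Measure.haar) ((bernoulliMeasure ν).prod Measure.haar) :=
    (BernoulliSpace.measurePreserving_smul ν s).skew_product (g := fun x h => cocycle s x * h)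
      (((measurable_cocycle s).comp measurable_fst).mul measurable_snd)
      (ae_of_all _ fun p => map_mul_left_eq_self _ _)
  have h' := h.quasiMeasurePreserving.mono (Measure.AbsolutelyContinuous.rfl.prod hν₁)
    (Measure.AbsolutelyContinuous.rfl.prod hν₂)
  have e : (fun ω : SkewSpace G => s • ω) =
      fun ω => (⟨s • ω.base, cocycle s ω.base * ω.fiber⟩ : SkewSpace G) :=
    funext fun ω => smul_mk s ω.base ω.fiber
  rw [e]
  exact ((measurePreserving_mk ν).quasiMeasurePreserving.comp h').comp
    (measurePreserving_toProd ν).quasiMeasurePreserving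

theorem isNonsingularAction_group (hν₁ : ν ≪ Measure.haar) (hν₂ : Measure.haar ≪ ν) :
    IsNonsingularAction G (SkewSpace.measure ν) :=
  ⟨measurable_smul_group, isNonsingular_group hν₁ hν₂⟩

/-- Inversion of the group coordinate; Haar measure and its image under inversion are equivalent. -/
theorem quasiMeasurePreserving_prodMap_inv {m m' : Measure G} [SFinite m] [SFinite m']
    (hm : m ≪ Measure.haar) (hm' : Measure.haar ≪ m') :
    Measure.QuasiMeasurePreserving (fun q : BernoulliSpace G × G => (q.1, q.2⁻¹))
      ((bernoulliMeasure ν).prod m) ((bernoulliMeasure ν).prod m') := by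
  have h1 : Measure.QuasiMeasurePreserving (fun h : G => h⁻¹) m m' :=
    (quasiMeasurePreserving_inv Measure.haar).mono hm hm'
  have h : ((bernoulliMeasure ν).prod m).map (Prod.map id fun h : G => h⁻¹) =
      (bernoulliMeasure ν).prod (m.map fun h : G => h⁻¹) := by
    rw [← Measure.map_prod_map _ _ measurable_id h1.measurable, Measure.map_id]
  exact ⟨measurable_fst.prodMk measurable_snd.inv,
    h.absolutelyContinuous.trans (Measure.AbsolutelyContinuous.rfl.prod h1.absolutelyContinuous)⟩

/-- The action of `G` is isomorphic to translation on `G × X`, by `(k, x) ↦ (x, k⁻¹)`. -/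
theorem isDissipativeEssentiallyFree_group [T2Space G] (hν₁ : ν ≪ Measure.haar)
    (hν₂ : Measure.haar ≪ ν) : IsDissipativeEssentiallyFree G (SkewSpace.measure ν) := by
  refine ⟨BernoulliSpace G, inferInstance, BernoulliSpace.standardBorelSpace, bernoulliMeasure ν,
    inferInstance, fun p => ⟨p.2, p.1⁻¹⟩, fun ω => (ω.fiber⁻¹, ω.base), ?_, ?_, ?_, ?_, ?_⟩
  · exact (measurePreserving_mk ν).quasiMeasurePreserving.comp
      ((quasiMeasurePreserving_prodMap_inv Measure.AbsolutelyContinuous.rfl hν₂).comp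
        Measure.measurePreserving_swap.quasiMeasurePreserving)
  · exact Measure.measurePreserving_swap.quasiMeasurePreserving.comp
      ((quasiMeasurePreserving_prodMap_inv hν₁ Measure.AbsolutelyContinuous.rfl).comp
        (measurePreserving_toProd ν).quasiMeasurePreserving)
  · exact ae_of_all _ fun p => Prod.ext (inv_inv p.1) rfl
  · exact ae_of_all _ fun ω => congrArg (SkewSpace.mk ω.base) (inv_inv ω.fiber)
  · exact fun g => ae_of_all _ fun p => congrArg (SkewSpace.mk p.2) (mul_inv_rev g p.1)

/-- The orbit space of `G` is a quotient of `X`, because the orbit of `(x, h)` contains `(x, 1)`. -/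
theorem exists_invariant_measure_orbit :
    ∃ η : Measure (OrbitSpace G (SkewSpace G)), IsProbabilityMeasure η ∧
      η ≪ OrbitSpace.measure G (SkewSpace.measure ν) ∧
      OrbitSpace.measure G (SkewSpace.measure ν) ≪ η ∧
      letI : SMulCommClass G (FreeGroup (Fin 2)) (SkewSpace G) := SMulCommClass.symm _ _ _
      ∀ s : FreeGroup (Fin 2),
        MeasurePreserving (fun y : OrbitSpace G (SkewSpace G) => s • y) η η := by
  let _ : SMulCommClass G (FreeGroup (Fin 2)) (SkewSpace G) := SMulCommClass.symm _ _ _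
  set j : BernoulliSpace G → OrbitSpace G (SkewSpace G) := fun x => OrbitSpace.mk G ⟨x, 1⟩ with hj
  have hjm : Measurable j := OrbitSpace.measurable_mk.comp
    (measurable_mk.comp (measurable_id.prodMk measurable_const))
  have hmk : OrbitSpace.mk G = j ∘ (base : SkewSpace G → BernoulliSpace G) := by
    funext ω
    refine Quotient.sound' ⟨ω.fiber⁻¹, ?_⟩
    change ω.fiber⁻¹ • (⟨ω.base, 1⟩ : SkewSpace G) = ω
    rw [smul_def, inv_inv, one_mul]
  have hη : OrbitSpace.measure G (SkewSpace.measure ν) = (bernoulliMeasure ν).map j := by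
    rw [OrbitSpace.measure, hmk, ← Measure.map_map hjm measurable_base,
      measurePreserving_base.map_eq]
  refine ⟨OrbitSpace.measure G (SkewSpace.measure ν),
    Measure.isProbabilityMeasure_map OrbitSpace.measurable_mk.aemeasurable,
    Measure.AbsolutelyContinuous.rfl, Measure.AbsolutelyContinuous.rfl, fun s => ?_⟩
  have hs := OrbitSpace.measurable_smul (H := G) (measurable_smul_free (G := G) s)
  have hsj : (fun y : OrbitSpace G (SkewSpace G) => s • y) ∘ j = j ∘ fun x => s • x := by
    funext x
    change OrbitSpace.mk G (s • (⟨x, 1⟩ : SkewSpace G)) = _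
    rw [hmk, Function.comp_apply, base_smul]
    rfl
  refine ⟨hs, ?_⟩
  rw [hη, Measure.map_map hs hjm, hsj,
    ← Measure.map_map hjm (BernoulliSpace.measurable_smul s),
    (BernoulliSpace.measurePreserving_smul ν s).map_eq]

theorem isMEEmbedding [T2Space G] (hν₁ : ν ≪ Measure.haar) (hν₂ : Measure.haar ≪ ν)
    (hν : ‖convolutionOperator ν‖ < 1 / 3)
    (hfree : IsEssentiallyFree (FreeGroup (Fin 2)) (bernoulliMeasure ν)) :
    IsMEEmbedding (FreeGroup (Fin 2)) G (SkewSpace.measure ν) := by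
  have := SkewSpace.standardBorelSpace (G := G)
  have hns := isNonsingularAction_free hν₁ hν₂
  obtain ⟨φ, hφm, hφ, hsum⟩ := exists_tsum_lt_top hν₁ hν
  exact
    { isCorrespondence :=
        { standardBorel := this
          isProbabilityMeasure := inferInstance
          nonsingular_left := hns
          nonsingular_right := isNonsingularAction_group hν₁ hν₂
          dissipative_left := isDissipativeEssentiallyFree_of_tsum_lt_top hns.2
            (isEssentiallyFree_free hfree)
            (measurable_coe_nnreal_ennreal.comp (hφm.comp measurable_fiber))
            (fun ω => by simpa using (hφ ω.fiber).ne') hsum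
          dissipative_right := isDissipativeEssentiallyFree_group hν₁ hν₂ }
      exists_invariant := exists_invariant_measure_orbit }

end

end SkewSpace

end

theorem theoremA {G : Type u} [Group G] [TopologicalSpace G] [IsTopologicalGroup G]
    [T2Space G] [LocallyCompactSpace G] [SecondCountableTopology G]
    [MeasurableSpace G] [BorelSpace G] (hG : ¬ IsAmenableGroup G)
    (ν : Measure G) [IsProbabilityMeasure ν]
    (hν₁ : ν ≪ Measure.haar) (hν₂ : Measure.haar ≪ ν)
    (hν : ‖convolutionOperator ν‖ < 1 / 3) :
    -- the action of `F₂ × G` on `(Ω, γ)` is a measure equivalence embedding of `F₂` into `G`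
    IsMEEmbedding (FreeGroup (Fin 2)) G (SkewSpace.measure ν) ∧
    -- the nonsingular action of `G` on `F₂ \ Ω` is essentially free and weakly mixing
    (IsNonsingular G (OrbitSpace.measure (FreeGroup (Fin 2)) (SkewSpace.measure ν)) ∧
      IsEssentiallyFree G (OrbitSpace.measure (FreeGroup (Fin 2)) (SkewSpace.measure ν)) ∧
      IsWeaklyMixingAction.{w} G
        (OrbitSpace.measure (FreeGroup (Fin 2)) (SkewSpace.measure ν))) ∧
    -- the action of `G` on `F₂ \ Ω` is stably strongly ergodic
    IsStablyStronglyErgodicAction.{w} G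
      (OrbitSpace.measure (FreeGroup (Fin 2)) (SkewSpace.measure ν)) := by
  have := nontrivial_of_not_isAmenableGroup hG
  obtain ⟨E, hE, hE0, hE1⟩ := exists_measurableSet_pos_compl_pos hν₂
  have hfree : IsEssentiallyFree (FreeGroup (Fin 2)) (bernoulliMeasure ν) :=
    BernoulliSpace.ae_smul_ne ν hE hE0 hE1
  exact ⟨SkewSpace.isMEEmbedding hν₁ hν₂ hν hfree,
    ⟨SkewSpace.isNonsingular_orbit hν₁ hν₂, SkewSpace.isEssentiallyFree_orbit hfree,
      fun _ _ _ _ hpmp herg => SkewSpace.isErgodicAction_prod hν₁ hν₂ hpmp herg⟩,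
    SkewSpace.isStronglyErgodicAction_orbit hν₁ hν₂,
    fun _ _ _ _ hpmp herg => SkewSpace.isStronglyErgodicAction_prod hν₁ hν₂ hpmp herg⟩
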